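/- Let $n\ge 1$, let $I\subset\mathbb R$ be a bounded open interval of length $\ell>0$, let $\Omega\subset\mathbb R^n$ be a bounded open set, and let $b\in L^1_{\mathrm{loc}}(I;W^{1,1}_{\mathrm{loc}}(\Omega;\mathbb R^n))$ be (essentially) bounded, with spatial weak derivative $D_xb$; let $\|\cdot\|$ be the operator norm of matrices and $\sup|b|$ the essential supremum of $|b|$ on $I\times\Omega$. Assume that for some real $p>2n$ $$\Lambda_p:=\int_\Omega\int_I \max\left\{\ell^{\frac{n}{n-p}},\ \frac{\operatorname{dist}(x,\partial\Omega)^{\frac{n}{n-p}}}{(\sup|b|)^{\frac{n}{n-p}}}\right\}\exp\left(\frac{\ell p^2}{p-n}\,\|D_xb(s,x)\|\right)ds\,dx<+\infty ,$$ (the quotient being $0$ if $\sup|b|=0$). Then $b$ has a space-continuous representative, that is, some $\tilde b$ such that for a.e. $t\in I$ the field $\tilde b(t,\cdot)$ is continuous on $\Omega$ and equals $b(t,\cdot)$ a.e. in $\Omega$, and every such $\tilde b$ has the following properties. (i) $\tilde b$ is well-posed in $\overline I\times\Omega$: for every $(s,x)\in\overline I\times\Omega$ and all sufficiently small $\delta>0$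 there is exactly one absolutely continuous $\gamma:\overline I\cap(s-\delta,s+\delta)\to\Omega$ with $\dot\gamma(t)=\tilde b(t,\gamma(t))$ for a.e. $t$ and $\gamma(s)=x$. For $s,t\in I$ let $\Omega_{(t,s)}$ be the set of the $x\in\Omega$ for which the maximal solution $\gamma_{(s,x)}$ in $\Omega$, on an open subinterval of $I$, with $\gamma_{(s,x)}(s)=x$ is defined at time $t$, and for such $x$ let $X(t,s,x):=\gamma_{(s,x)}(t)$. The sets $\Omega_{(t,s)}$ are open. (ii) For every $t\in I$, for a.e. $s\in I$, $$X(t,s,\cdot)\in W^{1,p}(\Omega_{(t,s)};\mathbb R^n)\quad\text{and}\quad X(s,t,\cdot)\in W^{1,p}(\Omega_{(s,t)};\mathbb R^n).$$ (iii) For every $t\in I$, with $D_xX$ the weak derivative (which has a representative jointly measurable in $(s,x)$), $$\int_I\int_{\Omega_{(t,s)}}\|D_xX(t,s,x)\|^p\,dx\,ds\le \ell^{\frac{n}{p-n}}\,\Lambda_p .$$ -/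

import Mathlib

open MeasureTheory Set
open scoped ENNReal

/-! ### Sobolev functions and weak derivatives -/

/-- `Du` is the weak differential on the open set `U` of the function `u`, both being locally
integrable on `U`: `∫ ∂ᵥφ • u = - ∫ φ • (Du v)` for all `φ ∈ C_c^∞(U)` and all directions `v`. -/
structure HasWeakFDerivOn {n : ℕ} (U : Set (EuclideanSpace ℝ (Fin n)))
    (u : EuclideanSpace ℝ (Fin n) → EuclideanSpace ℝ (Fin n))
    (Du : EuclideanSpace ℝ (Fin n) →
      EuclideanSpace ℝ (Fin n) →L[ℝ] EuclideanSpace ℝ (Fin n)) : Prop where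
  locInt : LocallyIntegrableOn u U volume
  locInt_deriv : LocallyIntegrableOn Du U volume
  integral_eq : ∀ φ : EuclideanSpace ℝ (Fin n) → ℝ, ContDiff ℝ (⊤ : ℕ∞) φ → HasCompactSupport φ →
    tsupport φ ⊆ U → ∀ v : EuclideanSpace ℝ (Fin n),
      ∫ x, (fderiv ℝ φ x v) • u x = - ∫ x, φ x • Du x v

/-- `u ∈ W^{1,p}(U; ℝⁿ)`. -/
def MemW1p {n : ℕ} (U : Set (EuclideanSpace ℝ (Fin n))) (p : ℝ)
    (u : EuclideanSpace ℝ (Fin n) → EuclideanSpace ℝ (Fin n)) : Prop :=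
  MemLp u (ENNReal.ofReal p) (volume.restrict U) ∧
    ∃ Du : EuclideanSpace ℝ (Fin n) → EuclideanSpace ℝ (Fin n) →L[ℝ] EuclideanSpace ℝ (Fin n),
      HasWeakFDerivOn U u Du ∧ MemLp Du (ENNReal.ofReal p) (volume.restrict U)

/-- `b ∈ L¹_loc(I; W^{1,1}_loc(Ω; ℝⁿ))`, with spatial weak derivative `D_x b = Db`. -/
structure MemL1locW11loc {n : ℕ} (I : Set ℝ) (Ω : Set (EuclideanSpace ℝ (Fin n)))
    (b : ℝ → EuclideanSpace ℝ (Fin n) → EuclideanSpace ℝ (Fin n))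
    (Db : ℝ → EuclideanSpace ℝ (Fin n) →
      EuclideanSpace ℝ (Fin n) →L[ℝ] EuclideanSpace ℝ (Fin n)) : Prop where
  locInt : LocallyIntegrableOn (Function.uncurry b) (I ×ˢ Ω) volume
  locInt_deriv : LocallyIntegrableOn (Function.uncurry Db) (I ×ˢ Ω) volume
  weakDeriv : ∀ᵐ t ∂(volume.restrict I), HasWeakFDerivOn Ω (b t) (Db t)

/-- `b'` is a space-continuous representative of `b`: for a.e. `t ∈ I` the field `b' t` is
continuous on `Ω` and agrees with `b t` almost everywhere on `Ω`. -/
def IsSpaceContinuousRep {n : ℕ} (I : Set ℝ) (Ω : Set (EuclideanSpace ℝ (Fin n)))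
    (b b' : ℝ → EuclideanSpace ℝ (Fin n) → EuclideanSpace ℝ (Fin n)) : Prop :=
  ∀ᵐ t ∂(volume.restrict I), ContinuousOn (b' t) Ω ∧ b' t =ᵐ[volume.restrict Ω] b t

/-! ### Solutions, well-posedness, flow -/

/-- `γ : J → Ω` is a (locally) absolutely continuous solution of `γ' (t) = b (t, γ t)` on the
interval `J`. -/
structure IsACSolutionOn {n : ℕ}
    (b : ℝ → EuclideanSpace ℝ (Fin n) → EuclideanSpace ℝ (Fin n))
    (Ω : Set (EuclideanSpace ℝ (Fin n))) (J : Set ℝ) (γ : ℝ → EuclideanSpace ℝ (Fin n)) :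
    Prop where
  mapsTo : MapsTo γ J Ω
  absCont : ∀ c ∈ J, ∀ d ∈ J, AbsolutelyContinuousOnInterval γ c d
  deriv : ∀ᵐ t ∂(volume.restrict J), HasDerivAt γ (b t (γ t)) t

/-- `b` is well-posed in `T × Ω` (`T` an interval): for all `(s, x) ∈ T × Ω` and all small enough
`δ > 0` there is exactly one absolutely continuous solution in `Ω` on `T ∩ (s - δ, s + δ)` with
value `x` at time `s`. -/
def WellPosed {n : ℕ} (b : ℝ → EuclideanSpace ℝ (Fin n) → EuclideanSpace ℝ (Fin n))
    (T : Set ℝ) (Ω : Set (EuclideanSpace ℝ (Fin n))) : Prop :=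
  ∀ s ∈ T, ∀ x ∈ Ω, ∃ ε > 0, ∀ δ : ℝ, 0 < δ → δ ≤ ε →
    (∃ γ, IsACSolutionOn b Ω (T ∩ Ioo (s - δ) (s + δ)) γ ∧ γ s = x) ∧
    ∀ γ₁ γ₂, IsACSolutionOn b Ω (T ∩ Ioo (s - δ) (s + δ)) γ₁ → γ₁ s = x →
      IsACSolutionOn b Ω (T ∩ Ioo (s - δ) (s + δ)) γ₂ → γ₂ s = x →
      EqOn γ₁ γ₂ (T ∩ Ioo (s - δ) (s + δ))

/-- Some solution of the equation, defined on an open interval `J ⊆ I` containing `s` and `t`,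
is at `x` at time `s` and at `y` at time `t`. In other words `t` is in the maximal interval of
existence `I_{(s,x)}`, and the maximal solution is at `y` at time `t`. -/
def Reaches {n : ℕ} (b : ℝ → EuclideanSpace ℝ (Fin n) → EuclideanSpace ℝ (Fin n))
    (I : Set ℝ) (Ω : Set (EuclideanSpace ℝ (Fin n))) (t s : ℝ)
    (x y : EuclideanSpace ℝ (Fin n)) : Prop :=
  ∃ J : Set ℝ, IsOpen J ∧ J.OrdConnected ∧ J ⊆ I ∧ s ∈ J ∧ t ∈ J ∧
    ∃ γ, IsACSolutionOn b Ω J γ ∧ γ s = x ∧ γ t = y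

/-- Restriction of a solution to a subset. -/
theorem IsACSolutionOn.mono {n : ℕ}
    {b : ℝ → EuclideanSpace ℝ (Fin n) → EuclideanSpace ℝ (Fin n)}
    {Ω : Set (EuclideanSpace ℝ (Fin n))} {J J' : Set ℝ} {γ : ℝ → EuclideanSpace ℝ (Fin n)}
    (h : IsACSolutionOn b Ω J γ) (hJ : J' ⊆ J) : IsACSolutionOn b Ω J' γ where
  mapsTo := h.mapsTo.mono_left hJ
  absCont c hc d hd := h.absCont c (hJ hc) d (hJ hd)
  deriv := ae_restrict_of_ae_restrict_of_subset hJ h.deriv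

/-- A solution is continuous at interior times. -/
theorem IsACSolutionOn.continuousAt {n : ℕ}
    {b : ℝ → EuclideanSpace ℝ (Fin n) → EuclideanSpace ℝ (Fin n)}
    {Ω : Set (EuclideanSpace ℝ (Fin n))} {J : Set ℝ} {γ : ℝ → EuclideanSpace ℝ (Fin n)}
    (h : IsACSolutionOn b Ω J γ) (hJ : IsOpen J) {τ : ℝ} (hτ : τ ∈ J) : ContinuousAt γ τ := by
  obtain ⟨η, hη, hball⟩ := Metric.isOpen_iff.1 hJ τ hτ
  rw [Real.ball_eq_Ioo] at hball
  have hc := (h.absCont (τ - η / 2) (hball ⟨by linarith, by linarith⟩) (τ + η / 2)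
    (hball ⟨by linarith, by linarith⟩)).continuousOn
  refine hc.continuousAt ?_
  rw [uIcc_of_le (by linarith)]
  exact Icc_mem_nhds (by linarith) (by linarith)

/-- For a well-posed field the point reached from `x` does not depend on the choice of a solution,
so that the flow below is well defined. -/
theorem Reaches.unique {n : ℕ}
    {b : ℝ → EuclideanSpace ℝ (Fin n) → EuclideanSpace ℝ (Fin n)} {T I : Set ℝ}
    {Ω : Set (EuclideanSpace ℝ (Fin n))} (hb : WellPosed b T Ω) (hI : I ⊆ T) {t s : ℝ}
    {x y₁ y₂ : EuclideanSpace ℝ (Fin n)} (h₁ : Reaches b I Ω t s x y₁)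
    (h₂ : Reaches b I Ω t s x y₂) : y₁ = y₂ := by
  obtain ⟨J₁, o₁, c₁, i₁, s₁, t₁, γ₁, g₁, gs₁, gt₁⟩ := h₁
  obtain ⟨J₂, o₂, c₂, i₂, s₂, t₂, γ₂, g₂, gs₂, gt₂⟩ := h₂
  have hop : ∀ τ ∈ J₁ ∩ J₂, γ₁ τ = γ₂ τ → ∃ δ > 0, ∀ τ' ∈ Ioo (τ - δ) (τ + δ),
      τ' ∈ J₁ ∩ J₂ ∧ γ₁ τ' = γ₂ τ' := by
    intro τ hτJ heq
    obtain ⟨ε, hε, H⟩ := hb τ (hI (i₁ hτJ.1)) (γ₁ τ) (g₁.mapsTo hτJ.1)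
    obtain ⟨η, hη, hball⟩ := Metric.isOpen_iff.1 (o₁.inter o₂) τ hτJ
    rw [Real.ball_eq_Ioo] at hball
    have hsub' : Ioo (τ - min ε η) (τ + min ε η) ⊆ J₁ ∩ J₂ :=
      (Ioo_subset_Ioo (by linarith [min_le_right ε η]) (by linarith [min_le_right ε η])).trans
        hball
    refine ⟨min ε η, lt_min hε hη, fun τ' hτ' => ⟨hsub' hτ', ?_⟩⟩
    exact (H (min ε η) (lt_min hε hη) (min_le_left _ _)).2 γ₁ γ₂
      (g₁.mono fun z hz => (hsub' hz.2).1) rfl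
      (g₂.mono fun z hz => (hsub' hz.2).2) heq.symm ⟨hI (i₁ (hsub' hτ').1), hτ'⟩
  have hsub : J₁ ∩ J₂ ⊆ {τ | τ ∈ J₁ ∩ J₂ ∧ γ₁ τ = γ₂ τ} := by
    refine (c₁.inter c₂).isPreconnected.subset_of_closure_inter_subset ?_
      ⟨s, ⟨s₁, s₂⟩, ⟨s₁, s₂⟩, gs₁.trans gs₂.symm⟩ ?_
    · rw [Metric.isOpen_iff]
      rintro τ ⟨hτ, heq⟩
      obtain ⟨δ, hδ, h⟩ := hop τ hτ heq
      exact ⟨δ, hδ, fun σ hσ => h σ (by rwa [Real.ball_eq_Ioo] at hσ)⟩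
    · rintro τ ⟨hcl, hτ⟩
      refine ⟨hτ, by_contra fun hne => ?_⟩
      have hev := ((g₁.continuousAt o₁ hτ.1).sub (g₂.continuousAt o₂ hτ.2)).eventually_ne
        (sub_ne_zero.2 hne)
      obtain ⟨σ, hσ, hσ'⟩ := ((mem_closure_iff_frequently.1 hcl).and_eventually hev).exists
      exact hσ' (sub_eq_zero.2 hσ.2)
  rw [← gt₁, ← gt₂]
  exact (hsub ⟨t₁, t₂⟩).2

/-- The domain `Ω_{(t,s)}` of the flow map from time `s` to time `t`. -/
def flowDomain {n : ℕ} (b : ℝ → EuclideanSpace ℝ (Fin n) → EuclideanSpace ℝ (Fin n))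
    (I : Set ℝ) (Ω : Set (EuclideanSpace ℝ (Fin n))) (t s : ℝ) :
    Set (EuclideanSpace ℝ (Fin n)) :=
  {x | ∃ y, Reaches b I Ω t s x y}

open Classical in
/-- The flow `X(t, s, x)`, for `x ∈ Ω_{(t,s)}` (with the irrelevant value `x` elsewhere). -/
noncomputable def flow {n : ℕ}
    (b : ℝ → EuclideanSpace ℝ (Fin n) → EuclideanSpace ℝ (Fin n))
    (I : Set ℝ) (Ω : Set (EuclideanSpace ℝ (Fin n))) (t s : ℝ)
    (x : EuclideanSpace ℝ (Fin n)) : EuclideanSpace ℝ (Fin n) :=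
  if h : ∃ y, Reaches b I Ω t s x y then h.choose else x

/-! ### The geometric condition -/

/-- `Λ_p = ∫_Ω ∫_I max {ℓ^α, dist(x, ∂Ω)^α / (sup |b|)^α} exp (ℓ p² / (p - n) ‖D_x b(s,x)‖) ds dx`
with `α = n / (n - p)`, for `I` an interval of length `ℓ`; `sup |b|` is the essential supremum of
`|b|` on `I × Ω`. -/
noncomputable def geometricConst {n : ℕ} (I : Set ℝ) (ℓ : ℝ)
    (Ω : Set (EuclideanSpace ℝ (Fin n))) (p : ℝ)
    (b : ℝ → EuclideanSpace ℝ (Fin n) → EuclideanSpace ℝ (Fin n))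
    (Db : ℝ → EuclideanSpace ℝ (Fin n) →
      EuclideanSpace ℝ (Fin n) →L[ℝ] EuclideanSpace ℝ (Fin n)) : ℝ≥0∞ :=
  ∫⁻ x in Ω, ∫⁻ s in I,
    max (ENNReal.ofReal ℓ ^ ((n : ℝ) / (n - p)))
        (Metric.infEDist x (frontier Ω) ^ ((n : ℝ) / (n - p)) /
          eLpNorm (Function.uncurry b) ⊤ (volume.restrict (I ×ˢ Ω)) ^ ((n : ℝ) / (n - p))) *
      ENNReal.ofReal (Real.exp (ℓ * p ^ 2 / (p - n) * ‖Db s x‖))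

/-!
The proof rests on one mechanism: exponential integrability of `D_x b` makes `b` almost Lipschitz,
and the exponent `ℓ p² / (p - n)` is large enough for this to be propagated over the whole interval.

*Regularity of the field.* Mollification commutes with the weak derivative, so Jensen's inequality
for `exp (a ‖·‖)` and the bound `C η⁻ⁿ` of the mollifying kernel show that the mollified field
`b_η` has `‖D b_η‖ ≤ a⁻¹ (C F + n log (1 / η))`, where `F (t)` bounds the exponential integral at
time `t` (`ExpSobolev.norm_mollDeriv_le`). Since a logarithm is integrable near zero, mollifications
at scales `κ, η` differ by `O(√η + √κ)` (`ExpSobolev.norm_moll_sub_moll_le`), so they converge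
locally uniformly to a continuous representative (`ExpSobolev.exists_continuousOn`).

*Stability of trajectories.* Grönwall's inequality for two curves that nearly follow `b_η` loses a
factor `exp (ℓ a⁻¹ n log (1 / η))`. With `a = ℓ p² / (p - n)` the inequality `(p - 2 n)² ≥ 0`
amounts to `4 n ℓ ≤ a`, so the loss is at most a multiple of `η ^ (-1/4)`, which the gain `√η`
outweighs (`ExpSobolevField.norm_curve_sub_le`). Hence solutions are unique, and trajectories of the
mollified fields converge, uniformly near each point of a flow domain, to solutions of the limit
equation (`ExpSobolevField.wellPosed`, `ExpSobolevField.exists_ball_flow`); this also gives the openness of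
the flow domains.

*The energy of the flow.* For a smooth field, `‖D_x X (t, s, x)‖ ≤ exp ∫ ‖D_x b‖` along the
trajectory, and Jensen's inequality in time bounds its `p`-th power by the mean of
`exp (p ℓ ‖D_x b‖)` over the lifespan of the trajectory (`IsTaylorField.enorm_fderiv_rpow_le`).
The change of variables `x = X (s, r, y)` has Jacobian at most `‖D_y X (s, r, y)‖ⁿ`, so Hölder's
inequality with exponents `p / (p - n)` and `p / n` makes the energy reappear on the right with a
power less than one, and it is absorbed (`IsTaylorField.flowEnergy_le_fieldEnergy`). The weight left
over is a negative power of the lifespan. Trajectories are followed while they stay at distance more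
than `σ²` from the boundary, and only those that come to distance more than `σ` are retained; their
lifespan is, up to a factor tending to `1`, at least the smaller of `ℓ` and of distance over speed
(`ofReal_mul_le_lifespan`), so the weight is bounded by the one in the hypothesis
(`ExpSobolevField.fieldEnergy_mollField_le`, with mollification at scale `σ⁴`).

*Passage to the limit.* The differentials of the approximate flows are bounded in `Lᵖ`, hence in
`L²`, and convex combinations of them converge almost everywhere and in almost every time slice
(`exists_slicewise_weakLimit`). The limit is the weak derivative of the flow, because the
approximate flows converge locally uniformly, and Fatou's lemma preserves the energy bound
(`ExpSobolevField.exists_weakFDeriv_flow`).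
-/

open Filter Topology Function

/-! ### Grönwall's inequality with an integrable coefficient -/

theorem AbsolutelyContinuousOnInterval.lipschitz_comp {f : ℝ → ℝ} {a b : ℝ} {g : ℝ → ℝ}
    (hf : AbsolutelyContinuousOnInterval f a b) {C : ℝ}
    (hg : ∀ x ∈ uIcc a b, ∀ y ∈ uIcc a b, |g (f x) - g (f y)| ≤ C * |f x - f y|) :
    AbsolutelyContinuousOnInterval (fun x => g (f x)) a b := by
  rw [absolutelyContinuousOnInterval_iff] at hf ⊢
  intro ε hε
  have hC : 0 < |C| + 1 := by positivity
  obtain ⟨δ, hδ, H⟩ := hf (ε / (|C| + 1)) (div_pos hε hC)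
  refine ⟨δ, hδ, fun N hN hlt => ?_⟩
  have h1 := H N hN hlt
  rw [lt_div_iff₀ hC] at h1
  refine lt_of_le_of_lt ?_ h1
  rw [Finset.sum_mul]
  refine Finset.sum_le_sum fun i hi => ?_
  have hmem := hN.1 i hi
  rw [Real.dist_eq, Real.dist_eq]
  refine (hg _ hmem.1 _ hmem.2).trans ?_
  rw [mul_comm]
  exact mul_le_mul_of_nonneg_left ((le_abs_self C).trans (by linarith)) (abs_nonneg _)

/-- Grönwall's inequality forward in time. The coefficient is only integrable, so the proof
differentiates absolutely continuous functions almost everywhere. -/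
theorem gronwall_integral_forward {u k : ℝ → ℝ} {a s t : ℝ} (hst : s ≤ t)
    (hu : ContinuousOn u (Icc s t)) (hk : IntervalIntegrable k volume s t)
    (hk0 : ∀ᵐ r, r ∈ Ioc s t → 0 ≤ k r)
    (h : ∀ r ∈ Icc s t, u r ≤ a + ∫ τ in s..r, k τ * u τ) :
    u t ≤ a * Real.exp (∫ τ in s..t, k τ) := by
  have hku : IntervalIntegrable (fun τ => k τ * u τ) volume s t :=
    hk.mul_continuousOn (by rwa [uIcc_of_le hst])
  set v : ℝ → ℝ := fun r => ∫ τ in s..r, k τ * u τ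
  set K : ℝ → ℝ := fun r => ∫ τ in s..r, k τ
  have hvAC : AbsolutelyContinuousOnInterval v s t :=
    hku.absolutelyContinuousOnInterval_intervalIntegral (c := s) left_mem_uIcc
  have hKAC : AbsolutelyContinuousOnInterval K s t :=
    hk.absolutelyContinuousOnInterval_intervalIntegral (c := s) left_mem_uIcc
  have hcst : AbsolutelyContinuousOnInterval (fun _ : ℝ => a) s t :=
    LipschitzOnWith.absolutelyContinuousOnInterval (K := 0)
      (LipschitzWith.const a).lipschitzOnWith
  have hWAC : AbsolutelyContinuousOnInterval (fun r => Real.exp (-(K r))) s t := by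
    have hcomp : IsCompact (K '' uIcc s t) := isCompact_uIcc.image_of_continuousOn hKAC.continuousOn
    obtain ⟨R, hR⟩ := hcomp.isBounded.subset_closedBall 0
    have hRK : ∀ x ∈ uIcc s t, -(K x) ≤ R := fun x hx => by
      have := hR (mem_image_of_mem K hx)
      rw [mem_closedBall_zero_iff, Real.norm_eq_abs] at this
      exact (neg_le_abs _).trans this
    refine hKAC.lipschitz_comp (g := fun y => Real.exp (-y)) (C := Real.exp R) ?_
    intro x hx y hy
    have hconv : Convex ℝ {z : ℝ | -z ≤ R} := by
      have : {z : ℝ | -z ≤ R} = Ici (-R) := by ext z; simp [neg_le]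
      rw [this]; exact convex_Ici _
    have := hconv.norm_image_sub_le_of_norm_hasDerivWithin_le
      (f := fun y => Real.exp (-y)) (f' := fun y => - Real.exp (-y)) (C := Real.exp R)
      (fun z _ => by simpa using ((hasDerivAt_neg z).exp).hasDerivWithinAt)
      (fun z hz => by
        rw [norm_neg, Real.norm_eq_abs, abs_of_pos (Real.exp_pos _)]
        exact Real.exp_le_exp.2 hz) (hRK y hy) (hRK x hx)
    simpa [Real.norm_eq_abs] using this
  set f : ℝ → ℝ := fun r => (a + v r) * Real.exp (-(K r))
  have hfAC : AbsolutelyContinuousOnInterval f s t := (hcst.add hvAC).mul hWAC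
  have hderiv : ∀ᵐ r, r ∈ Ioc s t → deriv f r ≤ 0 := by
    have h1 := hku.ae_hasDerivAt_integral
    have h2 := hk.ae_hasDerivAt_integral
    filter_upwards [h1, h2, hk0] with r h1 h2 h3 hr
    have hr' : r ∈ uIcc s t := by rw [uIcc_of_le hst]; exact Ioc_subset_Icc_self hr
    have h1' := h1 hr' s left_mem_uIcc
    have h2' := h2 hr' s left_mem_uIcc
    have hd : HasDerivAt f (k r * u r * Real.exp (-(K r)) +
        (a + v r) * (Real.exp (-(K r)) * (-(k r)))) r :=
      (h1'.const_add a).mul (h2'.neg.exp)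
    rw [hd.deriv]
    have := h r (Ioc_subset_Icc_self hr)
    have he := Real.exp_pos (-(K r))
    have : k r * u r ≤ k r * (a + v r) := mul_le_mul_of_nonneg_left this (h3 hr)
    nlinarith [mul_le_mul_of_nonneg_right this he.le]
  have hint := hfAC.integral_deriv_eq_sub
  have hle : ∫ x in s..t, deriv f x ≤ 0 := by
    rw [intervalIntegral.integral_of_le hst]
    exact integral_nonpos_of_ae ((ae_restrict_iff' measurableSet_Ioc).2 hderiv)
  have hfs : f s = a := by simp [f, v, K]
  have hft : f t ≤ a := by linarith
  have hut := h t (right_mem_Icc.2 hst)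
  calc u t ≤ a + v t := hut
    _ = f t * Real.exp (K t) := by
        simp only [f]; rw [mul_assoc, ← Real.exp_add]; simp
    _ ≤ a * Real.exp (K t) := mul_le_mul_of_nonneg_right hft (Real.exp_pos _).le

/-- Grönwall's inequality, with an integrable coefficient and in both time directions. -/
theorem gronwall_integral {u k : ℝ → ℝ} {a s t : ℝ}
    (hu : ContinuousOn u (uIcc s t)) (hk : IntervalIntegrable k volume s t)
    (hk0 : ∀ᵐ r, r ∈ uIoc s t → 0 ≤ k r) (hu0 : ∀ r ∈ uIcc s t, 0 ≤ u r)
    (h : ∀ r ∈ uIcc s t, u r ≤ a + |∫ τ in s..r, k τ * u τ|) :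
    u t ≤ a * Real.exp |∫ τ in s..t, k τ| := by
  rcases le_total s t with hst | hst
  · rw [uIoc_of_le hst] at hk0
    rw [uIcc_of_le hst] at hu h hu0
    have hnn : ∀ r ∈ Icc s t, 0 ≤ ∫ τ in s..r, k τ * u τ := fun r hr => by
      rw [intervalIntegral.integral_of_le hr.1]
      refine integral_nonneg_of_ae ((ae_restrict_iff' measurableSet_Ioc).2 ?_)
      filter_upwards [hk0] with τ hτ h'
      exact mul_nonneg (hτ ⟨h'.1, h'.2.trans hr.2⟩) (hu0 τ ⟨h'.1.le, h'.2.trans hr.2⟩)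
    have hnk : 0 ≤ ∫ τ in s..t, k τ := by
      rw [intervalIntegral.integral_of_le hst]
      exact integral_nonneg_of_ae ((ae_restrict_iff' measurableSet_Ioc).2 hk0)
    rw [abs_of_nonneg hnk]
    refine gronwall_integral_forward hst hu hk hk0 fun r hr => ?_
    simpa [abs_of_nonneg (hnn r hr)] using h r hr
  · rw [uIoc_of_ge hst] at hk0
    rw [uIcc_of_ge hst] at hu h hu0
    have hne : ∀ f : ℝ → ℝ, ∀ r, ∫ τ in (-s)..r, f (-τ) = - ∫ τ in s..(-r), f τ := fun f r => by
      rw [intervalIntegral.integral_comp_neg, neg_neg, intervalIntegral.integral_symm]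
    have hk0' : ∀ᵐ r, r ∈ Icc t s → 0 ≤ k r := by
      have : ∀ᵐ r : ℝ, r ≠ t := by
        simp [ae_iff]
      filter_upwards [this, hk0] with r h1 h2 h3
      exact h2 ⟨lt_of_le_of_ne h3.1 h1.symm, h3.2⟩
    have hnn : ∀ r ∈ Icc t s, 0 ≤ - ∫ τ in s..r, k τ * u τ := fun r hr => by
      rw [← intervalIntegral.integral_symm, intervalIntegral.integral_of_le hr.2]
      refine integral_nonneg_of_ae ((ae_restrict_iff' measurableSet_Ioc).2 ?_)
      filter_upwards [hk0'] with τ hτ h'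
      exact mul_nonneg (hτ ⟨hr.1.trans h'.1.le, h'.2⟩) (hu0 τ ⟨hr.1.trans h'.1.le, h'.2⟩)
    have hnk : 0 ≤ - ∫ τ in s..t, k τ := by
      rw [← intervalIntegral.integral_symm, intervalIntegral.integral_of_le hst]
      exact integral_nonneg_of_ae ((ae_restrict_iff' measurableSet_Ioc).2 hk0)
    have key := gronwall_integral_forward (u := fun r => u (-r)) (k := fun r => k (-r)) (a := a)
      (s := -s) (t := -t) (neg_le_neg hst) ?_ ?_ ?_ ?_
    · have e := hne k (-t)
      simp only [neg_neg] at key e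
      rwa [e, ← abs_of_nonneg hnk, abs_neg] at key
    · refine hu.comp continuous_neg.continuousOn fun r hr => ?_
      exact ⟨by linarith [hr.2], by linarith [hr.1]⟩
    · exact (IntervalIntegrable.iff_comp_neg).1 hk
    · have := (Measure.measurePreserving_neg (volume : Measure ℝ)).quasiMeasurePreserving.ae hk0'
      filter_upwards [this] with r h1 h2
      exact h1 ⟨by linarith [h2.2], by linarith [h2.1]⟩
    · intro r hr
      have hr' : -r ∈ Icc t s := ⟨by linarith [hr.2], by linarith [hr.1]⟩
      have := h (-r) hr'
      rw [← abs_neg, abs_of_nonneg (hnn _ hr')] at this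
      rw [hne (fun τ => k τ * u τ) r]
      exact this

/-! ### Carathéodory flows of bounded Lipschitz fields -/

section Cara

set_option linter.unusedSectionVars false

variable {E : Type*} [NormedAddCommGroup E] [NormedSpace ℝ E] [CompleteSpace E]
  [MeasurableSpace E] [BorelSpace E] [SecondCountableTopology E]

/-- A time-dependent field, jointly measurable, bounded by `M` and `L`-Lipschitz in space. -/
structure IsLipField (c : ℝ → E → E) (M L : ℝ) : Prop where
  meas : Measurable (uncurry c)
  bound : ∀ t x, ‖c t x‖ ≤ M
  lip : ∀ t x y, ‖c t x - c t y‖ ≤ L * ‖x - y‖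

/-- `γ` solves `γ' = c (t, γ)`, `γ s = x`, in integral form, at all times. -/
def IsCaraCurve (c : ℝ → E → E) (s : ℝ) (x : E) (γ : ℝ → E) : Prop :=
  Continuous γ ∧ ∀ t, γ t = x + ∫ r in s..t, c r (γ r)

variable {c : ℝ → E → E} {M L : ℝ}

theorem intervalIntegrable_of_measurable_of_bound {f : ℝ → E} (hf : Measurable f)
    (hb : ∀ t, ‖f t‖ ≤ M) (s t : ℝ) : IntervalIntegrable f volume s t :=
  (intervalIntegrable_const (c := M)).mono_fun hf.aestronglyMeasurable
    (Eventually.of_forall fun r => (hb r).trans (le_abs_self M))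

namespace IsLipField

theorem bound_nonneg (h : IsLipField c M L) : 0 ≤ M := (norm_nonneg _).trans (h.bound 0 0)

theorem intervalIntegrable (h : IsLipField c M L) {γ : ℝ → E} (hγ : Measurable γ) (s t : ℝ) :
    IntervalIntegrable (fun r => c r (γ r)) volume s t :=
  intervalIntegrable_of_measurable_of_bound (h.meas.comp (measurable_id.prodMk hγ))
    (fun r => h.bound r _) s t

theorem continuous (h : IsLipField c M L) (t : ℝ) : Continuous (c t) := by
  have : LipschitzWith L.toNNReal (c t) := LipschitzWith.of_dist_le_mul fun x y => by
    rw [dist_eq_norm, dist_eq_norm]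
    exact (h.lip t x y).trans (mul_le_mul_of_nonneg_right (Real.le_coe_toNNReal L) (norm_nonneg _))
  exact this.continuous

/-- Solutions exist globally: the Picard iterates converge, since their differences are dominated
by the terms of an exponential series. -/
theorem exists_isCaraCurve (h : IsLipField c M L) (s : ℝ) (x : E) :
    ∃ γ, IsCaraCurve c s x γ := by
  let g : ℕ → ℝ → E := fun k => Nat.rec (fun _ => x) (fun _ γ t => x + ∫ r in s..t, c r (γ r)) k
  have g0 : g 0 = fun _ => x := rfl
  have gs : ∀ k, g (k + 1) = fun t => x + ∫ r in s..t, c r (g k r) := fun k => rfl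
  have hcont : ∀ k, Continuous (g k) := by
    intro k
    induction k with
    | zero => rw [g0]; exact continuous_const
    | succ k ih =>
      rw [gs]
      exact continuous_const.add
        (intervalIntegral.continuous_primitive (fun a b => h.intervalIntegrable ih.measurable a b) s)
  have hL0 : 0 ≤ |L| := abs_nonneg L
  have hbd : ∀ k t, ‖g (k + 1) t - g k t‖ ≤ M * |L| ^ k * |t - s| ^ (k + 1) / (k + 1).factorial := by
    intro k
    induction k with
    | zero =>
      intro t
      rw [gs, g0]
      simp only [add_sub_cancel_left]
      have := intervalIntegral.norm_integral_le_of_norm_le_const (a := s) (b := t)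
        (f := fun r => c r x) (C := M) fun r _ => h.bound r x
      simpa using this
    | succ k ih =>
      intro t
      have e : g (k + 1 + 1) t - g (k + 1) t = ∫ r in s..t, (c r (g (k + 1) r) - c r (g k r)) := by
        rw [intervalIntegral.integral_sub (h.intervalIntegrable (hcont (k + 1)).measurable _ _)
          (h.intervalIntegrable (hcont k).measurable _ _), gs (k + 1)]
        conv_lhs => enter [2]; rw [gs k]
        simp
      rw [e]
      refine (intervalIntegral.norm_integral_le_integral_norm_uIoc).trans ?_
      have h1 : ∫ r in uIoc s t, ‖c r (g (k + 1) r) - c r (g k r)‖ ≤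
          ∫ r in uIoc s t, (|L| * (M * |L| ^ k / (k + 1).factorial)) * |r - s| ^ (k + 1) := by
        refine integral_mono_of_nonneg (Eventually.of_forall fun r => norm_nonneg _) ?_
          (Eventually.of_forall fun r => ?_)
        · exact (((continuous_const.mul (((continuous_id.sub continuous_const).abs).pow _))
            ).intervalIntegrable s t).def'
        · refine (h.lip r _ _).trans ?_
          calc L * ‖g (k + 1) r - g k r‖ ≤ |L| * (M * |L| ^ k * |r - s| ^ (k + 1) / (k + 1).factorial) :=
                mul_le_mul (le_abs_self L) (ih r) (norm_nonneg _) hL0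
            _ = _ := by ring
      refine h1.trans (le_of_eq ?_)
      rw [integral_const_mul, integral_pow_abs_sub_uIoc, Nat.factorial_succ (k + 1)]
      push_cast
      have : ((k + 1).factorial : ℝ) ≠ 0 := by positivity
      field_simp
      ring
  have hsum : ∀ t, Summable fun k : ℕ => M * |L| ^ k * |t - s| ^ (k + 1) / (k + 1).factorial := by
    intro t
    have h1 := (Real.summable_pow_div_factorial (|L| * |t - s|)).mul_left (M * |t - s|)
    refine Summable.of_nonneg_of_le (fun k => ?_) (fun k => ?_) h1
    · have := h.bound_nonneg; positivity
    · have hM := h.bound_nonneg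
      have : M * |t - s| * ((|L| * |t - s|) ^ k / k.factorial) =
          M * |L| ^ k * |t - s| ^ (k + 1) / k.factorial := by rw [mul_pow]; ring
      rw [this]
      exact div_le_div_of_nonneg_left (by positivity) (by positivity)
        (by exact_mod_cast Nat.factorial_le (Nat.le_succ k))
  have hlim : ∀ t, ∃ y, Tendsto (fun k => g k t) atTop (𝓝 y) := fun t =>
    cauchySeq_tendsto_of_complete (cauchySeq_of_dist_le_of_summable _ (fun k => by
      rw [dist_comm, dist_eq_norm]; exact hbd k t) (hsum t))
  choose γ hγ using hlim
  have hγm : Measurable γ :=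
    measurable_of_tendsto_metrizable (fun k => (hcont k).measurable) (tendsto_pi_nhds.2 hγ)
  have heq : ∀ t, γ t = x + ∫ r in s..t, c r (γ r) := by
    intro t
    have h1 : Tendsto (fun k => g (k + 1) t) atTop (𝓝 (x + ∫ r in s..t, c r (γ r))) := by
      simp only [gs]
      refine Tendsto.const_add x ?_
      refine intervalIntegral.tendsto_integral_filter_of_dominated_convergence (fun _ => M)
        (Eventually.of_forall fun k => ?_) (Eventually.of_forall fun k =>
          Eventually.of_forall fun r _ => h.bound r _) intervalIntegrable_const
        (Eventually.of_forall fun r _ => ((h.continuous r).tendsto _).comp (hγ r))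
      exact (h.meas.comp (measurable_id.prodMk (hcont k).measurable)).aestronglyMeasurable
    exact tendsto_nhds_unique ((hγ t).comp (tendsto_add_atTop_nat 1)) h1
  refine ⟨γ, ?_, heq⟩
  have : γ = fun t => x + ∫ r in s..t, c r (γ r) := funext heq
  rw [this]
  exact continuous_const.add
    (intervalIntegral.continuous_primitive (fun a b => h.intervalIntegrable hγm a b) s)

end IsLipField

theorem IsCaraCurve.apply_self {s : ℝ} {x : E} {γ : ℝ → E} (h : IsCaraCurve c s x γ) :
    γ s = x := by simpa using h.2 s

theorem IsCaraCurve.sub_eq (hc : IsLipField c M L) {s : ℝ} {x : E} {γ : ℝ → E}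
    (h : IsCaraCurve c s x γ) (r t : ℝ) : γ t - γ r = ∫ τ in r..t, c τ (γ τ) := by
  rw [h.2 t, h.2 r, add_sub_add_left_eq_sub, intervalIntegral.integral_interval_sub_left] <;>
    exact hc.intervalIntegrable h.1.measurable _ _

theorem IsCaraCurve.shift (hc : IsLipField c M L) {s : ℝ} {x : E} {γ : ℝ → E}
    (h : IsCaraCurve c s x γ) (r : ℝ) : IsCaraCurve c r (γ r) γ :=
  ⟨h.1, fun t => by rw [← h.sub_eq hc]; simp⟩

theorem IsCaraCurve.norm_sub_le (hc : IsLipField c M L) {s : ℝ} {x y : E} {γ₁ γ₂ : ℝ → E}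
    (h₁ : IsCaraCurve c s x γ₁) (h₂ : IsCaraCurve c s y γ₂) (t : ℝ) :
    ‖γ₁ t - γ₂ t‖ ≤ ‖x - y‖ * Real.exp (|L| * |t - s|) := by
  have := gronwall_integral (u := fun r => ‖γ₁ r - γ₂ r‖) (k := fun _ => |L|) (a := ‖x - y‖)
    (s := s) (t := t) (h₁.1.sub h₂.1).norm.continuousOn intervalIntegrable_const
    (Eventually.of_forall fun _ _ => abs_nonneg L) (fun _ _ => norm_nonneg _) ?_
  · simpa [abs_mul, mul_comm] using this
  · intro r _
    have e : γ₁ r - γ₂ r = (x - y) + ∫ τ in s..r, (c τ (γ₁ τ) - c τ (γ₂ τ)) := by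
      rw [intervalIntegral.integral_sub (hc.intervalIntegrable h₁.1.measurable _ _)
        (hc.intervalIntegrable h₂.1.measurable _ _), h₁.2 r, h₂.2 r]; abel
    simp only [e]
    refine (norm_add_le _ _).trans (add_le_add le_rfl ?_)
    refine intervalIntegral.norm_integral_le_abs_of_norm_le (Eventually.of_forall fun τ => ?_) ?_
    · exact (hc.lip τ _ _).trans (mul_le_mul_of_nonneg_right (le_abs_self L) (norm_nonneg _))
    · exact (continuous_const.mul (h₁.1.sub h₂.1).norm).intervalIntegrable _ _

open Classical in
/-- The global flow of a bounded Lipschitz field; the irrelevant value `x` is used for fields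
without integral curves. -/
noncomputable def lipFlow (c : ℝ → E → E) (t s : ℝ) (x : E) : E :=
  if h : ∃ γ, IsCaraCurve c s x γ then h.choose t else x

namespace IsLipField

theorem isCaraCurve_lipFlow (h : IsLipField c M L) (s : ℝ) (x : E) :
    IsCaraCurve c s x (fun t => lipFlow c t s x) := by
  have hex := h.exists_isCaraCurve s x
  have : (fun t => lipFlow c t s x) = hex.choose := by
    funext t; simp [lipFlow, hex]
  rw [this]; exact hex.choose_spec

theorem eq_lipFlow (h : IsLipField c M L) {s : ℝ} {x : E} {γ : ℝ → E}
    (hγ : IsCaraCurve c s x γ) (t : ℝ) : γ t = lipFlow c t s x := by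
  have := hγ.norm_sub_le h (h.isCaraCurve_lipFlow s x) t
  rw [sub_self, norm_zero, zero_mul] at this
  exact sub_eq_zero.1 (norm_le_zero_iff.1 this)

theorem lipFlow_self (h : IsLipField c M L) (s : ℝ) (x : E) : lipFlow c s s x = x :=
  (h.isCaraCurve_lipFlow s x).apply_self

theorem lipFlow_lipFlow (h : IsLipField c M L) (t r s : ℝ) (x : E) :
    lipFlow c t r (lipFlow c r s x) = lipFlow c t s x :=
  (h.eq_lipFlow ((h.isCaraCurve_lipFlow s x).shift h r) t).symm

theorem norm_lipFlow_sub_le (h : IsLipField c M L) (t s : ℝ) (x y : E) :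
    ‖lipFlow c t s x - lipFlow c t s y‖ ≤ Real.exp (|L| * |t - s|) * ‖x - y‖ := by
  rw [mul_comm]
  exact (h.isCaraCurve_lipFlow s x).norm_sub_le h (h.isCaraCurve_lipFlow s y) t

theorem norm_lipFlow_time_sub_le (h : IsLipField c M L) (t t' s : ℝ) (x : E) :
    ‖lipFlow c t s x - lipFlow c t' s x‖ ≤ M * |t - t'| := by
  rw [(h.isCaraCurve_lipFlow s x).sub_eq h t' t]
  exact intervalIntegral.norm_integral_le_of_norm_le_const fun r _ => h.bound r _

theorem continuous_lipFlow (h : IsLipField c M L) :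
    Continuous fun z : ℝ × ℝ × E => lipFlow c z.1 z.2.1 z.2.2 := by
  rw [continuous_iff_continuousAt]
  rintro ⟨t, s, x⟩
  rw [ContinuousAt, tendsto_iff_norm_sub_tendsto_zero]
  have hlim : Tendsto (fun z : ℝ × ℝ × E => M * |z.1 - t| +
      Real.exp (|L| * |t - z.2.1|) * (‖z.2.2 - x‖ + M * |z.2.1 - s|)) (𝓝 (t, s, x)) (𝓝 0) := by
    have : Continuous (fun z : ℝ × ℝ × E => M * |z.1 - t| +
      Real.exp (|L| * |t - z.2.1|) * (‖z.2.2 - x‖ + M * |z.2.1 - s|)) := by fun_prop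
    simpa using this.tendsto (t, s, x)
  refine squeeze_zero (fun _ => norm_nonneg _) (fun z => ?_) hlim
  obtain ⟨t', s', x'⟩ := z
  have e := h.lipFlow_lipFlow t s' s x
  have h1 := h.norm_lipFlow_time_sub_le t' t s' x'
  have h2 := h.norm_lipFlow_sub_le t s' x' (lipFlow c s' s x)
  have h3 := h.norm_lipFlow_time_sub_le s s' s x
  rw [h.lipFlow_self] at h3
  rw [e] at h2
  have h4 : ‖x' - lipFlow c s' s x‖ ≤ ‖x' - x‖ + M * |s' - s| := by
    rw [abs_sub_comm s' s]
    calc ‖x' - lipFlow c s' s x‖ = ‖(x' - x) + (x - lipFlow c s' s x)‖ := by congr 1; abel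
      _ ≤ _ := (norm_add_le _ _).trans (add_le_add le_rfl h3)
  calc ‖lipFlow c t' s' x' - lipFlow c t s x‖
      = ‖(lipFlow c t' s' x' - lipFlow c t s' x') + (lipFlow c t s' x' - lipFlow c t s x)‖ := by
        congr 1; abel
    _ ≤ _ := (norm_add_le _ _).trans (add_le_add h1
        (h2.trans (mul_le_mul_of_nonneg_left h4 (Real.exp_pos _).le)))

/-- The differential of the flow is controlled by the differential of the field along the
trajectory. -/
theorem norm_fderiv_lipFlow_le (h : IsLipField c M L) {Dc : ℝ → E → E →L[ℝ] E} {K : ℝ}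
    (hDm : ∀ γ : ℝ → E, Continuous γ → Measurable fun r => ‖Dc r (γ r)‖)
    (hDb : ∀ t x, ‖Dc t x‖ ≤ L)
    (hD : ∀ t x y, ‖c t y - c t x - Dc t x (y - x)‖ ≤ K * ‖y - x‖ ^ 2) (t s : ℝ) (x : E) :
    ‖fderiv ℝ (lipFlow c t s) x‖ ≤
      Real.exp |∫ r in s..t, ‖Dc r (lipFlow c r s x)‖| := by
  set g : ℝ → ℝ := fun r => ‖Dc r (lipFlow c r s x)‖
  have hgm : Measurable g := hDm _ (h.isCaraCurve_lipFlow s x).1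
  have hgi : ∀ a b, IntervalIntegrable g volume a b := fun a b =>
    intervalIntegrable_of_measurable_of_bound (M := L) hgm (fun r => by
      simpa [g] using hDb r _) a b
  set A := Real.exp (|L| * |t - s|)
  have key : ∀ y, ‖lipFlow c t s y - lipFlow c t s x‖ ≤
      ‖y - x‖ * Real.exp (|∫ r in s..t, g r| + |K| * (A * ‖y - x‖) * |t - s|) := by
    intro y
    set m := |K| * (A * ‖y - x‖)
    have hm : 0 ≤ m := by positivity
    have h1 := h.isCaraCurve_lipFlow s y
    have h2 := h.isCaraCurve_lipFlow s x
    have := gronwall_integral (u := fun r => ‖lipFlow c r s y - lipFlow c r s x‖)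
      (k := fun r => g r + m) (a := ‖y - x‖) (s := s) (t := t) (h1.1.sub h2.1).norm.continuousOn
      ((hgi _ _).add intervalIntegrable_const)
      (Eventually.of_forall fun r _ => add_nonneg (norm_nonneg _) hm) (fun _ _ => norm_nonneg _) ?_
    · refine this.trans (mul_le_mul_of_nonneg_left (Real.exp_le_exp.2 ?_) (norm_nonneg _))
      rw [intervalIntegral.integral_add (hgi _ _) intervalIntegrable_const]
      refine (abs_add_le _ _).trans (add_le_add le_rfl ?_)
      rw [intervalIntegral.integral_const, smul_eq_mul, abs_mul, abs_of_nonneg hm, mul_comm]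
    · intro r hr
      have e : lipFlow c r s y - lipFlow c r s x =
          (y - x) + ∫ τ in s..r, (c τ (lipFlow c τ s y) - c τ (lipFlow c τ s x)) := by
        rw [intervalIntegral.integral_sub (h.intervalIntegrable h1.1.measurable _ _)
          (h.intervalIntegrable h2.1.measurable _ _)]
        have e1 : lipFlow c r s y = y + ∫ τ in s..r, c τ (lipFlow c τ s y) := h1.2 r
        have e2 : lipFlow c r s x = x + ∫ τ in s..r, c τ (lipFlow c τ s x) := h2.2 r
        rw [e1, e2]
        abel
      conv_lhs => rw [e]
      refine (norm_add_le _ _).trans (add_le_add le_rfl ?_)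
      refine intervalIntegral.norm_integral_le_abs_of_norm_le ?_ ?_
      · refine (ae_restrict_iff' measurableSet_uIoc).2 (Eventually.of_forall fun τ hτ => ?_)
        have hτ' : |τ - s| ≤ |t - s| := by
          have : τ ∈ uIcc s t := (uIcc_subset_uIcc left_mem_uIcc hr) (uIoc_subset_uIcc hτ)
          exact abs_sub_left_of_mem_uIcc this
        set u := lipFlow c τ s y
        set w := lipFlow c τ s x
        have hu : ‖u - w‖ ≤ A * ‖y - x‖ := (h.norm_lipFlow_sub_le τ s y x).trans
          (mul_le_mul_of_nonneg_right (Real.exp_le_exp.2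
            (mul_le_mul_of_nonneg_left hτ' (abs_nonneg _))) (norm_nonneg _))
        calc ‖c τ u - c τ w‖ = ‖Dc τ w (u - w) + (c τ u - c τ w - Dc τ w (u - w))‖ := by
              congr 1; abel
          _ ≤ g τ * ‖u - w‖ + |K| * ‖u - w‖ ^ 2 := (norm_add_le _ _).trans
              (add_le_add ((Dc τ w).le_opNorm _) ((hD τ w u).trans
                (mul_le_mul_of_nonneg_right (le_abs_self K) (by positivity))))
          _ = (g τ + |K| * ‖u - w‖) * ‖u - w‖ := by ring
          _ ≤ (g τ + m) * ‖u - w‖ := by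
              refine mul_le_mul_of_nonneg_right (add_le_add le_rfl ?_) (norm_nonneg _)
              exact mul_le_mul_of_nonneg_left hu (abs_nonneg K)
      · exact ((hgi _ _).add intervalIntegrable_const).mul_continuousOn
          (h1.1.sub h2.1).norm.continuousOn
  -- letting `y → x` removes the contribution `K` of the Taylor remainder
  refine le_of_forall_gt_imp_ge_of_dense fun C hC => ?_
  have hC0 : 0 ≤ C := (Real.exp_pos _).le.trans hC.le
  refine norm_fderiv_le_of_lip' ℝ hC0 ?_
  have hlim : Tendsto (fun y => Real.exp (|∫ r in s..t, g r| + |K| * (A * ‖y - x‖) * |t - s|)) (𝓝 x)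
      (𝓝 (Real.exp |∫ r in s..t, g r|)) := by
    have : Continuous (fun y => Real.exp (|∫ r in s..t, g r| + |K| * (A * ‖y - x‖) * |t - s|)) := by
      fun_prop
    simpa using this.tendsto x
  filter_upwards [hlim.eventually_lt_const hC] with y hy
  refine (key y).trans ?_
  rw [mul_comm]
  exact mul_le_mul_of_nonneg_right hy.le (norm_nonneg _)

end IsLipField

end Cara

/-! ### A mollifier -/

section Moll

local notation "𝔼" n => EuclideanSpace ℝ (Fin n)

variable {n : ℕ}

/-- The mollifying kernel: smooth, nonnegative, of integral one, supported in the unit ball. -/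
noncomputable def mollKernel (n : ℕ) : (𝔼 n) → ℝ :=
  (ContDiffBump.mk 2⁻¹ 1 (by norm_num) (by norm_num) : ContDiffBump (0 : 𝔼 n)).normed volume

/-- The probability measure with density `mollKernel n`. -/
noncomputable def mollMeasure (n : ℕ) : Measure (𝔼 n) :=
  volume.withDensity fun z => ENNReal.ofReal (mollKernel n z)

/-- An upper bound of `mollKernel n`. -/
noncomputable def mollBound (n : ℕ) : ℝ :=
  1 / (volume : Measure (𝔼 n)).real (Metric.closedBall 0 2⁻¹)

theorem mollKernel_nonneg (z : 𝔼 n) : 0 ≤ mollKernel n z := ContDiffBump.nonneg_normed _ _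

theorem mollKernel_le (z : 𝔼 n) : mollKernel n z ≤ mollBound n :=
  ContDiffBump.normed_le_div_measure_closedBall_rIn _ _ z

theorem mollBound_nonneg : 0 ≤ mollBound n := (mollKernel_nonneg 0).trans (mollKernel_le 0)

theorem contDiff_mollKernel {m : ℕ∞} : ContDiff ℝ m (mollKernel n) :=
  ContDiffBump.contDiff_normed _

theorem measurable_mollKernel : Measurable (mollKernel n) :=
  (contDiff_mollKernel (m := 0)).continuous.measurable

theorem tsupport_mollKernel : tsupport (mollKernel n) = Metric.closedBall 0 1 :=
  ContDiffBump.tsupport_normed_eq _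

theorem hasCompactSupport_mollKernel : HasCompactSupport (mollKernel n) :=
  ContDiffBump.hasCompactSupport_normed _

theorem integral_mollKernel : ∫ z, mollKernel n z = 1 := ContDiffBump.integral_normed _

instance : IsProbabilityMeasure (mollMeasure n) := by
  refine ⟨?_⟩
  rw [mollMeasure, withDensity_apply _ MeasurableSet.univ, Measure.restrict_univ,
    ← ofReal_integral_eq_lintegral_ofReal, integral_mollKernel, ENNReal.ofReal_one]
  · exact ContDiffBump.integrable_normed _
  · exact Eventually.of_forall mollKernel_nonneg

theorem mollMeasure_le :
    mollMeasure n ≤ ENNReal.ofReal (mollBound n) •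
      (volume : Measure (𝔼 n)).restrict (Metric.closedBall 0 1) := by
  refine Measure.le_iff.2 fun s hs => ?_
  rw [mollMeasure, withDensity_apply _ hs, Measure.smul_apply, smul_eq_mul,
    ← lintegral_indicator hs, Measure.restrict_apply hs,
    ← lintegral_indicator_const (hs.inter Metric.isClosed_closedBall.measurableSet)]
  refine lintegral_mono fun z => ?_
  by_cases hz : z ∈ s
  · rw [indicator_of_mem hz]
    by_cases hb : z ∈ Metric.closedBall (0 : 𝔼 n) 1
    · rw [indicator_of_mem (show z ∈ s ∩ Metric.closedBall 0 1 from ⟨hz, hb⟩)]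
      exact ENNReal.ofReal_le_ofReal (mollKernel_le z)
    · rw [← tsupport_mollKernel] at hb
      simp [image_eq_zero_of_notMem_tsupport hb]
  · simp [hz]

theorem ae_mollMeasure_norm_le : ∀ᵐ z ∂(mollMeasure n), ‖z‖ ≤ 1 := by
  have h : ∀ᵐ z ∂(ENNReal.ofReal (mollBound n) •
      (volume : Measure (𝔼 n)).restrict (Metric.closedBall 0 1)), ‖z‖ ≤ 1 :=
    Measure.ae_smul_measure ((ae_restrict_iff' Metric.isClosed_closedBall.measurableSet).2
      (Eventually.of_forall fun z hz => by simpa using hz)) _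
  exact (Measure.absolutelyContinuous_of_le mollMeasure_le).ae_le h

theorem map_add_smul_volume (x : 𝔼 n) {η : ℝ} (hη : 0 < η) :
    (volume : Measure (𝔼 n)).map (fun z => x + η • z) = ENNReal.ofReal (η⁻¹ ^ n) • volume := by
  have h1 : (fun z : 𝔼 n => x + η • z) = (fun w => x + w) ∘ fun z => η • z := rfl
  rw [h1, ← Measure.map_map (measurable_const_add x) (measurable_const_smul η),
    Measure.map_addHaar_smul _ hη.ne', Measure.map_smul, map_add_left_eq_self,
    abs_of_nonneg (by positivity), finrank_euclideanSpace_fin, inv_pow]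

/-- Averages against the mollifying kernel at scale `η` are at most `C η⁻ⁿ` times the integral. -/
theorem lintegral_mollMeasure_le (x : 𝔼 n) {η : ℝ} (hη : 0 < η) {S : Set (𝔼 n)}
    (hS : Metric.closedBall x η ⊆ S) (hSm : MeasurableSet S) {f : (𝔼 n) → ℝ≥0∞}
    (hf : Measurable f) :
    ∫⁻ z, f (x + η • z) ∂(mollMeasure n) ≤
      ENNReal.ofReal (mollBound n * η⁻¹ ^ n) * ∫⁻ y in S, f y := by
  calc ∫⁻ z, f (x + η • z) ∂(mollMeasure n)
      ≤ ∫⁻ z, f (x + η • z) ∂(ENNReal.ofReal (mollBound n) •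
        (volume : Measure (𝔼 n)).restrict (Metric.closedBall 0 1)) := lintegral_mono' mollMeasure_le le_rfl
    _ = ENNReal.ofReal (mollBound n) * ∫⁻ z in Metric.closedBall 0 1, f (x + η • z) := by
        rw [lintegral_smul_measure, smul_eq_mul]
    _ ≤ ENNReal.ofReal (mollBound n) * ∫⁻ z, S.indicator f (x + η • z) := by
        gcongr ENNReal.ofReal _ * ?_
        rw [← lintegral_indicator Metric.isClosed_closedBall.measurableSet]
        refine lintegral_mono (indicator_le fun z hz => ?_)
        rw [indicator_of_mem (hS ?_)]
        rw [mem_closedBall_zero_iff] at hz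
        simpa [norm_smul, abs_of_pos hη] using mul_le_of_le_one_right hη.le hz
    _ = ENNReal.ofReal (mollBound n) * ∫⁻ y, S.indicator f y
          ∂((volume : Measure (𝔼 n)).map (fun z => x + η • z)) := by
        rw [lintegral_map (hf.indicator hSm) (by fun_prop)]
    _ = _ := by
        rw [map_add_smul_volume x hη, lintegral_smul_measure, smul_eq_mul, lintegral_indicator hSm,
          ← mul_assoc, ← ENNReal.ofReal_mul mollBound_nonneg]

variable {F : Type*} [NormedAddCommGroup F] [NormedSpace ℝ F]

/-- The mollification of `v` at scale `η`, with the convention that `moll 0 v = v`. -/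
noncomputable def moll (η : ℝ) (v : (𝔼 n) → F) (x : 𝔼 n) : F :=
  ∫ z, v (x + η • z) ∂(mollMeasure n)

/-- The mollifying kernel at scale `η`. -/
noncomputable def scaledKernel (n : ℕ) (η : ℝ) (y : 𝔼 n) : ℝ := η⁻¹ ^ n * mollKernel n (η⁻¹ • y)

theorem moll_zero [CompleteSpace F] (v : (𝔼 n) → F) (x : 𝔼 n) : moll 0 v x = v x := by
  simp [moll]

theorem moll_eq_integral_scaledKernel {η : ℝ} (hη : 0 < η) (v : (𝔼 n) → F) (x : 𝔼 n) :
    moll η v x = ∫ y, scaledKernel n η (y - x) • v y := by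
  rw [moll, mollMeasure, integral_withDensity_eq_integral_toReal_smul
    measurable_mollKernel.ennreal_ofReal (Eventually.of_forall fun _ => ENNReal.ofReal_lt_top)]
  have h := Measure.integral_comp_smul (volume : Measure (𝔼 n))
    (fun w => mollKernel n (η⁻¹ • w) • v (x + w)) η
  have h2 := integral_add_left_eq_self (μ := (volume : Measure (𝔼 n)))
    (fun y => mollKernel n (η⁻¹ • (y - x)) • v y) x
  simp only [add_sub_cancel_left] at h2
  simp only [smul_smul, inv_mul_cancel₀ hη.ne', one_smul] at h
  simp only [ENNReal.toReal_ofReal (mollKernel_nonneg _), scaledKernel]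
  rw [h, h2, abs_of_nonneg (by positivity), finrank_euclideanSpace_fin, ← integral_smul]
  simp only [smul_smul, inv_pow]

theorem contDiff_scaledKernel {m : ℕ∞} (η : ℝ) : ContDiff ℝ m (scaledKernel n η) :=
  contDiff_const.mul (contDiff_mollKernel.comp (contDiff_const_smul _))

theorem hasCompactSupport_scaledKernel {η : ℝ} (hη : 0 < η) :
    HasCompactSupport (scaledKernel n η) :=
  HasCompactSupport.mul_left
    (hasCompactSupport_mollKernel.comp_homeomorph (Homeomorph.smulOfNeZero η⁻¹ (inv_ne_zero hη.ne')))

theorem tsupport_scaledKernel_sub_subset {η : ℝ} (hη : 0 < η) (x : 𝔼 n) :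
    tsupport (fun y => scaledKernel n η (y - x)) ⊆ Metric.closedBall x η := by
  refine closure_minimal (fun y hy => ?_) Metric.isClosed_closedBall
  have h1 : mollKernel n (η⁻¹ • (y - x)) ≠ 0 := right_ne_zero_of_mul hy
  have h2 := subset_tsupport _ h1
  rw [tsupport_mollKernel, mem_closedBall_zero_iff, norm_smul, norm_inv, Real.norm_eq_abs,
    abs_of_pos hη, inv_mul_le_iff₀ hη, mul_one] at h2
  rwa [mem_closedBall_iff_norm]

/-! ### Convolution with a smooth compactly supported kernel -/

/-- Lipschitz and second-order Taylor bounds, uniform in space. -/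
theorem ContDiff.exists_taylor_bound {κ : (𝔼 n) → ℝ} (hκ : ContDiff ℝ 2 κ)
    (hc : HasCompactSupport κ) : ∃ L K : ℝ, 0 ≤ L ∧ 0 ≤ K ∧ (∀ x y, |κ x - κ y| ≤ L * ‖x - y‖) ∧
      (∀ x, ‖fderiv ℝ κ x‖ ≤ L) ∧
      ∀ x y, |κ y - κ x - fderiv ℝ κ x (y - x)| ≤ K * ‖y - x‖ ^ 2 := by
  obtain ⟨L, hL⟩ := hκ.lipschitzWith_of_hasCompactSupport hc (by norm_num)
  have h1 : ContDiff ℝ 1 (fderiv ℝ κ) := hκ.fderiv_right (by norm_num)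
  obtain ⟨K, hK⟩ := h1.lipschitzWith_of_hasCompactSupport (hc.fderiv ℝ) (by norm_num)
  refine ⟨L, K, L.2, K.2, fun x y => ?_, fun x => norm_fderiv_le_of_lipschitz ℝ hL, fun x y => ?_⟩
  · simpa [dist_eq_norm] using hL.dist_le_mul x y
  · have := (convex_segment x y).norm_image_sub_le_of_norm_fderiv_le' (𝕜 := ℝ)
      (f := κ) (C := K * ‖y - x‖) (φ := fderiv ℝ κ x)
      (fun z _ => (hκ.differentiable (by norm_num)) z) (fun z hz => ?_)
      (left_mem_segment ℝ x y) (right_mem_segment ℝ x y)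
    · rw [Real.norm_eq_abs] at this
      calc _ ≤ _ := this
        _ = _ := by ring
    · have h := hK.dist_le_mul z x
      rw [dist_eq_norm, dist_eq_norm] at h
      refine h.trans (mul_le_mul_of_nonneg_left ?_ K.2)
      exact norm_sub_le_of_mem_segment hz

end Moll

section Moll

local notation "𝔼" n => EuclideanSpace ℝ (Fin n)

variable {n : ℕ}

/-- The differential of the mollification, obtained by differentiating the kernel. -/
noncomputable def mollDeriv (η : ℝ) (β : (𝔼 n) → 𝔼 n) (x : 𝔼 n) : (𝔼 n) →L[ℝ] 𝔼 n :=
  ∫ y, -((fderiv ℝ (scaledKernel n η) (y - x)).smulRight (β y))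

theorem continuous_fderiv_scaledKernel (η : ℝ) : Continuous (fderiv ℝ (scaledKernel n η)) :=
  (contDiff_scaledKernel (m := 1) η).continuous_fderiv (by simp)

theorem integrable_scaledKernel_smul {F : Type*} [NormedAddCommGroup F] [NormedSpace ℝ F]
    {η : ℝ} (hη : 0 < η) {β : (𝔼 n) → F} (hβ : Integrable β) (x : 𝔼 n) :
    Integrable fun y => scaledKernel n η (y - x) • β y := by
  obtain ⟨C, hC⟩ := (hasCompactSupport_scaledKernel (n := n) hη).exists_bound_of_continuous
    (contDiff_scaledKernel (m := 0) η).continuous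
  refine hβ.bdd_smul C ?_ (Eventually.of_forall fun y => hC _)
  exact ((contDiff_scaledKernel (m := 0) η).continuous.comp
    (continuous_id.sub continuous_const)).aestronglyMeasurable

theorem integrable_fderiv_scaledKernel_smulRight {η : ℝ} (hη : 0 < η) {β : (𝔼 n) → 𝔼 n}
    (hβ : Integrable β) (x : 𝔼 n) :
    Integrable fun y => -((fderiv ℝ (scaledKernel n η) (y - x)).smulRight (β y)) := by
  obtain ⟨C, hC⟩ := ((hasCompactSupport_scaledKernel (n := n) hη).fderiv ℝ).exists_bound_of_continuous
    (continuous_fderiv_scaledKernel η)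
  refine Integrable.neg ?_
  refine (hβ.norm.const_mul C).mono' ?_ (Eventually.of_forall fun y => ?_)
  · have h1 : Continuous fun y => fderiv ℝ (scaledKernel n η) (y - x) :=
      (continuous_fderiv_scaledKernel η).comp (continuous_id.sub continuous_const)
    exact ((ContinuousLinearMap.smulRightL ℝ (𝔼 n) (𝔼 n)).aestronglyMeasurable_comp₂
      h1.aestronglyMeasurable hβ.1)
  · rw [ContinuousLinearMap.norm_smulRight_apply]
    exact mul_le_mul_of_nonneg_right (hC _) (norm_nonneg _)

/-- The mollification of an integrable field is Lipschitz, and satisfies a quadratic Taylor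
estimate, with constants that depend only on the scale and on the `L¹` norm of the field. -/
theorem exists_moll_bounds {η : ℝ} (hη : 0 < η) : ∃ L K : ℝ, 0 ≤ L ∧ 0 ≤ K ∧
    ∀ (β : (𝔼 n) → 𝔼 n) (R : ℝ), Integrable β → ∫ y, ‖β y‖ ≤ R →
      (∀ x y, ‖moll η β x - moll η β y‖ ≤ L * R * ‖x - y‖) ∧
      (∀ x, ‖mollDeriv η β x‖ ≤ L * R) ∧
      ∀ x y, ‖moll η β y - moll η β x - mollDeriv η β x (y - x)‖ ≤ K * R * ‖y - x‖ ^ 2 := by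
  obtain ⟨L, K, hL, hK, h1, h2, h3⟩ := ContDiff.exists_taylor_bound
    (contDiff_scaledKernel (n := n) (m := 2) η) (hasCompactSupport_scaledKernel hη)
  refine ⟨L, K, hL, hK, fun β R hβ hR => ⟨fun x y => ?_, fun x => ?_, fun x y => ?_⟩⟩
  · rw [moll_eq_integral_scaledKernel hη, moll_eq_integral_scaledKernel hη,
      ← integral_sub (integrable_scaledKernel_smul hη hβ _) (integrable_scaledKernel_smul hη hβ _)]
    calc _ ≤ ∫ w, L * ‖x - y‖ * ‖β w‖ := by
          refine norm_integral_le_of_norm_le (hβ.norm.const_mul _) (Eventually.of_forall fun w => ?_)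
          rw [← sub_smul, norm_smul]
          refine mul_le_mul_of_nonneg_right ((h1 _ _).trans (le_of_eq ?_)) (norm_nonneg _)
          rw [sub_sub_sub_cancel_left, norm_sub_rev]
      _ = L * (∫ w, ‖β w‖) * ‖x - y‖ := by rw [integral_const_mul]; ring
      _ ≤ _ := by gcongr
  · calc _ ≤ ∫ w, L * ‖β w‖ := by
          refine norm_integral_le_of_norm_le (hβ.norm.const_mul _) (Eventually.of_forall fun w => ?_)
          rw [norm_neg, ContinuousLinearMap.norm_smulRight_apply]
          exact mul_le_mul_of_nonneg_right (h2 _) (norm_nonneg _)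
      _ = L * (∫ w, ‖β w‖) := by rw [integral_const_mul]
      _ ≤ _ := by gcongr
  · rw [moll_eq_integral_scaledKernel hη, moll_eq_integral_scaledKernel hη,
      ← integral_sub (integrable_scaledKernel_smul hη hβ _) (integrable_scaledKernel_smul hη hβ _),
      mollDeriv, ContinuousLinearMap.integral_apply (integrable_fderiv_scaledKernel_smulRight hη hβ x),
      ← integral_sub (f := fun w => scaledKernel n η (w - y) • β w - scaledKernel n η (w - x) • β w)
        ((integrable_scaledKernel_smul hη hβ _).sub (integrable_scaledKernel_smul hη hβ _))
        ((integrable_fderiv_scaledKernel_smulRight hη hβ x).apply_continuousLinearMap _)]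
    calc _ ≤ ∫ w, K * ‖y - x‖ ^ 2 * ‖β w‖ := by
          refine norm_integral_le_of_norm_le (hβ.norm.const_mul _) (Eventually.of_forall fun w => ?_)
          have e : scaledKernel n η (w - y) • β w - scaledKernel n η (w - x) • β w -
              (-((fderiv ℝ (scaledKernel n η) (w - x)).smulRight (β w))) (y - x) =
              (scaledKernel n η (w - y) - scaledKernel n η (w - x) -
                fderiv ℝ (scaledKernel n η) (w - x) ((w - y) - (w - x))) • β w := by
            rw [sub_sub_sub_cancel_left, ← neg_sub y x, map_neg, sub_neg_eq_add, add_smul, sub_smul]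
            simp
          rw [e, norm_smul]
          refine mul_le_mul_of_nonneg_right ((h3 _ _).trans (le_of_eq ?_)) (norm_nonneg _)
          rw [sub_sub_sub_cancel_left, norm_sub_rev]
      _ = K * (∫ w, ‖β w‖) * ‖y - x‖ ^ 2 := by rw [integral_const_mul]; ring
      _ ≤ _ := by gcongr

theorem hasFDerivAt_of_taylor {E F : Type*} [NormedAddCommGroup E] [NormedSpace ℝ E]
    [NormedAddCommGroup F] [NormedSpace ℝ F] {f : E → F} {A : E →L[ℝ] F} {x : E} {K : ℝ}
    (h : ∀ y, ‖f y - f x - A (y - x)‖ ≤ K * ‖y - x‖ ^ 2) : HasFDerivAt f A x := by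
  refine HasFDerivAt.of_isLittleO ?_
  refine (Asymptotics.IsBigO.of_bound K (Eventually.of_forall fun y => ?_)).trans_isLittleO
    (Asymptotics.isLittleO_norm_pow_id (E' := E) one_lt_two |>.comp_tendsto
      (k := fun y => y - x) (l' := 𝓝 x) ?_)
  · simpa using h y
  · have : Continuous fun y : E => y - x := by fun_prop
    simpa using this.tendsto x

theorem hasFDerivAt_moll {η : ℝ} (hη : 0 < η) {β : (𝔼 n) → 𝔼 n} (hβ : Integrable β) (x : 𝔼 n) :
    HasFDerivAt (moll η β) (mollDeriv η β x) x := by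
  obtain ⟨L, K, -, -, h⟩ := exists_moll_bounds (n := n) hη
  exact hasFDerivAt_of_taylor fun y => (h β _ hβ le_rfl).2.2 x y

theorem measurable_moll {F : Type*} [NormedAddCommGroup F] [NormedSpace ℝ F] [MeasurableSpace F]
    [BorelSpace F] [SecondCountableTopology F] {β : ℝ → (𝔼 n) → F} (hβ : Measurable (uncurry β))
    (η : ℝ) : Measurable (uncurry fun t => moll η (β t)) := by
  have h1 : Measurable (uncurry fun (p : ℝ × 𝔼 n) (z : 𝔼 n) => β p.1 (p.2 + η • z)) :=
    hβ.comp ((measurable_fst.comp measurable_fst).prodMk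
      ((measurable_snd.comp measurable_fst).add (measurable_snd.const_smul η)))
  exact (h1.stronglyMeasurable.integral_prod_right (ν := mollMeasure n)).measurable

theorem measurable_mollDeriv {β : ℝ → (𝔼 n) → 𝔼 n} (hβ : Measurable (uncurry β)) (η : ℝ) :
    Measurable (uncurry fun t => mollDeriv η (β t)) := by
  have h1 : StronglyMeasurable (uncurry fun (p : ℝ × 𝔼 n) (y : 𝔼 n) =>
      -((fderiv ℝ (scaledKernel n η) (y - p.2)).smulRight (β p.1 y))) := by
    refine StronglyMeasurable.neg ?_
    have ha : StronglyMeasurable fun q : (ℝ × 𝔼 n) × 𝔼 n =>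
        fderiv ℝ (scaledKernel n η) (q.2 - q.1.2) :=
      ((continuous_fderiv_scaledKernel η).comp (by fun_prop)).stronglyMeasurable
    have hb : StronglyMeasurable fun q : (ℝ × 𝔼 n) × 𝔼 n => β q.1.1 q.2 :=
      (hβ.comp ((measurable_fst.comp measurable_fst).prodMk measurable_snd)).stronglyMeasurable
    have hc := (ContinuousLinearMap.smulRightL ℝ (𝔼 n) (𝔼 n)).continuous₂
    exact hc.comp_stronglyMeasurable (ha.prodMk hb)
  exact (h1.integral_prod_right (ν := volume)).measurable

/-- Mollification commutes with weak differentiation, well inside the domain. -/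
theorem mollDeriv_eq_moll {Ω : Set (𝔼 n)} {β : (𝔼 n) → 𝔼 n} {B : (𝔼 n) → (𝔼 n) →L[ℝ] 𝔼 n}
    (h : HasWeakFDerivOn Ω β B) (hβ : Integrable β) {η : ℝ} (hη : 0 < η) {x : 𝔼 n}
    (hx : Metric.closedBall x η ⊆ Ω) : mollDeriv η β x = moll η B x := by
  have hcs : HasCompactSupport fun y => scaledKernel n η (y - x) :=
    (hasCompactSupport_scaledKernel hη).comp_homeomorph (Homeomorph.subRight x)
  have hts := (tsupport_scaledKernel_sub_subset hη x).trans hx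
  have hcd : ContDiff ℝ (⊤ : ℕ∞) fun y => scaledKernel n η (y - x) :=
    (contDiff_scaledKernel η).comp (contDiff_id.sub contDiff_const)
  have hBi : Integrable fun y => scaledKernel n η (y - x) • B y := by
    have hB : IntegrableOn B (Metric.closedBall x η) :=
      h.locInt_deriv.integrableOn_compact_subset hx (isCompact_closedBall x η)
    obtain ⟨C, hC⟩ := (hasCompactSupport_scaledKernel (n := n) hη).exists_bound_of_continuous
      (contDiff_scaledKernel (m := 0) η).continuous
    have h1 : IntegrableOn (fun y => scaledKernel n η (y - x) • B y) (Metric.closedBall x η) :=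
      hB.bdd_smul C hcd.continuous.aestronglyMeasurable (Eventually.of_forall fun y => hC _)
    refine IntegrableOn.integrable_of_forall_notMem_eq_zero (ε' := (𝔼 n) →L[ℝ] 𝔼 n) h1 fun y hy => ?_
    have : scaledKernel n η (y - x) = 0 := image_eq_zero_of_notMem_tsupport
      (f := fun y => scaledKernel n η (y - x))
      fun h' => hy (tsupport_scaledKernel_sub_subset hη x h')
    rw [this]
    exact zero_smul ℝ (B y)
  ext1 v
  rw [mollDeriv, ContinuousLinearMap.integral_apply (integrable_fderiv_scaledKernel_smulRight hη hβ x),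
    moll_eq_integral_scaledKernel hη, ContinuousLinearMap.integral_apply hBi]
  have key := h.integral_eq _ hcd hcs hts v
  have e : ∀ y, fderiv ℝ (fun y => scaledKernel n η (y - x)) y =
      fderiv ℝ (scaledKernel n η) (y - x) := fun y => fderiv_comp_sub x
  simp only [e] at key
  simp only [neg_apply, ContinuousLinearMap.smulRight_apply, integral_neg, key,
    neg_neg, smul_apply]

/-! ### Jensen's inequality for the exponential of a norm -/

/-- `exp (q ‖·‖)` of a mean is at most the mean of `exp (q ‖·‖)`; both sides make sense for every
measurable function, the right-hand side being possibly infinite. -/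
theorem exp_norm_integral_le {α F : Type*} [MeasurableSpace α] {μ : Measure α}
    [IsProbabilityMeasure μ] [NormedAddCommGroup F] [NormedSpace ℝ F] {q : ℝ} (hq : 0 ≤ q)
    {f : α → F} (hf : AEStronglyMeasurable f μ) :
    ENNReal.ofReal (Real.exp (q * ‖∫ a, f a ∂μ‖)) ≤
      ∫⁻ a, ENNReal.ofReal (Real.exp (q * ‖f a‖)) ∂μ := by
  -- if `f` is not integrable its integral is `0`, and the right-hand side is at least `1`
  by_cases hi : Integrable f μ
  swap
  · rw [integral_undef hi]
    simp only [norm_zero, mul_zero, Real.exp_zero, ENNReal.ofReal_one]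
    calc (1 : ℝ≥0∞) = ∫⁻ _, 1 ∂μ := by simp
      _ ≤ _ := lintegral_mono fun a => by
        rw [← ENNReal.ofReal_one]
        exact ENNReal.ofReal_le_ofReal (Real.one_le_exp (by positivity))
  by_cases he : Integrable (fun a => Real.exp (q * ‖f a‖)) μ
  · rw [← ofReal_integral_eq_lintegral_ofReal he (Eventually.of_forall fun a => (Real.exp_pos _).le)]
    refine ENNReal.ofReal_le_ofReal ?_
    have := convexOn_exp.map_integral_le (μ := μ) (f := fun a => q * ‖f a‖)
      Real.continuous_exp.continuousOn isClosed_univ (Eventually.of_forall fun _ => mem_univ _)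
      (hi.norm.const_mul q) he
    refine le_trans (Real.exp_le_exp.2 ?_) this
    rw [integral_const_mul]
    exact mul_le_mul_of_nonneg_left (norm_integral_le_integral_norm _) hq
  · refine le_trans le_top (le_of_eq ?_)
    by_contra hne
    refine he ⟨?_, ?_⟩
    · exact Real.continuous_exp.comp_aestronglyMeasurable (hf.norm.const_mul q)
    · rw [hasFiniteIntegral_iff_ofReal (Eventually.of_forall fun a => (Real.exp_pos _).le)]
      exact lt_top_iff_ne_top.2 (Ne.symm hne)

end Moll

/-! ### Fields with exponentially integrable weak derivative -/

section Morrey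

local notation "𝔼" n => EuclideanSpace ℝ (Fin n)

variable {n : ℕ}

theorem ae_mollMeasure_comp {η : ℝ} (hη : 0 < η) (x : 𝔼 n) {P : (𝔼 n) → Prop}
    (h : ∀ᵐ y, P y) : ∀ᵐ z ∂(mollMeasure n), P (x + η • z) := by
  have h1 : ∀ᵐ z : 𝔼 n, P (x + η • z) := by
    refine ae_of_ae_map (by fun_prop) ?_
    rw [map_add_smul_volume x hη]
    exact Measure.ae_smul_measure h _
  exact (withDensity_absolutelyContinuous _ _).ae_le h1

theorem integral_mollMeasure_norm_le {F : Type*} [NormedAddCommGroup F] [NormedSpace ℝ F]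
    {f : (𝔼 n) → F} {C : ℝ} (h : ∀ᵐ z ∂(mollMeasure n), ‖f z‖ ≤ C) :
    ‖∫ z, f z ∂(mollMeasure n)‖ ≤ C := by
  simpa using norm_integral_le_of_norm_le_const h

theorem norm_moll_le {F : Type*} [NormedAddCommGroup F] [NormedSpace ℝ F] {β : (𝔼 n) → F} {M : ℝ}
    (h : ∀ y, ‖β y‖ ≤ M) (η : ℝ) (x : 𝔼 n) : ‖moll η β x‖ ≤ M :=
  integral_mollMeasure_norm_le (Eventually.of_forall fun _ => h _)

theorem measurable_mollDeriv_apply {β : (𝔼 n) → 𝔼 n} (hm : Measurable β) (η : ℝ) :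
    Measurable (mollDeriv η β) := by
  have h1 : Measurable (uncurry fun _ : ℝ => β) := hm.comp measurable_snd
  have h2 := measurable_mollDeriv h1 η
  exact h2.of_uncurry_left (x := 0)

theorem moll_comm {β : (𝔼 n) → 𝔼 n} (hm : Measurable β) {M : ℝ} (h : ∀ y, ‖β y‖ ≤ M)
    (η κ : ℝ) (x : 𝔼 n) : moll η (moll κ β) x = moll κ (moll η β) x := by
  simp only [moll]
  rw [integral_integral_swap]
  · simp only [add_right_comm]
  · refine Integrable.of_bound (C := M) ?_ (Eventually.of_forall fun _ => h _)
    exact (hm.comp (by fun_prop)).aestronglyMeasurable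

theorem moll_congr_ae {F : Type*} [NormedAddCommGroup F] [NormedSpace ℝ F] {u v : (𝔼 n) → F}
    {η : ℝ} (hη : 0 < η) (x : 𝔼 n) (h : u =ᵐ[volume] v) : moll η u x = moll η v x := by
  unfold moll
  exact integral_congr_ae (ae_mollMeasure_comp (P := fun y => u y = v y) hη x h)

/-- At almost every point, mollifications converge to the mollified function. -/
theorem ae_tendsto_moll {β : (𝔼 n) → 𝔼 n} (hβ : Integrable β) :
    ∀ᵐ x, Tendsto (fun η => moll η β x) (𝓝[>] 0) (𝓝 (β x)) := by
  -- the kernel is dominated by a multiple of the uniform density on balls, whose centers are almost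
  -- surely Lebesgue points
  obtain ⟨β', hβ', hββ'⟩ := hβ.1
  have hi : Integrable β' := (integrable_congr hββ').1 hβ
  filter_upwards [hββ', (Besicovitch.vitaliFamily volume).ae_tendsto_average_norm_sub
    hi.locallyIntegrable] with x hx h
  have h1 := h.comp (Besicovitch.tendsto_filterAt volume x)
  rw [tendsto_iff_norm_sub_tendsto_zero]
  set V : ℝ := (volume : Measure (𝔼 n)).real (Metric.closedBall 0 1)
  have h2 := h1.const_mul (mollBound n * V)
  rw [mul_zero] at h2
  refine squeeze_zero' (Eventually.of_forall fun _ => norm_nonneg _) ?_ h2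
  filter_upwards [self_mem_nhdsWithin] with η hη
  rw [mem_Ioi] at hη
  have e1 : moll η β x = moll η β' x :=
    moll_congr_ae hη x hββ'
  rw [e1, hx]
  have hmeas : Measurable β' := hβ'.measurable
  have hint : IntegrableOn (fun y => β' y - β' x) (Metric.closedBall x η) :=
    hi.integrableOn.sub (integrableOn_const (measure_closedBall_lt_top.ne))
  have e0 := lintegral_mollMeasure_le x hη (subset_refl _)
    Metric.isClosed_closedBall.measurableSet (f := fun y => ‖β' y - β' x‖ₑ)
    (hmeas.sub measurable_const).enorm
  have hfin : ∫⁻ y in Metric.closedBall x η, ‖β' y - β' x‖ₑ ≠ ⊤ := hint.2.ne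
  have hfin' : ENNReal.ofReal (mollBound n * η⁻¹ ^ n) *
      ∫⁻ y in Metric.closedBall x η, ‖β' y - β' x‖ₑ ≠ ⊤ :=
    ENNReal.mul_ne_top ENNReal.ofReal_ne_top hfin
  have hintν : Integrable (fun z => β' (x + η • z) - β' x) (mollMeasure n) :=
    ⟨((hmeas.comp (by fun_prop)).sub measurable_const).aestronglyMeasurable,
      lt_of_le_of_lt e0 (lt_top_iff_ne_top.2 hfin')⟩
  have hintν' : Integrable (fun z => β' (x + η • z)) (mollMeasure n) := by
    have h3 := hintν.add (integrable_const (μ := mollMeasure n) (β' x))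
    refine h3.congr (Eventually.of_forall fun z => ?_)
    simp
  have e2 : moll η β' x - β' x = ∫ z, (β' (x + η • z) - β' x) ∂(mollMeasure n) := by
    rw [integral_sub hintν' (integrable_const _)]; simp [moll]
  rw [e2]
  have e3 := (enorm_integral_le_lintegral_enorm
    (fun z => β' (x + η • z) - β' x) (μ := mollMeasure n)).trans e0
  have e4 := ENNReal.toReal_mono hfin' e3
  rw [toReal_enorm, ENNReal.toReal_mul, ENNReal.toReal_ofReal
    (mul_nonneg mollBound_nonneg (by positivity)), ← integral_norm_eq_lintegral_enorm hint.1] at e4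
  refine e4.trans (le_of_eq ?_)
  simp only [comp]
  rw [setAverage_eq, smul_eq_mul]
  have hv : (volume : Measure (𝔼 n)).real (Metric.closedBall x η) = η ^ n * V := by
    rw [Measure.addHaar_real_closedBall' _ _ hη.le, finrank_euclideanSpace_fin]
  have hV : 0 < V := by
    have h3 := Metric.measure_closedBall_pos (volume : Measure (𝔼 n)) 0 one_pos
    simp only [V, Measure.real]
    exact ENNReal.toReal_pos h3.ne' measure_closedBall_lt_top.ne
  have hn : η⁻¹ ^ n * η ^ n = 1 := by rw [← mul_pow, inv_mul_cancel₀ hη.ne', one_pow]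
  have hn' : η ^ n ≠ 0 := by positivity
  rw [hv, eq_comm, mul_inv, eq_inv_of_mul_eq_one_left hn]
  field_simp

/-- Data at a fixed time: a bounded integrable field `β` with weak differential `B` on the open set
`Ω`, and a finite bound `F` of the integral of `exp (a ‖B‖)` over `Ω`. -/
structure ExpSobolev (Ω : Set (𝔼 n)) (β : (𝔼 n) → 𝔼 n) (B : (𝔼 n) → (𝔼 n) →L[ℝ] 𝔼 n)
    (M a F : ℝ) : Prop where
  isOpen : IsOpen Ω
  meas : Measurable β
  integrable : Integrable β
  bound : ∀ y, ‖β y‖ ≤ M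
  meas_deriv : Measurable B
  weak : HasWeakFDerivOn Ω β B
  pos : 0 < a
  nonneg : 0 ≤ F
  exp_le : ∫⁻ y in Ω, ENNReal.ofReal (Real.exp (a * ‖B y‖)) ≤ ENNReal.ofReal F

theorem Real.log_inv_le_two_div {σ : ℝ} (hσ : 0 < σ) : Real.log ((σ ^ 2)⁻¹) ≤ 2 / σ := by
  rw [← inv_pow, Real.log_pow, Nat.cast_ofNat, div_eq_mul_inv]
  exact mul_le_mul_of_nonneg_left ((Real.log_le_sub_one_of_pos (by positivity)).trans (by linarith))
    zero_le_two

namespace ExpSobolev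

variable {Ω : Set (𝔼 n)} {β : (𝔼 n) → 𝔼 n} {B : (𝔼 n) → (𝔼 n) →L[ℝ] 𝔼 n} {M a F : ℝ}

theorem measurable_exp (h : ExpSobolev Ω β B M a F) (q : ℝ) :
    Measurable fun y => ENNReal.ofReal (Real.exp (q * ‖B y‖)) :=
  (Real.measurable_exp.comp (h.meas_deriv.norm.const_mul q)).ennreal_ofReal

/-- Passing from an exponential bound to a bound with a logarithm of the scale. -/
theorem le_of_exp_le (h : ExpSobolev Ω β B M a F) {N η : ℝ} (hη : 0 < η)
    (he : ENNReal.ofReal (Real.exp (a * N)) ≤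
      ENNReal.ofReal (mollBound n * η⁻¹ ^ n) * ENNReal.ofReal F) :
    N ≤ a⁻¹ * (mollBound n * F + n * Real.log η⁻¹) := by
  have ha := h.pos
  rw [← ENNReal.ofReal_mul (mul_nonneg mollBound_nonneg (by positivity)),
    ENNReal.ofReal_le_ofReal_iff (mul_nonneg (mul_nonneg mollBound_nonneg (by positivity)) h.nonneg)]
    at he
  have h1 : (0 : ℝ) < η⁻¹ ^ n := by positivity
  have e : mollBound n * η⁻¹ ^ n * F = (mollBound n * F) * η⁻¹ ^ n := by ring
  rw [e] at he
  have h2 : 0 < mollBound n * F := by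
    by_contra hcon
    have := (Real.exp_pos (a * N)).trans_le he
    exact absurd this (not_lt.2 (mul_nonpos_of_nonpos_of_nonneg (not_lt.1 hcon) h1.le))
  have h3 := Real.log_le_log (Real.exp_pos _) he
  rw [Real.log_exp, Real.log_mul h2.ne' h1.ne', Real.log_pow] at h3
  have h4 := Real.log_le_sub_one_of_pos h2
  rw [← div_eq_inv_mul, le_div_iff₀ ha]
  linarith

/-- Jensen's inequality for the differential of the mollified field. -/
theorem exp_norm_mollDeriv_le (h : ExpSobolev Ω β B M a F) {q : ℝ} (hq : 0 ≤ q) {η : ℝ} (hη : 0 < η)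
    {x : 𝔼 n} (hx : Metric.closedBall x η ⊆ Ω) :
    ENNReal.ofReal (Real.exp (q * ‖mollDeriv η β x‖)) ≤
      ∫⁻ z, ENNReal.ofReal (Real.exp (q * ‖B (x + η • z)‖)) ∂(mollMeasure n) := by
  rw [mollDeriv_eq_moll h.weak h.integrable hη hx]
  exact exp_norm_integral_le hq (h.meas_deriv.comp (by fun_prop)).aestronglyMeasurable

/-- The Lipschitz constant of the mollification grows only logarithmically in the scale. -/
theorem norm_mollDeriv_le (h : ExpSobolev Ω β B M a F) {η : ℝ} (hη : 0 < η)
    {x : 𝔼 n} (hx : Metric.closedBall x η ⊆ Ω) :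
    ‖mollDeriv η β x‖ ≤ a⁻¹ * (mollBound n * F + n * Real.log η⁻¹) := by
  refine h.le_of_exp_le hη ((h.exp_norm_mollDeriv_le h.pos.le hη hx).trans ?_)
  refine (lintegral_mollMeasure_le x hη hx h.isOpen.measurableSet (h.measurable_exp a)).trans ?_
  gcongr
  exact h.exp_le

theorem lipschitz_moll (h : ExpSobolev Ω β B M a F) {η : ℝ} (hη : 0 < η) {S : Set (𝔼 n)}
    (hS : Convex ℝ S) (hSΩ : ∀ x ∈ S, Metric.closedBall x η ⊆ Ω) {x y : 𝔼 n} (hx : x ∈ S)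
    (hy : y ∈ S) : ‖moll η β x - moll η β y‖ ≤
      a⁻¹ * (mollBound n * F + n * Real.log η⁻¹) * ‖x - y‖ :=
  hS.norm_image_sub_le_of_norm_hasFDerivWithin_le
    (fun z _ => (hasFDerivAt_moll hη h.integrable z).hasFDerivWithinAt)
    (fun z hz => h.norm_mollDeriv_le hη (hSΩ z hz)) hy hx

/-- The constant `G` such that mollification at scale `η` moves the field by at most `√η G`. -/
noncomputable def modulus (n : ℕ) (a F : ℝ) : ℝ := a⁻¹ * (2 * (mollBound n * F) + 4 * n)

theorem modulus_nonneg (h : ExpSobolev Ω β B M a F) : 0 ≤ modulus n a F := by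
  have := h.pos; have := h.nonneg; have := mollBound_nonneg (n := n)
  unfold modulus; positivity

/-- The differential of a mollification at scale `κ`, averaged at scale `θ`, obeys the logarithmic
bound at the scale `θ`, uniformly in `κ`: the order of the two averages can be exchanged. -/
theorem norm_integral_mollDeriv_le (h : ExpSobolev Ω β B M a F) {θ κ : ℝ} (hθ : 0 < θ) (hκ : 0 < κ)
    {x : 𝔼 n} (hx : Metric.closedBall x (θ + κ) ⊆ Ω) :
    ∫ z, ‖mollDeriv κ β (x + θ • z)‖ ∂(mollMeasure n) ≤
      a⁻¹ * (mollBound n * F + n * Real.log θ⁻¹) := by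
  have hDm : Measurable (mollDeriv κ β) := measurable_mollDeriv_apply h.meas κ
  have hN : 0 ≤ ∫ z, ‖mollDeriv κ β (x + θ • z)‖ ∂(mollMeasure n) :=
    integral_nonneg fun _ => norm_nonneg _
  refine h.le_of_exp_le hθ ?_
  have h1 := exp_norm_integral_le (μ := mollMeasure n) h.pos.le
    (f := fun z => ‖mollDeriv κ β (x + θ • z)‖) ((hDm.comp (by fun_prop)).norm.aestronglyMeasurable)
  rw [Real.norm_of_nonneg hN] at h1
  refine h1.trans ?_
  simp only [norm_norm]
  calc ∫⁻ z, ENNReal.ofReal (Real.exp (a * ‖mollDeriv κ β (x + θ • z)‖)) ∂(mollMeasure n)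
      ≤ ∫⁻ z, ∫⁻ w, ENNReal.ofReal (Real.exp (a * ‖B (x + θ • z + κ • w)‖)) ∂(mollMeasure n)
          ∂(mollMeasure n) := by
        refine lintegral_mono_ae ?_
        filter_upwards [ae_mollMeasure_norm_le] with z hz
        refine h.exp_norm_mollDeriv_le h.pos.le hκ (Subset.trans ?_ hx)
        intro y hy
        rw [mem_closedBall_iff_norm] at hy ⊢
        calc ‖y - x‖ = ‖θ • z + (y - (x + θ • z))‖ := by congr 1; abel
          _ ≤ θ + κ := by
            refine (norm_add_le _ _).trans (add_le_add ?_ hy)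
            rw [norm_smul, Real.norm_of_nonneg hθ.le]; exact mul_le_of_le_one_right hθ.le hz
    _ = ∫⁻ w, ∫⁻ z, ENNReal.ofReal (Real.exp (a * ‖B (x + κ • w + θ • z)‖)) ∂(mollMeasure n)
          ∂(mollMeasure n) := by
        rw [lintegral_lintegral_swap]
        · simp only [add_right_comm]
        · exact ((h.measurable_exp a).comp
            (by fun_prop : Measurable fun p : (𝔼 n) × 𝔼 n => x + θ • p.1 + κ • p.2)).aemeasurable
    _ ≤ ∫⁻ _, ENNReal.ofReal (mollBound n * θ⁻¹ ^ n) * ENNReal.ofReal F ∂(mollMeasure n) := by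
        refine lintegral_mono_ae ?_
        filter_upwards [ae_mollMeasure_norm_le] with w hw
        refine (lintegral_mollMeasure_le (x + κ • w) hθ (S := Ω) (Subset.trans ?_ hx)
          h.isOpen.measurableSet (h.measurable_exp a)).trans ?_
        · intro y hy
          rw [mem_closedBall_iff_norm] at hy ⊢
          calc ‖y - x‖ = ‖(y - (x + κ • w)) + κ • w‖ := by congr 1; abel
            _ ≤ θ + κ := by
              refine (norm_add_le _ _).trans (add_le_add hy ?_)
              rw [norm_smul, Real.norm_of_nonneg hκ.le]; exact mul_le_of_le_one_right hκ.le hw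
        · gcongr; exact h.exp_le
    _ = _ := by simp

/-- Mollifying a second time at scale `η` moves the field by `O(√η)`, uniformly in the first
scale `κ`. -/
theorem norm_moll_moll_sub_le (h : ExpSobolev Ω β B M a F) {η κ : ℝ} (hη : 0 < η) (hη1 : η ≤ 1)
    (hκ : 0 < κ) {x : 𝔼 n} (hx : Metric.closedBall x (η + κ) ⊆ Ω) :
    ‖moll η (moll κ β) x - moll κ β x‖ ≤ √η * modulus n a F := by
  obtain ⟨L, K, hL, hK, H⟩ := exists_moll_bounds (n := n) hκ
  obtain ⟨h1, h2, -⟩ := H β _ h.integrable le_rfl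
  set L' := L * ∫ y, ‖β y‖
  have hDm : Measurable (mollDeriv κ β) := measurable_mollDeriv_apply h.meas κ
  have hvm : Measurable (moll κ β) :=
    (continuous_iff_continuousAt.2 fun z =>
      (hasFDerivAt_moll hκ h.integrable z).continuousAt).measurable
  have hderiv : ∀ θ : ℝ, HasDerivAt (fun θ => moll θ (moll κ β) x)
      (∫ z, mollDeriv κ β (x + θ • z) z ∂(mollMeasure n)) θ := by
    intro θ
    refine (hasDerivAt_integral_of_dominated_loc_of_deriv_le (bound := fun _ => L')
      (F := fun θ z => moll κ β (x + θ • z)) (F' := fun θ z => mollDeriv κ β (x + θ • z) z)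
      univ_mem (Eventually.of_forall fun θ => (hvm.comp (by fun_prop)).aestronglyMeasurable) ?_ ?_ ?_
      (integrable_const _) ?_).2
    · exact Integrable.of_bound (hvm.comp (by fun_prop)).aestronglyMeasurable M
        (Eventually.of_forall fun _ => norm_moll_le h.bound _ _)
    · have hA : StronglyMeasurable fun z => mollDeriv κ β (x + θ • z) :=
        (hDm.comp (by fun_prop)).stronglyMeasurable
      exact (isBoundedBilinearMap_apply.continuous.comp_stronglyMeasurable
        (hA.prodMk stronglyMeasurable_id)).aestronglyMeasurable
    · filter_upwards [ae_mollMeasure_norm_le] with z hz θ _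
      calc _ ≤ _ := (mollDeriv κ β (x + θ • z)).le_opNorm z
        _ ≤ L' * 1 := mul_le_mul (h2 _) hz (norm_nonneg _) ((norm_nonneg _).trans (h2 0))
        _ = L' := mul_one _
    · refine Eventually.of_forall fun z θ _ => ?_
      have e1 : HasDerivAt (fun θ : ℝ => x + θ • z) z θ := by
        simpa using ((hasDerivAt_id θ).smul_const z).const_add x
      exact (hasFDerivAt_moll hκ h.integrable _).comp_hasDerivAt θ e1
  have hbd : ∀ θ, 0 < θ → θ ≤ η → ‖∫ z, mollDeriv κ β (x + θ • z) z ∂(mollMeasure n)‖ ≤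
      a⁻¹ * (mollBound n * F + n * Real.log θ⁻¹) := by
    intro θ hθ hθη
    refine le_trans ?_ (h.norm_integral_mollDeriv_le hθ hκ
      ((Metric.closedBall_subset_closedBall (by linarith)).trans hx))
    refine norm_integral_le_of_norm_le ?_ ?_
    · exact Integrable.of_bound ((hDm.comp (by fun_prop)).norm.aestronglyMeasurable) L'
        (Eventually.of_forall fun z => by rw [norm_norm]; exact h2 _)
    · filter_upwards [ae_mollMeasure_norm_le] with z hz
      exact ((mollDeriv κ β (x + θ • z)).le_opNorm z).trans
        (mul_le_of_le_one_right (norm_nonneg _) hz)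
  -- the substitution `θ = σ ^ 2` makes the logarithmic singularity of the derivative harmless
  have hsq : ∀ σ : ℝ, HasDerivAt (fun σ : ℝ => moll (σ ^ 2) (moll κ β) x)
      ((2 * σ) • ∫ z, mollDeriv κ β (x + σ ^ 2 • z) z ∂(mollMeasure n)) σ := by
    intro σ
    have h3 : HasDerivAt (fun σ : ℝ => σ ^ 2) (2 * σ) σ := by simpa using hasDerivAt_pow 2 σ
    exact (hderiv (σ ^ 2)).scomp σ h3
  have hs1 : √η ≤ 1 := Real.sqrt_le_one.2 hη1
  have := norm_image_sub_le_of_norm_deriv_le_segment' (f := fun σ : ℝ => moll (σ ^ 2) (moll κ β) x)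
    (a := 0) (b := √η) (C := modulus n a F) (fun σ _ => (hsq σ).hasDerivWithinAt) ?_ (√η)
    ⟨Real.sqrt_nonneg _, le_rfl⟩
  · simp only [Real.sq_sqrt hη.le] at this
    rw [zero_pow two_ne_zero, moll_zero, sub_zero, mul_comm] at this
    exact this
  · intro σ hσ
    rcases hσ.1.eq_or_lt with h0 | h0
    · subst h0
      simpa using h.modulus_nonneg
    · have hσ1 : σ ≤ 1 := hσ.2.le.trans hs1
      have hση : σ ^ 2 ≤ η := by
        have := pow_le_pow_left₀ h0.le hσ.2.le 2
        rwa [Real.sq_sqrt hη.le] at this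
      rw [norm_smul, Real.norm_of_nonneg (by positivity)]
      have hCF : 0 ≤ mollBound n * F := mul_nonneg mollBound_nonneg h.nonneg
      have ha := h.pos
      calc _ ≤ 2 * σ * (a⁻¹ * (mollBound n * F + n * (2 / σ))) := by
            refine mul_le_mul_of_nonneg_left ((hbd _ (by positivity) hση).trans ?_) (by positivity)
            gcongr
            exact Real.log_inv_le_two_div h0
        _ = a⁻¹ * (σ * (2 * (mollBound n * F)) + 4 * n) := by field_simp; ring
        _ ≤ modulus n a F := by
            unfold modulus
            gcongr a⁻¹ * (?_ + _)
            exact mul_le_of_le_one_left (by positivity) hσ1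

/-- Two mollifications of an exponentially Sobolev field are close to each other. -/
theorem norm_moll_sub_moll_le (h : ExpSobolev Ω β B M a F) {η κ : ℝ} (hη : 0 < η) (hη1 : η ≤ 1)
    (hκ : 0 < κ) (hκ1 : κ ≤ 1) {x : 𝔼 n} (hx : Metric.closedBall x (η + κ) ⊆ Ω) :
    ‖moll κ β x - moll η β x‖ ≤ (√η + √κ) * modulus n a F := by
  have h1 := h.norm_moll_moll_sub_le hη hη1 hκ hx
  have h2 := h.norm_moll_moll_sub_le hκ hκ1 hη (by rwa [add_comm])
  rw [moll_comm h.meas h.bound] at h2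
  rw [norm_sub_rev] at h1
  calc _ = ‖(moll κ β x - moll η (moll κ β) x) + (moll η (moll κ β) x - moll η β x)‖ := by
        congr 1; abel
    _ ≤ _ := by rw [add_mul]; exact (norm_add_le _ _).trans (add_le_add h1 h2)

theorem tendsto_moll_of_continuousAt {β g : (𝔼 n) → 𝔼 n} (hβ : Measurable β) {M : ℝ}
    (hb : ∀ y, ‖β y‖ ≤ M) {Ω : Set (𝔼 n)} (hΩ : IsOpen Ω)
    (hg : ∀ᵐ y ∂(volume.restrict Ω), g y = β y) {x : 𝔼 n} (hx : x ∈ Ω) (hc : ContinuousAt g x) :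
    Tendsto (fun η => moll η β x) (𝓝[>] 0) (𝓝 (g x)) := by
  rw [Metric.tendsto_nhds]
  intro ε hε
  obtain ⟨r, hr, hr'⟩ := Metric.continuousAt_iff.1 hc (ε / 2) (half_pos hε)
  obtain ⟨r₂, hr₂, hrΩ⟩ := Metric.isOpen_iff.1 hΩ x hx
  have hpos : 0 < min r r₂ := lt_min hr hr₂
  filter_upwards [Ioo_mem_nhdsGT hpos] with η hη
  rw [ae_restrict_iff' hΩ.measurableSet] at hg
  have hi : Integrable (fun z => β (x + η • z)) (mollMeasure n) :=
    Integrable.of_bound (hβ.comp (by fun_prop)).aestronglyMeasurable M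
      (Eventually.of_forall fun _ => hb _)
  have e2 : moll η β x - g x = ∫ z, (β (x + η • z) - g x) ∂(mollMeasure n) := by
    rw [integral_sub hi (integrable_const _)]; simp [moll]
  rw [dist_eq_norm, e2]
  refine lt_of_le_of_lt (integral_mollMeasure_norm_le (C := ε / 2) ?_) (half_lt_self hε)
  filter_upwards [ae_mollMeasure_comp hη.1 x hg, ae_mollMeasure_norm_le] with z hz hz1
  have hd : dist (x + η • z) x ≤ η := by
    rw [dist_eq_norm, add_sub_cancel_left, norm_smul, Real.norm_of_nonneg hη.1.le]
    exact mul_le_of_le_one_right hη.1.le hz1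
  have hd2 : dist (x + η • z) x < min r r₂ := hd.trans_lt hη.2
  rw [← hz (hrΩ (hd2.trans_le (min_le_right _ _))), ← dist_eq_norm]
  exact (hr' (hd2.trans_le (min_le_left _ _))).le

/-- The continuous representative is uniformly close to mollifications. -/
theorem norm_sub_moll_le (h : ExpSobolev Ω β B M a F) {g : (𝔼 n) → 𝔼 n} (hg : ContinuousOn g Ω)
    (hgβ : ∀ᵐ y ∂(volume.restrict Ω), g y = β y) {η : ℝ} (hη : 0 < η) (hη1 : η ≤ 1) {x : 𝔼 n}
    (hx : Metric.closedBall x (2 * η) ⊆ Ω) : ‖g x - moll η β x‖ ≤ √η * modulus n a F := by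
  have hxΩ : x ∈ Ω := hx (Metric.mem_closedBall_self (by positivity))
  have h1 := tendsto_moll_of_continuousAt h.meas h.bound h.isOpen hgβ hxΩ
    (hg.continuousAt (h.isOpen.mem_nhds hxΩ))
  have h2 : Tendsto (fun κ => (√η + √κ) * modulus n a F) (𝓝[>] 0) (𝓝 (√η * modulus n a F)) := by
    have : Continuous fun κ => (√η + √κ) * modulus n a F := by fun_prop
    have h3 := this.tendsto 0
    simp only [Real.sqrt_zero, add_zero] at h3
    exact h3.mono_left nhdsWithin_le_nhds
  refine le_of_tendsto_of_tendsto (h1.sub tendsto_const_nhds).norm h2 ?_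
  filter_upwards [Ioo_mem_nhdsGT hη] with κ hκ
  exact h.norm_moll_sub_moll_le hη hη1 hκ.1 (hκ.2.le.trans hη1)
    ((Metric.closedBall_subset_closedBall (by linarith [hκ.2])).trans hx)

theorem norm_le_of_continuousOn (h : ExpSobolev Ω β B M a F) {g : (𝔼 n) → 𝔼 n}
    (hg : ContinuousOn g Ω) (hgβ : ∀ᵐ y ∂(volume.restrict Ω), g y = β y) {x : 𝔼 n} (hx : x ∈ Ω) :
    ‖g x‖ ≤ M :=
  le_of_tendsto (tendsto_moll_of_continuousAt h.meas h.bound h.isOpen hgβ hx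
    (hg.continuousAt (h.isOpen.mem_nhds hx))).norm
    (Eventually.of_forall fun _ => norm_moll_le h.bound _ _)

/-- An exponentially Sobolev field has a continuous representative. -/
theorem exists_continuousOn (h : ExpSobolev Ω β B M a F) :
    ∃ g, ContinuousOn g Ω ∧ ∀ᵐ y ∂(volume.restrict Ω), g y = β y := by
  have hlim : ∀ x, x ∈ Ω → ∃ y, Tendsto (fun η => moll η β x) (𝓝[>] 0) (𝓝 y) := by
    intro x hx
    obtain ⟨r, hr, hrΩ⟩ := Metric.isOpen_iff.1 h.isOpen x hx
    refine cauchy_iff_exists_le_nhds.1 ?_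
    rw [Metric.cauchy_iff]
    refine ⟨inferInstance, fun ε hε => ?_⟩
    have hG : Tendsto (fun η : ℝ => √η * modulus n a F) (𝓝[>] 0) (𝓝 0) := by
      have : Continuous fun η : ℝ => √η * modulus n a F := by fun_prop
      simpa using (this.tendsto 0).mono_left nhdsWithin_le_nhds
    have hev : ∀ᶠ η : ℝ in 𝓝[>] 0, 0 < η ∧ η ≤ 1 ∧ η < r / 2 ∧ √η * modulus n a F < ε / 2 := by
      filter_upwards [self_mem_nhdsWithin, Ioo_mem_nhdsGT one_pos, Ioo_mem_nhdsGT (half_pos hr),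
        hG.eventually_lt_const (half_pos hε)] with η h1 h2 h3 h4 using ⟨h1, h2.2.le, h3.2, h4⟩
    refine ⟨_, image_mem_map hev, ?_⟩
    rintro _ ⟨η, ⟨h1, h2, h3, h4⟩, rfl⟩ _ ⟨κ, ⟨k1, k2, k3, k4⟩, rfl⟩
    rw [dist_eq_norm]
    refine (h.norm_moll_sub_moll_le k1 k2 h1 h2 (Subset.trans ?_ hrΩ)).trans_lt ?_
    · exact (Metric.closedBall_subset_ball (by linarith))
    · rw [add_mul]; linarith
  choose! g hg using hlim
  refine ⟨g, ?_, ?_⟩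
  · have hU : TendstoLocallyUniformlyOn (fun η => moll η β) g (𝓝[>] 0) Ω := by
      rw [Metric.tendstoLocallyUniformlyOn_iff]
      intro ε hε x hx
      obtain ⟨r, hr, hrΩ⟩ := Metric.isOpen_iff.1 h.isOpen x hx
      refine ⟨Ω ∩ Metric.ball x (r / 2),
        inter_mem self_mem_nhdsWithin (mem_nhdsWithin_of_mem_nhds (Metric.ball_mem_nhds _ (by positivity))), ?_⟩
      have hG : Tendsto (fun η : ℝ => √η * modulus n a F) (𝓝[>] 0) (𝓝 0) := by
        have : Continuous fun η : ℝ => √η * modulus n a F := by fun_prop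
        simpa using (this.tendsto 0).mono_left nhdsWithin_le_nhds
      filter_upwards [self_mem_nhdsWithin, Ioo_mem_nhdsGT one_pos,
        Ioo_mem_nhdsGT (show 0 < r / 4 by positivity), hG.eventually_lt_const hε] with η h1 h2 h3 h4 y hy
      rw [mem_Ioi] at h1
      rw [dist_eq_norm]
      refine lt_of_le_of_lt ?_ h4
      have t2 : Tendsto (fun κ => (√η + √κ) * modulus n a F) (𝓝[>] 0) (𝓝 (√η * modulus n a F)) := by
        have : Continuous fun κ => (√η + √κ) * modulus n a F := by fun_prop
        have h3 := this.tendsto 0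
        simp only [Real.sqrt_zero, add_zero] at h3
        exact h3.mono_left nhdsWithin_le_nhds
      refine le_of_tendsto_of_tendsto ((hg y hy.1).sub tendsto_const_nhds).norm t2 ?_
      filter_upwards [Ioo_mem_nhdsGT h1] with κ hκ
      refine h.norm_moll_sub_moll_le h1 h2.2.le hκ.1 (hκ.2.le.trans h2.2.le) (Subset.trans ?_ hrΩ)
      refine Metric.closedBall_subset_ball' ?_
      have := Metric.mem_ball.1 hy.2
      linarith [hκ.2, h3.2]
    refine hU.continuousOn (Eventually.frequently ?_)
    filter_upwards [self_mem_nhdsWithin] with η hη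
    exact fun z _ => (hasFDerivAt_moll hη h.integrable z).continuousAt.continuousWithinAt
  · rw [ae_restrict_iff' h.isOpen.measurableSet]
    filter_upwards [ae_tendsto_moll h.integrable] with y hy hyΩ
    exact tendsto_nhds_unique (hg y hyΩ) hy

end ExpSobolev

end Morrey

/-! ### Stability of trajectories -/

/-- The continuity method: a strict bound that can be deduced from the weak bound up to the current
time, and that holds at one time, always holds. -/
theorem forall_lt_of_bootstrap {u : ℝ → ℝ} {a b s r₀ : ℝ} (hu : ContinuousOn u (Icc a b))
    (hs : s ∈ Icc a b) (h0 : u s < r₀)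
    (h : ∀ r ∈ Icc a b, (∀ r' ∈ uIcc s r, u r' ≤ r₀) → u r < r₀) : ∀ r ∈ Icc a b, u r < r₀ := by
  intro r hr
  by_contra! hcon
  have hsub : ∀ {x}, x ∈ Icc a b → uIcc s x ⊆ Icc a b := fun hx =>
    (uIcc_subset_Icc hs hx)
  have ivt : ∀ x ∈ Icc a b, r₀ ≤ u x → ∃ y ∈ uIcc s x, u y = r₀ := fun x hx hux => by
    have := intermediate_value_uIcc (hu.mono (hsub hx))
    obtain ⟨y, hy, hy'⟩ := this (show r₀ ∈ uIcc (u s) (u x) by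
      rw [uIcc_of_le (h0.le.trans hux)]; exact ⟨h0.le, hux⟩)
    exact ⟨y, hy, hy'⟩
  have hcomp : IsCompact (uIcc s r ∩ u ⁻¹' {r₀}) := by
    have := (hu.mono (hsub hr)).preimage_isClosed_of_isClosed isClosed_Icc (isClosed_singleton (x := r₀))
    exact isCompact_uIcc.of_isClosed_subset this inter_subset_left
  obtain ⟨y, hy, hyu⟩ := ivt r hr hcon
  -- the time closest to `s` at which the bound is attained
  obtain ⟨r₁, hr₁, hmin⟩ := hcomp.exists_isMinOn ⟨y, hy, hyu⟩
    (f := fun x => |x - s|) (by fun_prop)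
  have hr₁' := hsub hr hr₁.1
  refine absurd (h r₁ hr₁' fun r' hr' => ?_) (not_lt.2 (le_of_eq hr₁.2.symm))
  by_contra! hc
  have hr'I := hsub hr₁' hr'
  obtain ⟨z, hz, hzu⟩ := ivt r' hr'I hc.le
  have h1 : |r₁ - s| ≤ |z - s| :=
    hmin ⟨uIcc_subset_uIcc left_mem_uIcc hr₁.1 (uIcc_subset_uIcc left_mem_uIcc hr' hz), hzu⟩
  have : z = r' := by
    rcases le_total s r₁ with hc1 | hc1
    · rw [uIcc_of_le hc1] at hr'
      rw [uIcc_of_le hr'.1] at hz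
      rw [abs_of_nonneg (by linarith), abs_of_nonneg (by linarith [hz.1])] at h1
      linarith [hz.2, hr'.2]
    · rw [uIcc_of_ge hc1] at hr'
      rw [uIcc_of_ge hr'.2] at hz
      rw [abs_of_nonpos (by linarith), abs_of_nonpos (by linarith [hz.2])] at h1
      linarith [hz.1, hr'.1]
  rw [this] at hzu
  exact absurd hzu hc.ne'

section Stability

local notation "𝔼" n => EuclideanSpace ℝ (Fin n)

variable {n : ℕ}

/-- A bounded measurable field, defined for all times and points but of interest on `[t₀, t₁] × Ω`,
which is exponentially Sobolev at almost every time of the interval, with an integrable bound `F`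
of the exponential integrals. The exponent `a` is large compared with the length of the time
interval; `R` bounds the `L¹` norms. -/
structure ExpSobolevField (t₀ t₁ : ℝ) (Ω : Set (𝔼 n)) (β : ℝ → (𝔼 n) → 𝔼 n)
    (B : ℝ → (𝔼 n) → (𝔼 n) →L[ℝ] 𝔼 n) (M R a : ℝ) (F : ℝ → ℝ) : Prop where
  lt : t₀ < t₁
  isOpen : IsOpen Ω
  meas : Measurable (uncurry β)
  bound : ∀ t y, ‖β t y‖ ≤ M
  integrable : ∀ t, Integrable (β t)
  integral_le : ∀ t, ∫ y, ‖β t y‖ ≤ R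
  integrableOn : IntegrableOn F (Icc t₀ t₁)
  nonneg : ∀ t, 0 ≤ F t
  ae : ∀ᵐ t, t ∈ Icc t₀ t₁ → ExpSobolev Ω (β t) (B t) M a (F t)
  pos : 0 < a
  le : 4 * (n * (t₁ - t₀)) ≤ a

/-- The mollified field. -/
noncomputable abbrev mollField (β : ℝ → (𝔼 n) → 𝔼 n) (η : ℝ) : ℝ → (𝔼 n) → 𝔼 n :=
  fun t => moll η (β t)

namespace ExpSobolevField

variable {t₀ t₁ : ℝ} {Ω : Set (𝔼 n)} {β : ℝ → (𝔼 n) → 𝔼 n}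
    {B : ℝ → (𝔼 n) → (𝔼 n) →L[ℝ] 𝔼 n} {M R a : ℝ} {F : ℝ → ℝ}

theorem exists_isLipField (h : ExpSobolevField t₀ t₁ Ω β B M R a F) {η : ℝ} (hη : 0 < η) :
    ∃ L K, IsLipField (mollField β η) M L ∧ (∀ t x, ‖mollDeriv η (β t) x‖ ≤ L) ∧
      ∀ t x y, ‖mollField β η t y - mollField β η t x - mollDeriv η (β t) x (y - x)‖ ≤
        K * ‖y - x‖ ^ 2 := by
  obtain ⟨L, K, -, -, H⟩ := exists_moll_bounds (n := n) hη
  refine ⟨L * R, K * R, ⟨measurable_moll h.meas η, fun t x => norm_moll_le (h.bound t) η x,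
    fun t => (H _ _ (h.integrable t) (h.integral_le t)).1⟩, fun t =>
    (H _ _ (h.integrable t) (h.integral_le t)).2.1, fun t =>
    (H _ _ (h.integrable t) (h.integral_le t)).2.2⟩

theorem bound_nonneg (h : ExpSobolevField t₀ t₁ Ω β B M R a F) : 0 ≤ M :=
  (norm_nonneg _).trans (h.bound 0 0)

/-- The total modulus, integrated over the time interval. -/
noncomputable def totalModulus (n : ℕ) (t₀ t₁ a : ℝ) (F : ℝ → ℝ) : ℝ :=
  ∫ τ in Icc t₀ t₁, ExpSobolev.modulus n a (F τ)

/-- The amplification factor, up to a power of the scale. -/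
noncomputable def amplification (n : ℕ) (t₀ t₁ a : ℝ) (F : ℝ → ℝ) : ℝ :=
  Real.exp (∫ τ in Icc t₀ t₁, a⁻¹ * (mollBound n * F τ))

theorem integrableOn_modulus (h : ExpSobolevField t₀ t₁ Ω β B M R a F) :
    IntegrableOn (fun τ => ExpSobolev.modulus n a (F τ)) (Icc t₀ t₁) := by
  unfold ExpSobolev.modulus
  have : IntegrableOn (fun _ : ℝ => 4 * (n : ℝ)) (Icc t₀ t₁) := integrableOn_const (by simp)
  exact (((h.integrableOn.const_mul _).const_mul 2).add this).const_mul _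

theorem modulus_nonneg (h : ExpSobolevField t₀ t₁ Ω β B M R a F) (τ : ℝ) :
    0 ≤ ExpSobolev.modulus n a (F τ) := by
  have := h.pos; have := h.nonneg τ; have := mollBound_nonneg (n := n)
  unfold ExpSobolev.modulus; positivity

theorem totalModulus_nonneg (h : ExpSobolevField t₀ t₁ Ω β B M R a F) :
    0 ≤ totalModulus n t₀ t₁ a F := integral_nonneg fun τ => h.modulus_nonneg τ

/-- Two curves which nearly follow the mollified field at scale `η`, inside a tube contained in
`Ω`, stay close to each other. The amplification is only a small negative power of `η`. -/
theorem norm_curve_sub_le (h : ExpSobolevField t₀ t₁ Ω β B M R a F) {η : ℝ} (hη : 0 < η) (hη1 : η ≤ 1)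
    {s t : ℝ} (hst : uIcc s t ⊆ Icc t₀ t₁) {γ₁ γ₂ f₁ f₂ m : ℝ → 𝔼 n} {r₀ e : ℝ} (he : 0 ≤ e)
    (hc₁ : ContinuousOn γ₁ (uIcc s t)) (hc₂ : ContinuousOn γ₂ (uIcc s t))
    (hf₁ : IntervalIntegrable f₁ volume s t) (hf₂ : IntervalIntegrable f₂ volume s t)
    (hγ₁ : ∀ r ∈ uIcc s t, γ₁ r = γ₁ s + ∫ τ in s..r, f₁ τ)
    (hγ₂ : ∀ r ∈ uIcc s t, γ₂ r = γ₂ s + ∫ τ in s..r, f₂ τ)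
    (hm₁ : ∀ r ∈ uIcc s t, γ₁ r ∈ Metric.closedBall (m r) r₀)
    (hm₂ : ∀ r ∈ uIcc s t, γ₂ r ∈ Metric.closedBall (m r) r₀)
    (hmΩ : ∀ r ∈ uIcc s t, Metric.closedBall (m r) (r₀ + η) ⊆ Ω)
    (herr : ∀ᵐ τ, τ ∈ uIoc s t → ‖f₁ τ - mollField β η τ (γ₁ τ)‖ +
      ‖f₂ τ - mollField β η τ (γ₂ τ)‖ ≤ e * ExpSobolev.modulus n a (F τ)) :
    ‖γ₁ t - γ₂ t‖ ≤ (‖γ₁ s - γ₂ s‖ + e * totalModulus n t₀ t₁ a F) *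
      (amplification n t₀ t₁ a F * η ^ (-(1 / 4) : ℝ)) := by
  have ha := h.pos
  have hlog : 0 ≤ Real.log η⁻¹ := Real.log_nonneg ((one_le_inv₀ hη).2 hη1)
  set k : ℝ → ℝ := fun τ => a⁻¹ * (mollBound n * F τ + n * Real.log η⁻¹)
  have hk0 : ∀ τ, 0 ≤ k τ := fun τ => by
    have := h.nonneg τ; have := mollBound_nonneg (n := n); positivity
  have hkI : IntegrableOn k (Icc t₀ t₁) := by
    have : IntegrableOn (fun _ : ℝ => (n : ℝ) * Real.log η⁻¹) (Icc t₀ t₁) :=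
      integrableOn_const (by simp)
    exact ((h.integrableOn.const_mul _).add this).const_mul _
  have hoc : ∀ {r}, r ∈ uIcc s t → uIoc s r ⊆ uIcc s t := fun hr =>
    uIoc_subset_uIcc.trans (uIcc_subset_uIcc left_mem_uIcc hr)
  have hii : ∀ {f : ℝ → ℝ}, IntegrableOn f (Icc t₀ t₁) → ∀ {r}, r ∈ uIcc s t →
      IntervalIntegrable f volume s r := fun hf r hr =>
    intervalIntegrable_iff.2 (hf.mono_set ((hoc hr).trans hst))
  have habs : ∀ {f : ℝ → ℝ}, (∀ τ, 0 ≤ f τ) → IntegrableOn f (Icc t₀ t₁) → ∀ {r}, r ∈ uIcc s t →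
      |∫ τ in s..r, f τ| ≤ ∫ τ in Icc t₀ t₁, f τ := fun hf0 hf r hr => by
    rw [intervalIntegral.abs_integral_eq_abs_integral_uIoc, abs_of_nonneg (integral_nonneg hf0)]
    exact setIntegral_mono_set hf (Eventually.of_forall hf0) ((hoc hr).trans hst).eventuallyLE
  -- the coefficient is the Lipschitz constant of the mollified field on balls inside `Ω`
  have key := gronwall_integral (u := fun r => ‖γ₁ r - γ₂ r‖) (k := k)
    (a := ‖γ₁ s - γ₂ s‖ + e * totalModulus n t₀ t₁ a F) (s := s) (t := t)
    (hc₁.sub hc₂).norm (hii hkI right_mem_uIcc) (Eventually.of_forall fun τ _ => hk0 τ)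
    (fun _ _ => norm_nonneg _) ?_
  · refine key.trans (mul_le_mul_of_nonneg_left ?_
      (add_nonneg (norm_nonneg _) (mul_nonneg he h.totalModulus_nonneg)))
    rw [Real.rpow_def_of_pos hη, amplification, ← Real.exp_add]
    refine Real.exp_le_exp.2 ?_
    have hFi : IntegrableOn (fun τ => a⁻¹ * (mollBound n * F τ)) (Icc t₀ t₁) :=
      (h.integrableOn.const_mul _).const_mul _
    have e1 : ∫ τ in s..t, k τ = (∫ τ in s..t, a⁻¹ * (mollBound n * F τ)) +
        (t - s) * (a⁻¹ * (n * Real.log η⁻¹)) := by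
      simp only [k, mul_add]
      rw [intervalIntegral.integral_add (hii hFi right_mem_uIcc) intervalIntegrable_const,
        intervalIntegral.integral_const, smul_eq_mul]
    rw [e1]
    refine (abs_add_le _ _).trans (add_le_add (habs (fun τ => ?_) hFi right_mem_uIcc) ?_)
    · have := h.nonneg τ; have := mollBound_nonneg (n := n); positivity
    · have h1 : |t - s| ≤ t₁ - t₀ := by
        have hs := hst left_mem_uIcc
        have ht := hst right_mem_uIcc
        rw [abs_le]; constructor <;> linarith [hs.1, hs.2, ht.1, ht.2]
      have h2 : 0 ≤ a⁻¹ * (n * Real.log η⁻¹) := by positivity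
      -- this is where the size of the exponent `a` turns the logarithm into a factor `η ^ (-1/4)`
      have h4 : a⁻¹ * (n * (t₁ - t₀)) ≤ 1 / 4 := by
        rw [← div_eq_inv_mul, div_le_iff₀ ha]; linarith [h.le]
      rw [abs_mul, abs_of_nonneg h2]
      calc |t - s| * (a⁻¹ * (n * Real.log η⁻¹)) ≤ (t₁ - t₀) * (a⁻¹ * (n * Real.log η⁻¹)) := by
            gcongr
        _ = a⁻¹ * (n * (t₁ - t₀)) * Real.log η⁻¹ := by ring
        _ ≤ 1 / 4 * Real.log η⁻¹ := by gcongr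
        _ = Real.log η * -(1 / 4) := by rw [Real.log_inv]; ring
  · intro r hr
    have hmono : uIcc s r ⊆ uIcc s t := uIcc_subset_uIcc left_mem_uIcc hr
    have e1 : γ₁ r - γ₂ r = (γ₁ s - γ₂ s) + ∫ τ in s..r, (f₁ τ - f₂ τ) := by
      rw [intervalIntegral.integral_sub (hf₁.mono_set hmono) (hf₂.mono_set hmono), hγ₁ r hr, hγ₂ r hr]
      abel
    have hcu : ContinuousOn (fun τ => ‖γ₁ τ - γ₂ τ‖) (uIcc s r) := ((hc₁.sub hc₂).norm).mono hmono
    have hki := (hii hkI hr).mul_continuousOn hcu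
    have hmi := (hii (h.integrableOn_modulus.const_mul e) hr)
    have h2 : ‖∫ τ in s..r, (f₁ τ - f₂ τ)‖ ≤
        |∫ τ in s..r, (e * ExpSobolev.modulus n a (F τ) + k τ * ‖γ₁ τ - γ₂ τ‖)| := by
      refine intervalIntegral.norm_integral_le_abs_of_norm_le ?_ (hmi.add hki)
      rw [ae_restrict_iff' measurableSet_uIoc]
      filter_upwards [herr, h.ae] with τ h3 h4 hτ
      have hτ' : τ ∈ uIoc s t := by
        have := hoc hr hτ
        rcases le_total s t with hc | hc
        · rw [uIoc_of_le hc]; rw [uIcc_of_le hc] at hr this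
          rw [uIoc_of_le hr.1] at hτ
          exact ⟨hτ.1, this.2⟩
        · rw [uIoc_of_ge hc]; rw [uIcc_of_ge hc] at hr this
          rw [uIoc_of_ge hr.2] at hτ
          exact ⟨hr.1.trans_lt hτ.1, hτ.2⟩
      have hτI := uIoc_subset_uIcc hτ'
      have h5 := h3 hτ'
      have h6 := (h4 (hst hτI)).lipschitz_moll hη (convex_closedBall (m τ) r₀) (fun z hz => by
        refine Subset.trans (Metric.closedBall_subset_closedBall' ?_) (hmΩ τ hτI)
        rw [add_comm η]
        exact add_le_add (Metric.mem_closedBall.1 hz) le_rfl) (hm₁ τ hτI) (hm₂ τ hτI)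
      calc ‖f₁ τ - f₂ τ‖ = ‖(f₁ τ - mollField β η τ (γ₁ τ)) - (f₂ τ - mollField β η τ (γ₂ τ)) +
            (moll η (β τ) (γ₁ τ) - moll η (β τ) (γ₂ τ))‖ := by congr 1; simp only [mollField]; abel
        _ ≤ _ := (norm_add_le _ _).trans (add_le_add ((norm_sub_le _ _).trans h5) h6)
    rw [intervalIntegral.integral_add hmi hki, intervalIntegral.integral_const_mul] at h2
    calc ‖γ₁ r - γ₂ r‖ = ‖(γ₁ s - γ₂ s) + ∫ τ in s..r, (f₁ τ - f₂ τ)‖ := by rw [e1]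
      _ ≤ ‖γ₁ s - γ₂ s‖ + (e * totalModulus n t₀ t₁ a F +
          |∫ τ in s..r, k τ * ‖γ₁ τ - γ₂ τ‖|) := by
        refine (norm_add_le _ _).trans (add_le_add le_rfl (h2.trans ((abs_add_le _ _).trans
          (add_le_add ?_ le_rfl))))
        rw [abs_mul, abs_of_nonneg he]
        exact mul_le_mul_of_nonneg_left (habs h.modulus_nonneg h.integrableOn_modulus hr) he
      _ = _ := by ring

end ExpSobolevField

end Stability

/-! ### Solutions as limits of mollified trajectories -/

section Solutions

local notation "𝔼" n => EuclideanSpace ℝ (Fin n)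

variable {n : ℕ}

theorem lipschitzOnWith_integral {f : ℝ → 𝔼 n} {M a b : ℝ} (hM : 0 ≤ M) (s : ℝ)
    (hs : s ∈ Icc a b) (hf : IntegrableOn f (Icc a b))
    (hb : ∀ᵐ τ, τ ∈ Icc a b → ‖f τ‖ ≤ M) :
    LipschitzOnWith M.toNNReal (fun r => ∫ τ in s..r, f τ) (Icc a b) := by
  have hi : ∀ {x y}, x ∈ Icc a b → y ∈ Icc a b → IntervalIntegrable f volume x y := fun hx hy =>
    intervalIntegrable_iff.2 (hf.mono_set (uIoc_subset_uIcc.trans (uIcc_subset_Icc hx hy)))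
  refine LipschitzOnWith.of_dist_le_mul fun x hx y hy => ?_
  rw [dist_eq_norm, intervalIntegral.integral_interval_sub_left (hi hs hx) (hi hs hy),
    Real.coe_toNNReal _ hM, Real.dist_eq]
  refine intervalIntegral.norm_integral_le_of_norm_le_const_ae ?_
  filter_upwards [hb] with τ h1 h2
  exact h1 (uIcc_subset_Icc hy hx (uIoc_subset_uIcc h2))

theorem LipschitzOnWith.absolutelyContinuousOnInterval_of_mem {X : Type*} [PseudoMetricSpace X]
    {f : ℝ → X} {K : NNReal} {a b : ℝ} (hf : LipschitzOnWith K f (Icc a b)) {c d : ℝ}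
    (hc : c ∈ Icc a b) (hd : d ∈ Icc a b) : AbsolutelyContinuousOnInterval f c d :=
  (hf.mono (uIcc_subset_Icc hc hd)).absolutelyContinuousOnInterval

/-- An absolutely continuous solution of an equation with bounded right-hand side satisfies the
integral equation. -/
theorem IsACSolutionOn.integral_eq {b : ℝ → (𝔼 n) → 𝔼 n} {Ω : Set (𝔼 n)} {J : Set ℝ}
    {γ : ℝ → 𝔼 n} (hγ : IsACSolutionOn b Ω J γ) {M : ℝ}
    (hb : ∀ᵐ τ, τ ∈ J → ∀ x ∈ Ω, ‖b τ x‖ ≤ M) {s t : ℝ} (hst : uIcc s t ⊆ J) :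
    IntervalIntegrable (fun τ => b τ (γ τ)) volume s t ∧
      γ t = γ s + ∫ τ in s..t, b τ (γ τ) := by
  have hs : s ∈ J := hst left_mem_uIcc
  have ht : t ∈ J := hst right_mem_uIcc
  have hder : ∀ᵐ τ, τ ∈ uIcc s t → HasDerivAt γ (b τ (γ τ)) τ :=
    (ae_restrict_iff' measurableSet_uIcc).1 (ae_restrict_of_ae_restrict_of_subset hst hγ.deriv)
  have hbd : ∀ᵐ τ, τ ∈ uIcc s t → ‖b τ (γ τ)‖ ≤ |M| := by
    filter_upwards [hb] with τ h1 h2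
    exact (h1 (hst h2) _ (hγ.mapsTo (hst h2))).trans (le_abs_self M)
  have hint : IntegrableOn (fun τ => b τ (γ τ)) (uIcc s t) := by
    have hm : AEStronglyMeasurable (fun τ => b τ (γ τ)) (volume.restrict (uIcc s t)) := by
      refine (measurable_deriv γ).stronglyMeasurable.aestronglyMeasurable.congr ?_
      rw [EventuallyEq, ae_restrict_iff' measurableSet_uIcc]
      filter_upwards [hder] with τ h1 h2 using (h1 h2).deriv
    have : IsFiniteMeasure (volume.restrict (uIcc s t)) := by rw [uIcc]; infer_instance
    exact Integrable.of_bound hm |M| ((ae_restrict_iff' measurableSet_uIcc).2 hbd)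
  have hii : IntervalIntegrable (fun τ => b τ (γ τ)) volume s t :=
    intervalIntegrable_iff.2 (hint.mono_set uIoc_subset_uIcc)
  refine ⟨hii, ?_⟩
  have hlip := lipschitzOnWith_integral (abs_nonneg M) s (left_mem_uIcc (a := s) (b := t)) hint hbd
  have hAC : AbsolutelyContinuousOnInterval (fun r => γ r - ∫ τ in s..r, b τ (γ τ)) s t :=
    (hγ.absCont s hs t ht).sub hlip.absolutelyContinuousOnInterval
  obtain ⟨C, hC⟩ := hAC.const_of_ae_hasDerivAt_zero (by
    filter_upwards [hder, hii.ae_hasDerivAt_integral] with τ h1 h2 h3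
    have h4 := (h1 h3).sub (h2 h3 s left_mem_uIcc)
    rw [sub_self] at h4
    exact h4)
  have e1 := hC s left_mem_uIcc
  have e2 := hC t right_mem_uIcc
  simp only [intervalIntegral.integral_same, sub_zero] at e1
  rw [e1, ← e2]; abel

/-- A solution of the integral equation is an absolutely continuous solution. -/
theorem isACSolutionOn_of_integral_eq {b : ℝ → (𝔼 n) → 𝔼 n} {Ω : Set (𝔼 n)} {a₀ b₀ M s : ℝ}
    {γ : ℝ → 𝔼 n} (hM : 0 ≤ M) (hs : s ∈ Icc a₀ b₀) (hΩ : ∀ r ∈ Icc a₀ b₀, γ r ∈ Ω)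
    (hi : IntegrableOn (fun τ => b τ (γ τ)) (Icc a₀ b₀))
    (hb : ∀ᵐ τ, τ ∈ Icc a₀ b₀ → ‖b τ (γ τ)‖ ≤ M)
    (heq : ∀ r ∈ Icc a₀ b₀, γ r = γ s + ∫ τ in s..r, b τ (γ τ)) {J : Set ℝ}
    (hJ : J ⊆ Icc a₀ b₀) : IsACSolutionOn b Ω J γ := by
  have hlip : LipschitzOnWith M.toNNReal γ (Icc a₀ b₀) := by
    have := lipschitzOnWith_integral hM s hs hi hb
    refine LipschitzOnWith.of_dist_le_mul fun x hx y hy => ?_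
    rw [heq x hx, heq y hy, dist_add_left]
    exact this.dist_le_mul x hx y hy
  refine ⟨fun r hr => hΩ r (hJ hr), fun c hc d hd =>
    hlip.absolutelyContinuousOnInterval_of_mem (hJ hc) (hJ hd), ?_⟩
  have hab : a₀ ≤ b₀ := hs.1.trans hs.2
  have hii : IntervalIntegrable (fun τ => b τ (γ τ)) volume a₀ b₀ := by
    rw [intervalIntegrable_iff, uIoc_of_le hab]; exact hi.mono_set Ioc_subset_Icc_self
  refine ae_restrict_of_ae_restrict_of_subset hJ ?_
  rw [← restrict_Ioo_eq_restrict_Icc, ae_restrict_iff' measurableSet_Ioo]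
  filter_upwards [hii.ae_hasDerivAt_integral] with τ h1 h2
  rw [uIcc_of_le hab] at h1
  refine ((h1 (Ioo_subset_Icc_self h2) s hs).const_add (γ s)).congr_of_eventuallyEq ?_
  filter_upwards [Icc_mem_nhds h2.1 h2.2] with r hr using heq r hr

namespace ExpSobolevField

variable {t₀ t₁ : ℝ} {Ω : Set (𝔼 n)} {β : ℝ → (𝔼 n) → 𝔼 n}
    {B : ℝ → (𝔼 n) → (𝔼 n) →L[ℝ] 𝔼 n} {M R a : ℝ} {F : ℝ → ℝ} {b : ℝ → (𝔼 n) → 𝔼 n}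

/-- At almost every time, `b` is the continuous representative of `β` on `Ω`. -/
def IsRep (t₀ t₁ : ℝ) (Ω : Set (𝔼 n)) (β b : ℝ → (𝔼 n) → 𝔼 n) : Prop :=
  ∀ᵐ t, t ∈ Icc t₀ t₁ → ContinuousOn (b t) Ω ∧ ∀ᵐ y ∂(volume.restrict Ω), b t y = β t y

theorem ae_norm_le (h : ExpSobolevField t₀ t₁ Ω β B M R a F) (hb : IsRep t₀ t₁ Ω β b) :
    ∀ᵐ τ, τ ∈ Icc t₀ t₁ → ∀ x ∈ Ω, ‖b τ x‖ ≤ M := by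
  filter_upwards [h.ae, hb] with τ h1 h2 h3 x hx
  exact (h1 h3).norm_le_of_continuousOn (h2 h3).1 (h2 h3).2 hx

/-- The null set of exceptional times does not depend on the point. -/
theorem ae_norm_sub_mollField_le (h : ExpSobolevField t₀ t₁ Ω β B M R a F)
    (hb : IsRep t₀ t₁ Ω β b) {η : ℝ} (hη : 0 < η) (hη1 : η ≤ 1) :
    ∀ᵐ τ, τ ∈ Icc t₀ t₁ → ∀ x, Metric.closedBall x (2 * η) ⊆ Ω →
      ‖b τ x - mollField β η τ x‖ ≤ √η * ExpSobolev.modulus n a (F τ) := by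
  filter_upwards [h.ae, hb] with τ h1 h2 h3 x hx
  exact (h1 h3).norm_sub_moll_le (h2 h3).1 (h2 h3).2 hη hη1 hx

theorem sqrt_mul_rpow {η : ℝ} (hη : 0 < η) : √η * η ^ (-(1 / 4) : ℝ) = η ^ (1 / 4 : ℝ) := by
  rw [Real.sqrt_eq_rpow, ← Real.rpow_add hη]; norm_num

theorem tendsto_rpow_quarter (C : ℝ) :
    Tendsto (fun η : ℝ => C * η ^ (1 / 4 : ℝ)) (𝓝[>] 0) (𝓝 0) := by
  have : Continuous fun η : ℝ => C * η ^ (1 / 4 : ℝ) :=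
    continuous_const.mul (Real.continuous_rpow_const (by norm_num))
  have h1 := this.tendsto 0
  rw [Real.zero_rpow (by norm_num), mul_zero] at h1
  exact h1.mono_left nhdsWithin_le_nhds

/-- The constant in the rate of convergence of the trajectories of mollified fields. -/
noncomputable def rate (n : ℕ) (t₀ t₁ a : ℝ) (F : ℝ → ℝ) : ℝ :=
  2 * totalModulus n t₀ t₁ a F * amplification n t₀ t₁ a F

/-- Trajectories of the fields mollified at scales `κ' ≤ κ` differ by `O(κ ^ (1/4))`, as long as
they stay in a common tube inside `Ω`. -/
theorem norm_lipFlow_sub_lipFlow_le (h : ExpSobolevField t₀ t₁ Ω β B M R a F) {κ κ' : ℝ}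
    (hκ : 0 < κ) (hκ1 : κ ≤ 1) (hκ' : 0 < κ') (hκκ' : κ' ≤ κ) {s t : ℝ} {x : 𝔼 n}
    (hst : uIcc s t ⊆ Icc t₀ t₁) {m : ℝ → 𝔼 n} {r₀ : ℝ} (hκr : 2 * κ ≤ r₀)
    (hm : ∀ r ∈ uIcc s t, lipFlow (mollField β κ) r s x ∈ Metric.closedBall (m r) r₀)
    (hm' : ∀ r ∈ uIcc s t, lipFlow (mollField β κ') r s x ∈ Metric.closedBall (m r) r₀)
    (hmΩ : ∀ r ∈ uIcc s t, Metric.closedBall (m r) (2 * r₀) ⊆ Ω) :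
    ‖lipFlow (mollField β κ) t s x - lipFlow (mollField β κ') t s x‖ ≤
      rate n t₀ t₁ a F * κ ^ (1 / 4 : ℝ) := by
  obtain ⟨L, K, hc, -⟩ := h.exists_isLipField hκ
  obtain ⟨L', K', hc', -⟩ := h.exists_isLipField hκ'
  have h1 := hc.isCaraCurve_lipFlow s x
  have h2 := hc'.isCaraCurve_lipFlow s x
  have key := h.norm_curve_sub_le hκ hκ1 hst (e := 2 * √κ) (by positivity)
    h1.1.continuousOn h2.1.continuousOn (hc.intervalIntegrable h1.1.measurable s t)
    (hc'.intervalIntegrable h2.1.measurable s t)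
    (fun r _ => by rw [h1.apply_self]; exact h1.2 r)
    (fun r _ => by rw [h2.apply_self]; exact h2.2 r) hm hm'
    (fun r hr => (Metric.closedBall_subset_closedBall (by linarith)).trans (hmΩ r hr)) ?_
  · refine key.trans (le_of_eq ?_)
    simp only [hc.lipFlow_self, hc'.lipFlow_self, sub_self, norm_zero, zero_add]
    rw [← sqrt_mul_rpow hκ, rate]; ring
  · filter_upwards [h.ae] with τ h3 h4
    rw [sub_self, norm_zero, zero_add]
    have hτ := uIoc_subset_uIcc h4
    refine ((h3 (hst hτ)).norm_moll_sub_moll_le hκ hκ1 hκ' (hκκ'.trans hκ1) (Subset.trans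
      (Metric.closedBall_subset_closedBall' ?_) (hmΩ τ hτ))).trans ?_
    · have := Metric.mem_closedBall.1 (hm' τ hτ)
      linarith
    · have h5 := h.modulus_nonneg τ
      rw [two_mul]
      gcongr

/-- Trajectories of the mollified fields which remain in a tube inside `Ω` converge to a solution. -/
theorem exists_solution (h : ExpSobolevField t₀ t₁ Ω β B M R a F) (hb : IsRep t₀ t₁ Ω β b)
    {a₀ b₀ s : ℝ} (hab : Icc a₀ b₀ ⊆ Icc t₀ t₁) (hs : s ∈ Icc a₀ b₀) {x : 𝔼 n} {m : ℝ → 𝔼 n}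
    {r₀ κ₀ : ℝ} (hr₀ : 0 < r₀) (hκ₀ : 0 < κ₀)
    (hm : ∀ κ, 0 < κ → κ ≤ κ₀ → ∀ r ∈ Icc a₀ b₀,
      lipFlow (mollField β κ) r s x ∈ Metric.closedBall (m r) r₀)
    (hmΩ : ∀ r ∈ Icc a₀ b₀, Metric.closedBall (m r) (2 * r₀) ⊆ Ω) :
    ∃ γ : ℝ → 𝔼 n, γ s = x ∧ (∀ J ⊆ Icc a₀ b₀, IsACSolutionOn b Ω J γ) ∧
      ∀ κ, 0 < κ → κ ≤ κ₀ → κ ≤ 1 → 2 * κ ≤ r₀ → ∀ r ∈ Icc a₀ b₀,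
        ‖lipFlow (mollField β κ) r s x - γ r‖ ≤ rate n t₀ t₁ a F * κ ^ (1 / 4 : ℝ) := by
  have hsub : ∀ {r}, r ∈ Icc a₀ b₀ → uIcc s r ⊆ Icc a₀ b₀ := fun hr => uIcc_subset_Icc hs hr
  have hcau : ∀ κ κ', 0 < κ → κ ≤ κ₀ → κ ≤ 1 → 2 * κ ≤ r₀ → 0 < κ' → κ' ≤ κ → ∀ r ∈ Icc a₀ b₀,
      ‖lipFlow (mollField β κ) r s x - lipFlow (mollField β κ') r s x‖ ≤
        rate n t₀ t₁ a F * κ ^ (1 / 4 : ℝ) := fun κ κ' k1 k2 k3 k4 k5 k6 r hr =>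
    h.norm_lipFlow_sub_lipFlow_le k1 k3 k5 k6 ((hsub hr).trans hab) k4
      (fun r' hr' => hm κ k1 k2 r' (hsub hr hr')) (fun r' hr' => hm κ' k5 (k6.trans k2) r' (hsub hr hr'))
      (fun r' hr' => hmΩ r' (hsub hr hr'))
  have hsmall : ∀ᶠ κ : ℝ in 𝓝[>] 0, 0 < κ ∧ κ ≤ κ₀ ∧ κ ≤ 1 ∧ 2 * κ ≤ r₀ := by
    filter_upwards [Ioo_mem_nhdsGT hκ₀, Ioo_mem_nhdsGT one_pos, Ioo_mem_nhdsGT (half_pos hr₀)]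
      with κ k1 k2 k3
    exact ⟨k1.1, k1.2.le, k2.2.le, by linarith [k3.2]⟩
  have hlim : ∀ r, r ∈ Icc a₀ b₀ →
      ∃ y, Tendsto (fun κ => lipFlow (mollField β κ) r s x) (𝓝[>] 0) (𝓝 y) := by
    intro r hr
    refine cauchy_iff_exists_le_nhds.1 ?_
    rw [Metric.cauchy_iff]
    refine ⟨inferInstance, fun ε hε => ?_⟩
    have hev := hsmall.and ((tendsto_rpow_quarter (rate n t₀ t₁ a F)).eventually_lt_const hε)
    refine ⟨_, image_mem_map hev, ?_⟩
    rintro _ ⟨κ, ⟨⟨k1, k2, k3, k4⟩, k5⟩, rfl⟩ _ ⟨κ', ⟨⟨l1, l2, l3, l4⟩, l5⟩, rfl⟩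
    rcases le_total κ' κ with hc | hc
    · rw [dist_eq_norm]
      exact (hcau κ κ' k1 k2 k3 k4 l1 hc r hr).trans_lt k5
    · rw [dist_comm, dist_eq_norm]
      exact (hcau κ' κ l1 l2 l3 l4 k1 hc r hr).trans_lt l5
  choose! γ hγ using hlim
  have hrate : ∀ κ, 0 < κ → κ ≤ κ₀ → κ ≤ 1 → 2 * κ ≤ r₀ → ∀ r ∈ Icc a₀ b₀,
        ‖lipFlow (mollField β κ) r s x - γ r‖ ≤ rate n t₀ t₁ a F * κ ^ (1 / 4 : ℝ) := by
    intro κ k1 k2 k3 k4 r hr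
    refine le_of_tendsto (tendsto_const_nhds.sub (hγ r hr)).norm ?_
    filter_upwards [Ioo_mem_nhdsGT k1] with κ' hκ'
    exact hcau κ κ' k1 k2 k3 k4 hκ'.1 hκ'.2.le r hr
  have hγs : γ s = x := by
    refine tendsto_nhds_unique (hγ s hs) (tendsto_const_nhds.congr' ?_)
    filter_upwards [self_mem_nhdsWithin] with κ hκ
    obtain ⟨L, K, hc, -⟩ := h.exists_isLipField hκ
    exact (hc.lipFlow_self s x).symm
  have hγm : ∀ r ∈ Icc a₀ b₀, γ r ∈ Metric.closedBall (m r) r₀ := fun r hr => by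
    refine Metric.isClosed_closedBall.mem_of_tendsto (hγ r hr) ?_
    filter_upwards [hsmall] with κ hκ using hm κ hκ.1 hκ.2.1 r hr
  have hγΩ : ∀ r ∈ Icc a₀ b₀, γ r ∈ Ω := fun r hr =>
    hmΩ r hr (Metric.closedBall_subset_closedBall (by linarith) (hγm r hr))
  have hbd : ∀ᵐ τ, τ ∈ Icc a₀ b₀ → ‖b τ (γ τ)‖ ≤ M := by
    filter_upwards [h.ae_norm_le hb] with τ h1 h2 using h1 (hab h2) _ (hγΩ τ h2)
  -- pointwise convergence of the velocities, at almost every time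
  have hvel : ∀ᵐ τ, τ ∈ Icc a₀ b₀ → Tendsto
      (fun κ => mollField β κ τ (lipFlow (mollField β κ) τ s x)) (𝓝[>] 0) (𝓝 (b τ (γ τ))) := by
    filter_upwards [h.ae, hb] with τ h1 h2 hτ
    have h1' := h1 (hab hτ)
    have h2' := h2 (hab hτ)
    have hct := ((h2'.1.continuousAt (h.isOpen.mem_nhds (hγΩ τ hτ))).tendsto).comp (hγ τ hτ)
    have hz : Tendsto (fun κ => ‖b τ (lipFlow (mollField β κ) τ s x) -
        mollField β κ τ (lipFlow (mollField β κ) τ s x)‖) (𝓝[>] 0) (𝓝 0) := by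
      have hlim0 : Tendsto (fun κ : ℝ => √κ * ExpSobolev.modulus n a (F τ)) (𝓝[>] 0) (𝓝 0) := by
        have : Continuous fun κ : ℝ => √κ * ExpSobolev.modulus n a (F τ) := by fun_prop
        simpa using (this.tendsto 0).mono_left nhdsWithin_le_nhds
      refine squeeze_zero' (Eventually.of_forall fun _ => norm_nonneg _) ?_ hlim0
      filter_upwards [hsmall] with κ hκ
      refine h1'.norm_sub_moll_le h2'.1 h2'.2 hκ.1 hκ.2.2.1 (Subset.trans
        (Metric.closedBall_subset_closedBall' ?_) (hmΩ τ hτ))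
      have := Metric.mem_closedBall.1 (hm κ hκ.1 hκ.2.1 τ hτ)
      linarith [hκ.2.2.2]
    have := hct.sub (tendsto_zero_iff_norm_tendsto_zero.2 hz)
    rw [sub_zero] at this
    refine this.congr fun κ => ?_
    simp
  have hgen : ∀ {κ : ℝ}, 0 < κ → Measurable fun τ => mollField β κ τ (lipFlow (mollField β κ) τ s x) :=
    fun {κ} hκ => by
      obtain ⟨L, K, hc, -⟩ := h.exists_isLipField hκ
      exact hc.meas.comp (measurable_id.prodMk (hc.isCaraCurve_lipFlow s x).1.measurable)
  have hint : IntegrableOn (fun τ => b τ (γ τ)) (Icc a₀ b₀) := by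
    have hm : AEStronglyMeasurable (fun τ => b τ (γ τ)) (volume.restrict (Icc a₀ b₀)) := by
      have hseq : Tendsto (fun k : ℕ => (1 : ℝ) / (k + 1)) atTop (𝓝[>] 0) :=
        tendsto_nhdsWithin_iff.2 ⟨tendsto_one_div_add_atTop_nhds_zero_nat,
          Eventually.of_forall fun k => by rw [mem_Ioi]; positivity⟩
      refine aestronglyMeasurable_of_tendsto_ae atTop (f := fun (k : ℕ) τ =>
        mollField β (1 / (k + 1)) τ (lipFlow (mollField β (1 / (k + 1))) τ s x))
        (fun k => (hgen (by positivity)).aestronglyMeasurable) ?_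
      rw [ae_restrict_iff' measurableSet_Icc]
      filter_upwards [hvel] with τ h1 h2 using (h1 h2).comp hseq
    exact Integrable.of_bound hm M ((ae_restrict_iff' measurableSet_Icc).2 hbd)
  have heq : ∀ r ∈ Icc a₀ b₀, γ r = γ s + ∫ τ in s..r, b τ (γ τ) := by
    intro r hr
    have h1 : Tendsto (fun κ => x + ∫ τ in s..r, mollField β κ τ (lipFlow (mollField β κ) τ s x))
        (𝓝[>] 0) (𝓝 (x + ∫ τ in s..r, b τ (γ τ))) := by
      refine Tendsto.const_add x ?_
      refine intervalIntegral.tendsto_integral_filter_of_dominated_convergence (fun _ => M) ?_ ?_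
        intervalIntegrable_const ?_
      · filter_upwards [self_mem_nhdsWithin] with κ hκ using (hgen hκ).aestronglyMeasurable
      · exact Eventually.of_forall fun κ => Eventually.of_forall fun τ _ => norm_moll_le (h.bound τ) _ _
      · filter_upwards [hvel] with τ h1 h2
        exact h1 (hsub hr (uIoc_subset_uIcc h2))
    rw [hγs]
    refine tendsto_nhds_unique (hγ r hr) (h1.congr' ?_)
    filter_upwards [self_mem_nhdsWithin] with κ hκ
    obtain ⟨L, K, hc, -⟩ := h.exists_isLipField hκ
    exact ((hc.isCaraCurve_lipFlow s x).2 r).symm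
  exact ⟨γ, hγs, fun J hJ => isACSolutionOn_of_integral_eq h.bound_nonneg hs hγΩ hint hbd heq hJ,
    hrate⟩

end ExpSobolevField

end Solutions

/-! ### Well-posedness and local convergence of the flow -/

section WellPosedness

local notation "𝔼" n => EuclideanSpace ℝ (Fin n)

variable {n : ℕ}

namespace ExpSobolevField

variable {t₀ t₁ : ℝ} {Ω : Set (𝔼 n)} {β : ℝ → (𝔼 n) → 𝔼 n}
    {B : ℝ → (𝔼 n) → (𝔼 n) →L[ℝ] 𝔼 n} {M R a : ℝ} {F : ℝ → ℝ} {b : ℝ → (𝔼 n) → 𝔼 n}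

theorem ordConnected_Icc_inter_Ioo {t₀ t₁ c d : ℝ} : (Icc t₀ t₁ ∩ Ioo c d).OrdConnected :=
  ordConnected_Icc.inter ordConnected_Ioo

/-- Solutions have speed at most `M`. -/
theorem norm_sub_le_of_isACSolutionOn (h : ExpSobolevField t₀ t₁ Ω β B M R a F)
    (hb : IsRep t₀ t₁ Ω β b) {J : Set ℝ} (hJ : J ⊆ Icc t₀ t₁) {γ : ℝ → 𝔼 n}
    (hγ : IsACSolutionOn b Ω J γ) {s t : ℝ} (hst : uIcc s t ⊆ J) :
    ‖γ t - γ s‖ ≤ M * |t - s| := by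
  have hbJ : ∀ᵐ τ, τ ∈ J → ∀ x ∈ Ω, ‖b τ x‖ ≤ M := by
    filter_upwards [h.ae_norm_le hb] with τ h1 h2 using h1 (hJ h2)
  rw [(hγ.integral_eq hbJ hst).2, add_sub_cancel_left]
  refine intervalIntegral.norm_integral_le_of_norm_le_const_ae ?_
  filter_upwards [hbJ] with τ h1 h2
  have := hst (uIoc_subset_uIcc h2)
  exact h1 this _ (hγ.mapsTo this)

/-- Two solutions which start at the same point and stay in a common ball inside `Ω` coincide. -/
theorem eq_of_isACSolutionOn (h : ExpSobolevField t₀ t₁ Ω β B M R a F)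
    (hb : IsRep t₀ t₁ Ω β b) {J : Set ℝ} (hJ : J ⊆ Icc t₀ t₁) {γ₁ γ₂ : ℝ → 𝔼 n}
    (hγ₁ : IsACSolutionOn b Ω J γ₁) (hγ₂ : IsACSolutionOn b Ω J γ₂) {s t : ℝ}
    (hst : uIcc s t ⊆ J) (heq : γ₁ s = γ₂ s) {x : 𝔼 n} {r₀ : ℝ} (hr₀ : 0 < r₀)
    (hx : Metric.closedBall x (2 * r₀) ⊆ Ω)
    (h₁ : ∀ r ∈ uIcc s t, γ₁ r ∈ Metric.closedBall x r₀)
    (h₂ : ∀ r ∈ uIcc s t, γ₂ r ∈ Metric.closedBall x r₀) : γ₁ t = γ₂ t := by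
  have hbJ : ∀ᵐ τ, τ ∈ J → ∀ x ∈ Ω, ‖b τ x‖ ≤ M := by
    filter_upwards [h.ae_norm_le hb] with τ h1 h2 using h1 (hJ h2)
  have hsub : ∀ {r}, r ∈ uIcc s t → uIcc s r ⊆ J := fun hr =>
    (uIcc_subset_uIcc left_mem_uIcc hr).trans hst
  have key : ∀ᶠ η : ℝ in 𝓝[>] 0, ‖γ₁ t - γ₂ t‖ ≤ rate n t₀ t₁ a F * η ^ (1 / 4 : ℝ) := by
    filter_upwards [Ioo_mem_nhdsGT one_pos, Ioo_mem_nhdsGT (half_pos hr₀)] with η h1 h2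
    have hη := h1.1
    have := h.norm_curve_sub_le hη h1.2.le (hst.trans hJ) (γ₁ := γ₁) (γ₂ := γ₂)
      (f₁ := fun τ => b τ (γ₁ τ)) (f₂ := fun τ => b τ (γ₂ τ)) (m := fun _ => x) (r₀ := r₀)
      (e := 2 * √η) (by positivity)
      (hγ₁.absCont s (hst left_mem_uIcc) t (hst right_mem_uIcc)).continuousOn
      (hγ₂.absCont s (hst left_mem_uIcc) t (hst right_mem_uIcc)).continuousOn
      (hγ₁.integral_eq hbJ hst).1 (hγ₂.integral_eq hbJ hst).1
      (fun r hr => (hγ₁.integral_eq hbJ (hsub hr)).2)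
      (fun r hr => (hγ₂.integral_eq hbJ (hsub hr)).2) h₁ h₂
      (fun r _ => (Metric.closedBall_subset_closedBall (by linarith [h2.2])).trans hx) ?_
    · refine this.trans (le_of_eq ?_)
      rw [heq, sub_self, norm_zero, zero_add, ← sqrt_mul_rpow hη, rate]; ring
    · filter_upwards [h.ae_norm_sub_mollField_le hb hη h1.2.le] with τ h3 h4
      have hτ := uIoc_subset_uIcc h4
      have hball : ∀ y ∈ Metric.closedBall x r₀, Metric.closedBall y (2 * η) ⊆ Ω := fun y hy =>
        Subset.trans (Metric.closedBall_subset_closedBall' (by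
          have := Metric.mem_closedBall.1 hy
          linarith [h2.2])) hx
      have h5 := h3 (hJ (hst hτ)) _ (hball _ (h₁ τ hτ))
      have h6 := h3 (hJ (hst hτ)) _ (hball _ (h₂ τ hτ))
      calc _ ≤ _ := add_le_add h5 h6
        _ = _ := by ring
  have h0 := le_of_tendsto_of_tendsto tendsto_const_nhds (tendsto_rpow_quarter (rate n t₀ t₁ a F)) key
  exact sub_eq_zero.1 (norm_le_zero_iff.1 h0)

theorem norm_lipFlow_sub_self_le (h : ExpSobolevField t₀ t₁ Ω β B M R a F) {κ : ℝ} (hκ : 0 < κ)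
    (r s : ℝ) (x : 𝔼 n) : ‖lipFlow (mollField β κ) r s x - x‖ ≤ M * |r - s| := by
  obtain ⟨L, K, hc, -⟩ := h.exists_isLipField hκ
  have := hc.norm_lipFlow_time_sub_le r s s x
  rwa [hc.lipFlow_self] at this

/-- Existence and uniqueness for a time so short that trajectories of speed at most `M` stay in a
ball inside `Ω`. -/
theorem wellPosed (h : ExpSobolevField t₀ t₁ Ω β B M R a F) (hb : IsRep t₀ t₁ Ω β b) :
    WellPosed b (Icc t₀ t₁) Ω := by
  intro s hs x hx
  obtain ⟨r, hr, hrΩ⟩ := Metric.isOpen_iff.1 h.isOpen x hx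
  set r₀ := r / 3
  have hr₀ : 0 < r₀ := by positivity
  have hxΩ : Metric.closedBall x (2 * r₀) ⊆ Ω :=
    (Metric.closedBall_subset_ball (by simp only [r₀]; linarith)).trans hrΩ
  have hM := h.bound_nonneg
  refine ⟨r₀ / (M + 1), by positivity, fun δ hδ hδε => ?_⟩
  have hMδ : M * δ ≤ r₀ := by
    rw [le_div_iff₀ (by positivity)] at hδε
    nlinarith
  set J := Icc t₀ t₁ ∩ Ioo (s - δ) (s + δ)
  have hsJ : s ∈ J := ⟨hs, by constructor <;> linarith⟩
  have hJs : ∀ {t}, t ∈ J → uIcc s t ⊆ J := fun ht =>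
    ordConnected_Icc_inter_Ioo.uIcc_subset hsJ ht
  have hball : ∀ {t} {y : 𝔼 n}, t ∈ Icc (s - δ) (s + δ) → ‖y - x‖ ≤ M * |t - s| →
      y ∈ Metric.closedBall x r₀ := fun {t y} ht hy => by
    rw [mem_closedBall_iff_norm]
    refine hy.trans (le_trans ?_ hMδ)
    refine mul_le_mul_of_nonneg_left ?_ hM
    rw [abs_le]; constructor <;> linarith [ht.1, ht.2]
  constructor
  · obtain ⟨γ, hγs, hγ, -⟩ := h.exists_solution hb (a₀ := max t₀ (s - δ)) (b₀ := min t₁ (s + δ))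
      (s := s) (x := x) (m := fun _ => x) (r₀ := r₀) (κ₀ := 1)
      (Icc_subset_Icc (le_max_left _ _) (min_le_left _ _))
      ⟨max_le hs.1 (by linarith), le_min hs.2 (by linarith)⟩ hr₀ one_pos
      (fun κ hκ _ r hr => hball ⟨(le_max_right _ _).trans hr.1, hr.2.trans (min_le_right _ _)⟩
        (h.norm_lipFlow_sub_self_le hκ r s x)) (fun _ _ => hxΩ)
    refine ⟨γ, hγ J fun r hr => ⟨max_le hr.1.1 hr.2.1.le, le_min hr.1.2 hr.2.2.le⟩, hγs⟩
  · intro γ₁ γ₂ h₁ hs₁ h₂ hs₂ t ht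
    have hb' : ∀ {γ : ℝ → 𝔼 n}, IsACSolutionOn b Ω J γ → γ s = x → ∀ r ∈ uIcc s t,
        γ r ∈ Metric.closedBall x r₀ := fun {γ} hγ hγs r hr => by
      have hrJ := hJs ht hr
      refine hball (Ioo_subset_Icc_self hrJ.2) ?_
      have := h.norm_sub_le_of_isACSolutionOn hb inter_subset_left hγ (hJs hrJ)
      rwa [hγs] at this
    exact h.eq_of_isACSolutionOn hb inter_subset_left h₁ h₂ (hJs ht) (hs₁.trans hs₂.symm) hr₀ hxΩ
      (hb' h₁ hs₁) (hb' h₂ hs₂)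

theorem flow_eq_of_reaches {b : ℝ → (𝔼 n) → 𝔼 n} {I T : Set ℝ} (hb : WellPosed b T Ω)
    (hI : I ⊆ T) {t s : ℝ} {x y : 𝔼 n} (h : Reaches b I Ω t s x y) : flow b I Ω t s x = y := by
  have hex : ∃ y, Reaches b I Ω t s x y := ⟨y, h⟩
  have : flow b I Ω t s x = hex.choose := by simp [flow, hex]
  rw [this]
  exact Reaches.unique hb hI hex.choose_spec h

/-- Near a point of the flow domain, the flow is defined and is the uniform limit of the flows of
the mollified fields, the trajectories of which stay well inside `Ω`. -/
theorem exists_ball_flow (h : ExpSobolevField t₀ t₁ Ω β B M R a F) (hb : IsRep t₀ t₁ Ω β b)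
    {s t : ℝ} {x : 𝔼 n} (hx : x ∈ flowDomain b (Ioo t₀ t₁) Ω t s) :
    ∃ ρ > 0, ∃ κ₀ > 0, ∃ r₀ > 0, ∀ x' ∈ Metric.ball x ρ, x' ∈ flowDomain b (Ioo t₀ t₁) Ω t s ∧
      ∀ κ, 0 < κ → κ ≤ κ₀ →
        ‖lipFlow (mollField β κ) t s x' - flow b (Ioo t₀ t₁) Ω t s x'‖ ≤
          rate n t₀ t₁ a F * κ ^ (1 / 4 : ℝ) ∧
        ∀ r ∈ uIcc s t, Metric.closedBall (lipFlow (mollField β κ) r s x') r₀ ⊆ Ω := by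
  obtain ⟨y, J, hJo, hJc, hJI, hsJ, htJ, γ, hγ, hγs, hγt⟩ := hx
  have hJI' : J ⊆ Icc t₀ t₁ := hJI.trans Ioo_subset_Icc_self
  -- a slightly larger compact time interval
  obtain ⟨δ, hδ, hδJ⟩ : ∃ δ > 0, Icc (min s t - δ) (max s t + δ) ⊆ J := by
    have h1 : min s t ∈ J := by rcases min_choice s t with h | h <;> rw [h] <;> assumption
    have h2 : max s t ∈ J := by rcases max_choice s t with h | h <;> rw [h] <;> assumption
    obtain ⟨δ₁, hδ₁, hb₁⟩ := Metric.isOpen_iff.1 hJo _ h1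
    obtain ⟨δ₂, hδ₂, hb₂⟩ := Metric.isOpen_iff.1 hJo _ h2
    refine ⟨min δ₁ δ₂ / 2, by positivity, hJc.out (hb₁ ?_) (hb₂ ?_)⟩
    · rw [Metric.mem_ball, Real.dist_eq, sub_sub_cancel_left, abs_neg, abs_of_pos (by positivity)]
      linarith [min_le_left δ₁ δ₂, lt_min hδ₁ hδ₂]
    · rw [Metric.mem_ball, Real.dist_eq, add_sub_cancel_left, abs_of_pos (by positivity)]
      linarith [min_le_right δ₁ δ₂, lt_min hδ₁ hδ₂]
  set a₀ := min s t - δ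
  set b₀ := max s t + δ
  have hsI : s ∈ Ioo a₀ b₀ := ⟨by linarith [min_le_left s t], by linarith [le_max_left s t]⟩
  have htI : t ∈ Ioo a₀ b₀ := ⟨by linarith [min_le_right s t], by linarith [le_max_right s t]⟩
  have hsI' := Ioo_subset_Icc_self hsI
  have hab : a₀ ≤ b₀ := hsI'.1.trans hsI'.2
  have hγc : ContinuousOn γ (Icc a₀ b₀) := by
    have := (hγ.absCont a₀ (hδJ (left_mem_Icc.2 hab)) b₀ (hδJ (right_mem_Icc.2 hab))).continuousOn
    rwa [uIcc_of_le hab] at this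
  obtain ⟨r, hr, hrΩ⟩ := (isCompact_Icc.image_of_continuousOn hγc).exists_cthickening_subset_open
    h.isOpen (image_subset_iff.2 fun r hr => hγ.mapsTo (hδJ hr))
  set r₀ := min (r / 2) 1
  have hr₀ : 0 < r₀ := lt_min (by positivity) one_pos
  have hmΩ : ∀ r ∈ Icc a₀ b₀, Metric.closedBall (γ r) (2 * r₀) ⊆ Ω := fun r' hr' =>
    ((Metric.closedBall_subset_closedBall (by linarith [min_le_left (r / 2) 1])).trans
      (Metric.closedBall_subset_cthickening (mem_image_of_mem γ hr') r)).trans hrΩ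
  have hbJ : ∀ᵐ τ, τ ∈ J → ∀ x ∈ Ω, ‖b τ x‖ ≤ M := by
    filter_upwards [h.ae_norm_le hb] with τ h1 h2 using h1 (hJI' h2)
  have hsub : ∀ {r}, r ∈ Icc a₀ b₀ → uIcc s r ⊆ Icc a₀ b₀ := fun hr => uIcc_subset_Icc hsI' hr
  -- the comparison scale
  obtain ⟨η, ⟨hη, hη'⟩, hη3⟩ : ∃ η : ℝ, (0 < η ∧ η < r₀ / 2) ∧
      rate n t₀ t₁ a F * η ^ (1 / 4 : ℝ) < r₀ / 3 := by
    have h1 := (tendsto_rpow_quarter (rate n t₀ t₁ a F)).eventually_lt_const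
      (show 0 < r₀ / 3 by positivity)
    exact ((show ∀ᶠ η : ℝ in 𝓝[>] 0, 0 < η ∧ η < r₀ / 2 from
      Ioo_mem_nhdsGT (half_pos hr₀)).and h1).exists
  have hη1 : η ≤ 1 := by linarith [min_le_right (r / 2) 1]
  set D := amplification n t₀ t₁ a F * η ^ (-(1 / 4) : ℝ)
  have hD : 0 < D := mul_pos (Real.exp_pos _) (Real.rpow_pos_of_pos hη _)
  set A := totalModulus n t₀ t₁ a F
  have hA : 0 ≤ A := h.totalModulus_nonneg
  obtain ⟨κ₀, ⟨hκ₀, hκ₀'⟩, hκ3⟩ : ∃ κ : ℝ, (0 < κ ∧ κ < η) ∧ √κ * (A * D) < r₀ / 3 := by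
    have h1 : Tendsto (fun κ : ℝ => √κ * (A * D)) (𝓝[>] 0) (𝓝 0) := by
      have : Continuous fun κ : ℝ => √κ * (A * D) := by fun_prop
      simpa using (this.tendsto 0).mono_left nhdsWithin_le_nhds
    exact ((show ∀ᶠ κ : ℝ in 𝓝[>] 0, 0 < κ ∧ κ < η from Ioo_mem_nhdsGT hη).and
      (h1.eventually_lt_const (show 0 < r₀ / 3 by positivity))).exists
  have hρ : 0 < min (r₀ / (3 * D)) r₀ := lt_min (by positivity) hr₀
  refine ⟨min (r₀ / (3 * D)) r₀, hρ, κ₀, hκ₀, r₀, hr₀, fun x' hx' => ?_⟩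
  have hx'1 : ‖x' - x‖ * D < r₀ / 3 := by
    have := (mem_ball_iff_norm.1 hx').trans_le (min_le_left _ _)
    rw [lt_div_iff₀ (by positivity)] at this
    linarith
  have hx'2 : ‖x' - x‖ < r₀ := (mem_ball_iff_norm.1 hx').trans_le (min_le_right _ _)
  -- trajectories of the mollified fields stay in the tube
  have htube : ∀ κ, 0 < κ → κ ≤ κ₀ → ∀ r ∈ Icc a₀ b₀,
      ‖lipFlow (mollField β κ) r s x' - γ r‖ < r₀ := by
    intro κ hκ hκκ₀
    obtain ⟨L, K, hc, -⟩ := h.exists_isLipField hκ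
    have hX := hc.isCaraCurve_lipFlow s x'
    refine forall_lt_of_bootstrap ((hX.1.continuousOn.sub hγc).norm) hsI' ?_ ?_
    · rwa [hc.lipFlow_self, hγs]
    · intro r hr hprev
      have hsr := hsub hr
      have hsrJ := hsr.trans hδJ
      have key := h.norm_curve_sub_le hη hη1 (hsrJ.trans hJI')
        (γ₁ := fun r => lipFlow (mollField β κ) r s x') (γ₂ := γ)
        (f₁ := fun τ => mollField β κ τ (lipFlow (mollField β κ) τ s x'))
        (f₂ := fun τ => b τ (γ τ)) (m := γ) (r₀ := r₀)
        (e := 2 * √η + √κ) (by positivity) hX.1.continuousOn (hγc.mono hsr)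
        (hc.intervalIntegrable hX.1.measurable _ _) (hγ.integral_eq hbJ hsrJ).1
        (fun r' _ => by rw [hX.apply_self]; exact hX.2 r')
        (fun r' hr' => (hγ.integral_eq hbJ ((uIcc_subset_uIcc left_mem_uIcc hr').trans hsrJ)).2)
        (fun r' hr' => by rw [mem_closedBall_iff_norm]; exact hprev r' hr')
        (fun r' _ => Metric.mem_closedBall_self hr₀.le)
        (fun r' hr' => (Metric.closedBall_subset_closedBall (by linarith)).trans (hmΩ r' (hsr hr'))) ?_
      · refine key.trans_lt ?_
        simp only [hc.lipFlow_self, hγs]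
        have hκη : √κ ≤ √κ₀ := Real.sqrt_le_sqrt hκκ₀
        have e1 : 2 * √η * A * D = rate n t₀ t₁ a F * η ^ (1 / 4 : ℝ) := by
          rw [← sqrt_mul_rpow hη, rate]; simp only [A, D]; ring
        have e2 : √κ * (A * D) ≤ √κ₀ * (A * D) := by gcongr
        calc (‖x' - x‖ + (2 * √η + √κ) * A) * D
            = ‖x' - x‖ * D + 2 * √η * A * D + √κ * (A * D) := by ring
          _ < r₀ := by rw [e1]; linarith
      · filter_upwards [h.ae_norm_sub_mollField_le hb hη hη1, h.ae] with τ h3 h4 h5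
        have hτ := uIoc_subset_uIcc h5
        have hτI := hJI' (hsrJ hτ)
        have h6 := h3 hτI (γ τ)
          ((Metric.closedBall_subset_closedBall (by linarith)).trans (hmΩ τ (hsr hτ)))
        have h7 := (h4 hτI).norm_moll_sub_moll_le hη hη1 hκ (by linarith)
          (x := lipFlow (mollField β κ) τ s x') (Subset.trans
            (Metric.closedBall_subset_closedBall' ?_) (hmΩ τ (hsr hτ)))
        · calc _ ≤ _ := add_le_add h7 h6
            _ = _ := by ring
        · have := hprev τ hτ
          rw [← dist_eq_norm] at this
          linarith
  have htube' : ∀ κ, 0 < κ → κ ≤ κ₀ → ∀ r ∈ Icc a₀ b₀,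
      lipFlow (mollField β κ) r s x' ∈ Metric.closedBall (γ r) r₀ := fun κ k1 k2 r hr => by
    rw [mem_closedBall_iff_norm]; exact (htube κ k1 k2 r hr).le
  obtain ⟨γ', hγ's, hγ', hrate⟩ := h.exists_solution hb (hδJ.trans hJI') hsI' hr₀ hκ₀ htube' hmΩ
  have hreach : Reaches b (Ioo t₀ t₁) Ω t s x' (γ' t) :=
    ⟨Ioo a₀ b₀, isOpen_Ioo, ordConnected_Ioo, (Ioo_subset_Icc_self.trans hδJ).trans hJI, hsI, htI,
      γ', hγ' _ Ioo_subset_Icc_self, hγ's, rfl⟩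
  refine ⟨⟨_, hreach⟩, fun κ k1 k2 => ⟨?_, fun r hr => ?_⟩⟩
  · rw [flow_eq_of_reaches (h.wellPosed hb) Ioo_subset_Icc_self hreach]
    exact hrate κ k1 k2 (by linarith) (by linarith) t (Ioo_subset_Icc_self htI)
  · have hrI := hsub (Ioo_subset_Icc_self htI) hr
    refine Subset.trans (Metric.closedBall_subset_closedBall' ?_) (hmΩ r hrI)
    have := Metric.mem_closedBall.1 (htube' κ k1 k2 r hrI)
    linarith

/-- Openness comes from `exists_ball_flow`: nearby mollified trajectories stay in a tube around a
solution that reaches the time `t`. -/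
theorem isOpen_flowDomain (h : ExpSobolevField t₀ t₁ Ω β B M R a F) (hb : IsRep t₀ t₁ Ω β b)
    (t s : ℝ) : IsOpen (flowDomain b (Ioo t₀ t₁) Ω t s) := by
  rw [Metric.isOpen_iff]
  intro x hx
  obtain ⟨ρ, hρ, κ₀, -, r₀, -, H⟩ := h.exists_ball_flow hb hx
  exact ⟨ρ, hρ, fun x' hx' => (H x' hx').1⟩

end ExpSobolevField

end WellPosedness

/-! ### Change of variables along a Lipschitz flow -/

section ChangeOfVariables

local notation "𝔼" n => EuclideanSpace ℝ (Fin n)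

variable {n : ℕ}

theorem LipschitzWith.volume_image_eq_zero {f : (𝔼 n) → 𝔼 n} {K : NNReal} (hf : LipschitzWith K f)
    {s : Set (𝔼 n)} (hs : volume s = 0) : volume (f '' s) = 0 := by
  have h1 := hf.hausdorffMeasure_image_le (d := Module.finrank ℝ (𝔼 n)) (Nat.cast_nonneg _) s
  have h2 : Measure.hausdorffMeasure (Module.finrank ℝ (𝔼 n)) s = 0 :=
    Measure.absolutelyContinuous_isAddHaarMeasure _ (volume : Measure (𝔼 n)) hs
  rw [h2, mul_zero] at h1
  exact Measure.absolutelyContinuous_isAddHaarMeasure (volume : Measure (𝔼 n)) _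
    (le_antisymm h1 (zero_le))

/-- Hadamard's inequality in its crudest form. -/
theorem ofReal_abs_det_le (A : (𝔼 n) →L[ℝ] 𝔼 n) : ENNReal.ofReal |A.det| ≤ ‖A‖ₑ ^ n := by
  have h1 := Measure.addHaar_image_continuousLinearMap (volume : Measure (𝔼 n)) A
    (Metric.closedBall 0 1)
  have h2 : A '' Metric.closedBall 0 1 ⊆ Metric.closedBall 0 ‖A‖ := by
    rintro _ ⟨x, hx, rfl⟩
    rw [mem_closedBall_zero_iff] at hx ⊢
    exact (A.le_opNorm x).trans (mul_le_of_le_one_right (norm_nonneg _) hx)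
  have h3 := measure_mono (μ := volume) h2
  rw [h1, Measure.addHaar_closedBall' _ _ (norm_nonneg A), finrank_euclideanSpace_fin,
    ENNReal.mul_le_mul_iff_left (Metric.measure_closedBall_pos volume _ one_pos).ne'
      measure_closedBall_lt_top.ne, ENNReal.ofReal_pow (norm_nonneg _), ofReal_norm] at h3
  exact h3

variable {c : ℝ → (𝔼 n) → 𝔼 n} {M L : ℝ}

theorem IsLipField.lipschitzWith_lipFlow (h : IsLipField c M L) (t s : ℝ) :
    LipschitzWith (Real.exp (|L| * |t - s|)).toNNReal (lipFlow c t s) := by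
  refine LipschitzWith.of_dist_le_mul fun x y => ?_
  rw [dist_eq_norm, dist_eq_norm, Real.coe_toNNReal _ (Real.exp_pos _).le]
  exact h.norm_lipFlow_sub_le t s x y

theorem IsLipField.lipFlow_cancel (h : IsLipField c M L) (s r : ℝ) (y : 𝔼 n) :
    lipFlow c r s (lipFlow c s r y) = y := by
  rw [h.lipFlow_lipFlow, h.lipFlow_self]

/-- Change of variables `x = X (s, r, y)` along the flow, with the Jacobian determinant bounded by
the `n`-th power of the norm of the differential. The flow is differentiable almost everywhere, by
Rademacher's theorem, and maps null sets to null sets. -/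
theorem IsLipField.lintegral_le_lintegral_comp_lipFlow (h : IsLipField c M L) (s r : ℝ)
    (G : (𝔼 n) → ℝ≥0∞) :
    ∫⁻ x, G x ≤ ∫⁻ y, ‖fderiv ℝ (lipFlow c s r) y‖ₑ ^ n * G (lipFlow c s r y) := by
  set f := lipFlow c s r
  have hL := h.lipschitzWith_lipFlow s r
  set S := {y | DifferentiableAt ℝ f y}
  have hS : MeasurableSet S := measurableSet_of_differentiableAt ℝ f
  have hSc : volume Sᶜ = 0 := hL.ae_differentiableAt
  have himg := hL.volume_image_eq_zero hSc
  have hinj : Injective f := LeftInverse.injective (g := lipFlow c r s) fun y => h.lipFlow_cancel s r y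
  have hsurj : Surjective f := RightInverse.surjective (g := lipFlow c r s)
    fun y => h.lipFlow_cancel r s y
  have hcov : f '' S =ᵐ[volume] univ := by
    refine eventuallyEq_univ.2 ?_
    rw [mem_ae_iff, ← image_compl_eq ⟨hinj, hsurj⟩]
    exact himg
  calc ∫⁻ x, G x = ∫⁻ x in f '' S, G x := by
        rw [setLIntegral_congr hcov, setLIntegral_univ]
    _ = ∫⁻ y in S, ENNReal.ofReal |(fderiv ℝ f y).det| * G (f y) :=
        lintegral_image_eq_lintegral_abs_det_fderiv_mul volume hS
          (fun y hy => (DifferentiableAt.hasFDerivAt hy).hasFDerivWithinAt) hinj.injOn G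
    _ ≤ ∫⁻ y in S, ‖fderiv ℝ f y‖ₑ ^ n * G (f y) :=
        lintegral_mono fun y => mul_le_mul_left (ofReal_abs_det_le _) _
    _ ≤ _ := setLIntegral_le_lintegral _ _

end ChangeOfVariables

/-! ### Trajectories inside an open set -/

section Admissible

local notation "𝔼" n => EuclideanSpace ℝ (Fin n)

variable {n : ℕ} {c : ℝ → (𝔼 n) → 𝔼 n} {M L : ℝ}

/-- The trajectory from `x` at time `s` stays in `U` until time `t`. -/
def StaysIn (c : ℝ → (𝔼 n) → 𝔼 n) (U : Set (𝔼 n)) (t s : ℝ) (x : 𝔼 n) : Prop :=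
  ∀ r ∈ uIcc s t, lipFlow c r s x ∈ U

/-- The times `s, t` are in `I`, the trajectory from `x` at time `s` stays in `U` until time `t`,
and as long as it stays in `U` it visits `V`. -/
def Admissible (c : ℝ → (𝔼 n) → 𝔼 n) (I : Set ℝ) (U V : Set (𝔼 n)) (t s : ℝ) (x : 𝔼 n) : Prop :=
  s ∈ I ∧ t ∈ I ∧ StaysIn c U t s x ∧ ∃ r ∈ I, StaysIn c U r s x ∧ lipFlow c r s x ∈ V

variable {I : Set ℝ} {U V : Set (𝔼 n)}

theorem isOpen_staysIn (h : IsLipField c M L) (hU : IsOpen U) :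
    IsOpen {z : ℝ × ℝ × 𝔼 n | StaysIn c U z.1 z.2.1 z.2.2} := by
  have e : {z : ℝ × ℝ × 𝔼 n | StaysIn c U z.1 z.2.1 z.2.2} = {z | ∀ θ ∈ Icc (0 : ℝ) 1,
      lipFlow c (z.2.1 + θ * (z.1 - z.2.1)) z.2.1 z.2.2 ∈ U} := by
    ext z
    simp only [StaysIn, mem_ofPred_eq, ← segment_eq_uIcc, segment_eq_image', forall_mem_image,
      smul_eq_mul]
  rw [e, isOpen_iff_mem_nhds]
  intro z hz
  refine isCompact_Icc.eventually_forall_of_forall_eventually (x₀ := z) fun θ hθ => ?_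
  have hc : Continuous fun w : (ℝ × ℝ × 𝔼 n) × ℝ =>
      lipFlow c (w.1.2.1 + w.2 * (w.1.1 - w.1.2.1)) w.1.2.1 w.1.2.2 :=
    h.continuous_lipFlow.comp (f := fun w : (ℝ × ℝ × 𝔼 n) × ℝ =>
      (w.1.2.1 + w.2 * (w.1.1 - w.1.2.1), w.1.2.1, w.1.2.2)) (by fun_prop)
  exact (hU.preimage hc).mem_nhds (hz θ hθ)

theorem isOpen_admissible (h : IsLipField c M L) (hI : IsOpen I) (hU : IsOpen U) (hV : IsOpen V) :
    IsOpen {z : ℝ × ℝ × 𝔼 n | Admissible c I U V z.1 z.2.1 z.2.2} := by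
  have h1 : IsOpen {w : ℝ × ℝ × 𝔼 n | w.1 ∈ I ∧ StaysIn c U w.1 w.2.1 w.2.2 ∧
      lipFlow c w.1 w.2.1 w.2.2 ∈ V} :=
    (hI.preimage continuous_fst).inter
      ((isOpen_staysIn h hU).inter (hV.preimage h.continuous_lipFlow))
  have h2 := isOpenMap_snd _ h1
  have e : {z : ℝ × ℝ × 𝔼 n | Admissible c I U V z.1 z.2.1 z.2.2} =
      {z | z.2.1 ∈ I} ∩ ({z | z.1 ∈ I} ∩ ({z | StaysIn c U z.1 z.2.1 z.2.2} ∩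
        {z | z.2 ∈ Prod.snd '' {w : ℝ × ℝ × 𝔼 n | w.1 ∈ I ∧ StaysIn c U w.1 w.2.1 w.2.2 ∧
          lipFlow c w.1 w.2.1 w.2.2 ∈ V}})) := by
    ext z
    simp [Admissible]
  rw [e]
  exact (hI.preimage (by fun_prop)).inter ((hI.preimage (by fun_prop)).inter
    ((isOpen_staysIn h hU).inter (h2.preimage continuous_snd)))

theorem StaysIn.comp (h : IsLipField c M L) {t s r : ℝ} {x : 𝔼 n} (hr : StaysIn c U r s x)
    (ht : StaysIn c U t s x) : StaysIn c U t r (lipFlow c r s x) := by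
  intro q hq
  rw [h.lipFlow_lipFlow]
  rcases uIcc_subset_uIcc_union_uIcc (b := s) hq with h1 | h1
  · rw [uIcc_comm] at h1; exact hr q h1
  · exact ht q h1

theorem staysIn_self (h : IsLipField c M L) {s : ℝ} {x : 𝔼 n} (hx : x ∈ U) : StaysIn c U s s x := by
  intro r hr
  rw [uIcc_self, mem_singleton_iff] at hr
  rwa [hr, h.lipFlow_self]

theorem StaysIn.mem (h : IsLipField c M L) {t s : ℝ} {x : 𝔼 n} (ht : StaysIn c U t s x) : x ∈ U := by
  have := ht s left_mem_uIcc
  rwa [h.lipFlow_self] at this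

namespace Admissible

theorem mem (h : IsLipField c M L) {t s : ℝ} {x : 𝔼 n} (ht : Admissible c I U V t s x) : x ∈ U :=
  ht.2.2.1.mem h

theorem self (h : IsLipField c M L) {t s : ℝ} {x : 𝔼 n} (ht : Admissible c I U V t s x) :
    Admissible c I U V s s x :=
  ⟨ht.1, ht.1, staysIn_self h (ht.mem h), ht.2.2.2⟩

theorem comp (h : IsLipField c M L) {t s r : ℝ} {x : 𝔼 n} (hr : Admissible c I U V r s x)
    (ht : Admissible c I U V t s x) : Admissible c I U V t r (lipFlow c r s x) := by
  obtain ⟨q, hq, hq1, hq2⟩ := hr.2.2.2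
  exact ⟨hr.2.1, ht.2.1, hr.2.2.1.comp h ht.2.2.1, q, hq, hr.2.2.1.comp h hq1, by
    rwa [h.lipFlow_lipFlow]⟩

theorem symm (h : IsLipField c M L) {s r : ℝ} {x : 𝔼 n} (hr : Admissible c I U V r s x) :
    Admissible c I U V s r (lipFlow c r s x) := hr.comp h (hr.self h)

/-- Admissibility of a time is a property of the trajectory, not of its starting point. -/
theorem iff_comp (h : IsLipField c M L) {t s r : ℝ} {x : 𝔼 n} (hr : Admissible c I U V r s x) :
    Admissible c I U V t s x ↔ Admissible c I U V t r (lipFlow c r s x) := by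
  refine ⟨fun ht => hr.comp h ht, fun ht => ?_⟩
  have := (hr.symm h).comp h ht
  rwa [h.lipFlow_cancel] at this

theorem of_mem_uIcc (hI : I.OrdConnected) {t s r : ℝ} {x : 𝔼 n}
    (ht : Admissible c I U V t s x) (hr : r ∈ uIcc s t) : Admissible c I U V r s x :=
  ⟨ht.1, hI.uIcc_subset ht.1 ht.2.1 hr, fun q hq =>
    ht.2.2.1 q (uIcc_subset_uIcc left_mem_uIcc hr hq), ht.2.2.2⟩

end Admissible

end Admissible

/-! ### The integral estimate for the flow of a Lipschitz field -/

section FlowEstimate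

local notation "𝔼" n => EuclideanSpace ℝ (Fin n)

variable {n : ℕ}

/-- A bounded Lipschitz field which is differentiable in space with a quadratic Taylor remainder,
uniformly in time; `Dc` is its spatial differential. -/
structure IsTaylorField (c : ℝ → (𝔼 n) → 𝔼 n) (Dc : ℝ → (𝔼 n) → (𝔼 n) →L[ℝ] 𝔼 n)
    (M L K : ℝ) : Prop extends IsLipField c M L where
  meas_deriv : Measurable (uncurry Dc)
  norm_deriv_le : ∀ t x, ‖Dc t x‖ ≤ L
  taylor : ∀ t x y, ‖c t y - c t x - Dc t x (y - x)‖ ≤ K * ‖y - x‖ ^ 2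

/-- Indicator function of admissibility. -/
noncomputable def admInd (c : ℝ → (𝔼 n) → 𝔼 n) (I : Set ℝ) (U V : Set (𝔼 n)) (t s : ℝ)
    (x : 𝔼 n) : ℝ≥0∞ :=
  {z : ℝ × ℝ × 𝔼 n | Admissible c I U V z.1 z.2.1 z.2.2}.indicator 1 (t, s, x)

/-- The length of the set of admissible times of a trajectory. -/
noncomputable def lifespan (c : ℝ → (𝔼 n) → 𝔼 n) (I : Set ℝ) (U V : Set (𝔼 n)) (s : ℝ)
    (x : 𝔼 n) : ℝ≥0∞ :=
  volume {t | Admissible c I U V t s x}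

variable {c : ℝ → (𝔼 n) → 𝔼 n} {I : Set ℝ} {U V : Set (𝔼 n)} {t s r : ℝ} {x y : 𝔼 n}

theorem admInd_of_admissible (h : Admissible c I U V t s x) : admInd c I U V t s x = 1 :=
  indicator_of_mem (s := {z : ℝ × ℝ × 𝔼 n | Admissible c I U V z.1 z.2.1 z.2.2}) h _

theorem admInd_of_not_admissible (h : ¬ Admissible c I U V t s x) : admInd c I U V t s x = 0 :=
  indicator_of_notMem (s := {z : ℝ × ℝ × 𝔼 n | Admissible c I U V z.1 z.2.1 z.2.2}) h _

theorem admInd_le_one : admInd c I U V t s x ≤ 1 := by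
  by_cases h : Admissible c I U V t s x
  · rw [admInd_of_admissible h]
  · rw [admInd_of_not_admissible h]; exact zero_le_one

theorem admInd_rpow {q : ℝ} (hq : 0 < q) : admInd c I U V t s x ^ q = admInd c I U V t s x := by
  by_cases h : Admissible c I U V t s x
  · rw [admInd_of_admissible h, ENNReal.one_rpow]
  · rw [admInd_of_not_admissible h, ENNReal.zero_rpow_of_pos hq]

variable {M L : ℝ}

theorem IsLipField.measurable_admInd (h : IsLipField c M L) (hI : IsOpen I) (hU : IsOpen U)
    (hV : IsOpen V) {α : Type*} [MeasurableSpace α] {f g : α → ℝ} {k : α → 𝔼 n}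
    (hf : Measurable f) (hg : Measurable g) (hk : Measurable k) :
    Measurable fun a => admInd c I U V (f a) (g a) (k a) :=
  (Measurable.indicator (f := (1 : ℝ × ℝ × (𝔼 n) → ℝ≥0∞)) measurable_const
    (isOpen_admissible h hI hU hV).measurableSet).comp (hf.prodMk (hg.prodMk hk))

theorem IsLipField.measurable_lifespan (h : IsLipField c M L) (hI : IsOpen I) (hU : IsOpen U)
    (hV : IsOpen V) {α : Type*} [MeasurableSpace α] {g : α → ℝ} {k : α → 𝔼 n}
    (hg : Measurable g) (hk : Measurable k) :
    Measurable fun a => lifespan c I U V (g a) (k a) :=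
  (measurable_measure_prodMk_right (μ := (volume : Measure ℝ))
    (isOpen_admissible h hI hU hV).measurableSet).comp (hg.prodMk hk)

theorem IsLipField.measurable_enorm_fderiv (h : IsLipField c M L) {α : Type*} [MeasurableSpace α]
    {f g : α → ℝ} {k : α → 𝔼 n} (hf : Measurable f) (hg : Measurable g) (hk : Measurable k) :
    Measurable fun a => ‖fderiv ℝ (lipFlow c (f a) (g a)) (k a)‖ₑ := by
  have h1 : Continuous (uncurry fun z : ℝ × ℝ => lipFlow c z.1 z.2) :=
    h.continuous_lipFlow.comp (f := fun w : (ℝ × ℝ) × 𝔼 n => (w.1.1, w.1.2, w.2)) (by fun_prop)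
  exact ((measurable_fderiv_with_param ℝ h1).comp ((hf.prodMk hg).prodMk hk)).enorm

theorem IsLipField.measurable_lipFlow (h : IsLipField c M L) {α : Type*} [MeasurableSpace α]
    {f g : α → ℝ} {k : α → 𝔼 n} (hf : Measurable f) (hg : Measurable g) (hk : Measurable k) :
    Measurable fun a => lipFlow c (f a) (g a) (k a) :=
  h.continuous_lipFlow.measurable.comp (hf.prodMk (hg.prodMk hk))

theorem lintegral_admInd (h : IsLipField c M L) (hI : IsOpen I) (hU : IsOpen U)
    (hV : IsOpen V) (s : ℝ) (x : 𝔼 n) : ∫⁻ r, admInd c I U V r s x = lifespan c I U V s x := by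
  have hm : MeasurableSet {t | Admissible c I U V t s x} :=
    ((isOpen_admissible h hI hU hV).measurableSet).preimage
      (f := fun t : ℝ => (t, s, x)) (by fun_prop)
  rw [lifespan, ← lintegral_indicator_one hm]
  rfl

/-- The lifespan is constant along a trajectory. -/
theorem Admissible.lifespan_eq (h : IsLipField c M L) (hr : Admissible c I U V r s x) :
    lifespan c I U V s x = lifespan c I U V r (lipFlow c r s x) := by
  unfold lifespan
  congr 1
  ext t
  exact hr.iff_comp h

theorem lifespan_le (c : ℝ → (𝔼 n) → 𝔼 n) (I : Set ℝ) (U V : Set (𝔼 n)) (s : ℝ) (x : 𝔼 n) :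
    lifespan c I U V s x ≤ volume I :=
  measure_mono fun _ ht => ht.2.1

theorem Admissible.lifespan_pos (h : IsLipField c M L) (hI : IsOpen I) (hU : IsOpen U)
    (hV : IsOpen V) (ht : Admissible c I U V t s x) : 0 < lifespan c I U V s x :=
  IsOpen.measure_pos _ ((isOpen_admissible h hI hU hV).preimage
    (f := fun t : ℝ => (t, s, x)) (by fun_prop)) ⟨t, ht⟩

/-- Inserting the indicator of admissibility allows the change of variables along the flow to be
performed on admissible trajectories only. -/
theorem IsLipField.lintegral_admInd_mul_le (h : IsLipField c M L) (s r : ℝ)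
    (G : (𝔼 n) → ℝ≥0∞) :
    ∫⁻ x, admInd c I U V r s x * G x ≤
      ∫⁻ y, admInd c I U V s r y * (‖fderiv ℝ (lipFlow c s r) y‖ₑ ^ n * G (lipFlow c s r y)) := by
  refine (h.lintegral_le_lintegral_comp_lipFlow s r _).trans (lintegral_mono fun y => ?_)
  by_cases hy : Admissible c I U V s r y
  · rw [admInd_of_admissible hy, one_mul]
    exact mul_le_mul_right (mul_le_of_le_one_left zero_le admInd_le_one) _
  · have : ¬ Admissible c I U V r s (lipFlow c s r y) := fun h' => by
      have := h'.symm h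
      rw [h.lipFlow_cancel] at this
      exact hy this
    simp [admInd_of_not_admissible this]

variable {Dc : ℝ → (𝔼 n) → (𝔼 n) →L[ℝ] 𝔼 n} {K p ℓ : ℝ}

theorem IsTaylorField.measurable_exp (h : IsTaylorField c Dc M L K) (q : ℝ)
    {α : Type*} [MeasurableSpace α] {g : α → ℝ} {k : α → 𝔼 n}
    (hg : Measurable g) (hk : Measurable k) :
    Measurable fun a => ENNReal.ofReal (Real.exp (q * ‖Dc (g a) (k a)‖)) :=
  ((Real.measurable_exp.comp ((h.meas_deriv.comp (hg.prodMk hk)).norm.const_mul q))).ennreal_ofReal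

/-- Jensen's inequality in time for the differential of the flow. -/
theorem IsTaylorField.enorm_fderiv_rpow_le (h : IsTaylorField c Dc M L K) (hI : IsOpen I)
    (hIc : I.OrdConnected) (hU : IsOpen U) (hV : IsOpen V) (hℓ : volume I = ENNReal.ofReal ℓ)
    (hℓ0 : 0 ≤ ℓ) (hp : 0 ≤ p) (ht : Admissible c I U V t s x) :
    ‖fderiv ℝ (lipFlow c t s) x‖ₑ ^ p ≤
      (lifespan c I U V s x)⁻¹ * ∫⁻ r, admInd c I U V r s x *
        ENNReal.ofReal (Real.exp (p * ℓ * ‖Dc r (lipFlow c r s x)‖)) := by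
  have hL := h.toIsLipField
  set J := {r | Admissible c I U V r s x}
  have hJo : IsOpen J := (isOpen_admissible hL hI hU hV).preimage
    (f := fun t : ℝ => (t, s, x)) (by fun_prop)
  have hJm : MeasurableSet J := hJo.measurableSet
  have hJ0 : volume J ≠ 0 := (ht.lifespan_pos hL hI hU hV).ne'
  have hJle : volume J ≤ ENNReal.ofReal ℓ := hℓ ▸ lifespan_le c I U V s x
  have hJt : volume J ≠ ⊤ := (hJle.trans_lt ENNReal.ofReal_lt_top).ne
  set g : ℝ → (𝔼 n) →L[ℝ] 𝔼 n := fun r => Dc r (lipFlow c r s x)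
  have hγ : Measurable fun r => lipFlow c r s x :=
    hL.measurable_lipFlow measurable_id measurable_const measurable_const
  have hg : Measurable g := h.meas_deriv.comp (measurable_id.prodMk hγ)
  have hfin : IsFiniteMeasure (volume.restrict J) := ⟨by simpa using hJt.lt_top⟩
  have hgi : Integrable (fun r => ‖g r‖) (volume.restrict J) :=
    Integrable.of_bound hg.norm.aestronglyMeasurable L
      (Eventually.of_forall fun r => by simpa using h.norm_deriv_le r _)
  set μ := (volume J)⁻¹ • volume.restrict J
  have hμ : IsProbabilityMeasure μ := ⟨by
    simp only [μ, Measure.smul_apply, Measure.restrict_apply_univ, smul_eq_mul]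
    exact ENNReal.inv_mul_cancel hJ0 hJt⟩
  have e1 : ‖fderiv ℝ (lipFlow c t s) x‖ ≤ Real.exp (∫ r in J, ‖g r‖) := by
    refine (hL.norm_fderiv_lipFlow_le (fun γ hγ => (h.meas_deriv.comp
      (measurable_id.prodMk hγ.measurable)).norm) h.norm_deriv_le h.taylor t s x).trans
      (Real.exp_le_exp.2 ?_)
    rw [intervalIntegral.abs_intervalIntegral_eq,
      abs_of_nonneg (integral_nonneg fun r => norm_nonneg _)]
    exact setIntegral_mono_set hgi (Eventually.of_forall fun r => norm_nonneg _)
      (LE.le.eventuallyLE fun r hr => ht.of_mem_uIcc hIc (uIoc_subset_uIcc hr))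
  have e2 : ∫ r in J, ‖g r‖ ≤ ℓ * ‖∫ r, ‖g r‖ ∂μ‖ := by
    rw [integral_smul_measure, Real.norm_of_nonneg (smul_nonneg ENNReal.toReal_nonneg
      (integral_nonneg fun r => norm_nonneg _)), smul_eq_mul, ENNReal.toReal_inv]
    have h1 : 0 < (volume J).toReal := ENNReal.toReal_pos hJ0 hJt
    have h2 : (volume J).toReal ≤ ℓ := ENNReal.toReal_le_of_le_ofReal hℓ0 hJle
    have h3 : (0:ℝ) ≤ ∫ r in J, ‖g r‖ := integral_nonneg fun r => norm_nonneg _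
    rw [← mul_assoc, ← div_eq_mul_inv]
    exact le_mul_of_one_le_left h3 ((one_le_div h1).2 h2)
  have e3 := exp_norm_integral_le (μ := μ) (q := p * ℓ) (mul_nonneg hp hℓ0)
    (hg.norm.aestronglyMeasurable)
  simp only [norm_norm] at e3
  calc ‖fderiv ℝ (lipFlow c t s) x‖ₑ ^ p
      ≤ ENNReal.ofReal (Real.exp (∫ r in J, ‖g r‖)) ^ p := by
        rw [← ofReal_norm]
        exact ENNReal.rpow_le_rpow (ENNReal.ofReal_le_ofReal e1) hp
    _ = ENNReal.ofReal (Real.exp ((∫ r in J, ‖g r‖) * p)) := by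
        rw [ENNReal.ofReal_rpow_of_pos (Real.exp_pos _), Real.exp_mul]
    _ ≤ ENNReal.ofReal (Real.exp (p * ℓ * ‖∫ r, ‖g r‖ ∂μ‖)) := by
        refine ENNReal.ofReal_le_ofReal (Real.exp_le_exp.2 ?_)
        rw [mul_assoc, mul_comm]
        exact mul_le_mul_of_nonneg_left e2 hp
    _ ≤ _ := e3
    _ = (volume J)⁻¹ * ∫⁻ r in J, ENNReal.ofReal (Real.exp (p * ℓ * ‖g r‖)) := by
        rw [lintegral_smul_measure, smul_eq_mul]
    _ = _ := by
        congr 1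
        rw [← lintegral_indicator hJm]
        refine lintegral_congr fun r => ?_
        by_cases hr : Admissible c I U V r s x
        · rw [admInd_of_admissible hr, one_mul, indicator_of_mem (show r ∈ J from hr)]
        · rw [admInd_of_not_admissible hr, zero_mul, indicator_of_notMem (show r ∉ J from hr)]

end FlowEstimate

/-! ### Absorption: the energy of the flow is bounded by that of the field -/

section FlowEnergy

local notation "𝔼" n => EuclideanSpace ℝ (Fin n)

variable {n : ℕ}

/-- The integral of `‖D_x X(t, s, x)‖ ^ p` over the admissible pairs `(s, x)`. -/
noncomputable def flowEnergy (c : ℝ → (𝔼 n) → 𝔼 n) (I : Set ℝ) (U V : Set (𝔼 n)) (p t : ℝ) :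
    ℝ≥0∞ :=
  ∫⁻ s, ∫⁻ x, admInd c I U V t s x * ‖fderiv ℝ (lipFlow c t s) x‖ₑ ^ p

/-- The integral of the weighted exponential of the differential of the field; the weight
involves the length of the life of the trajectory through `(r, y)`. -/
noncomputable def fieldEnergy (c : ℝ → (𝔼 n) → 𝔼 n) (Dc : ℝ → (𝔼 n) → (𝔼 n) →L[ℝ] 𝔼 n)
    (I : Set ℝ) (U V : Set (𝔼 n)) (ℓ p : ℝ) : ℝ≥0∞ :=
  ∫⁻ r, ∫⁻ y, admInd c I U V r r y * lifespan c I U V r y ^ ((n : ℝ) / (n - p)) *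
    ENNReal.ofReal (Real.exp (ℓ * p ^ 2 / (p - n) * ‖Dc r y‖))

variable {c : ℝ → (𝔼 n) → 𝔼 n} {Dc : ℝ → (𝔼 n) → (𝔼 n) →L[ℝ] 𝔼 n} {I : Set ℝ}
  {U V : Set (𝔼 n)} {M L K p ℓ : ℝ}

/-- Jensen's inequality in time, followed by the change of variables to the intermediate time `r`:
the energy is an integral over the trajectories in which `s` and `r` play separate roles. -/
theorem IsTaylorField.flowEnergy_le (h : IsTaylorField c Dc M L K) (hI : IsOpen I)
    (hIc : I.OrdConnected) (hU : IsOpen U) (hV : IsOpen V) (hℓ : volume I = ENNReal.ofReal ℓ)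
    (hℓ0 : 0 ≤ ℓ) (hp : 0 ≤ p) (t : ℝ) :
    flowEnergy c I U V p t ≤ ∫⁻ s, ∫⁻ r, ∫⁻ y,
      (admInd c I U V t r y * admInd c I U V s r y * (lifespan c I U V r y)⁻¹ *
        ENNReal.ofReal (Real.exp (p * ℓ * ‖Dc r y‖))) *
      (admInd c I U V s r y * ‖fderiv ℝ (lipFlow c s r) y‖ₑ ^ n) := by
  have hL := h.toIsLipField
  refine lintegral_mono fun s => ?_
  calc ∫⁻ x, admInd c I U V t s x * ‖fderiv ℝ (lipFlow c t s) x‖ₑ ^ p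
      ≤ ∫⁻ x, ∫⁻ r, admInd c I U V r s x * (admInd c I U V t s x * (lifespan c I U V s x)⁻¹ *
          ENNReal.ofReal (Real.exp (p * ℓ * ‖Dc r (lipFlow c r s x)‖))) := by
        refine lintegral_mono fun x => ?_
        by_cases hx : Admissible c I U V t s x
        · simp only [admInd_of_admissible hx, one_mul]
          refine (h.enorm_fderiv_rpow_le hI hIc hU hV hℓ hℓ0 hp hx).trans ?_
          rw [← lintegral_const_mul]
          · refine lintegral_mono fun r => le_of_eq ?_
            ring
          · exact (hL.measurable_admInd hI hU hV measurable_id measurable_const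
              measurable_const).mul (h.measurable_exp _ measurable_id (hL.measurable_lipFlow
                measurable_id measurable_const measurable_const))
        · simp only [admInd_of_not_admissible hx, zero_mul]
          exact zero_le
    _ = ∫⁻ r, ∫⁻ x, admInd c I U V r s x * (admInd c I U V t s x * (lifespan c I U V s x)⁻¹ *
          ENNReal.ofReal (Real.exp (p * ℓ * ‖Dc r (lipFlow c r s x)‖))) := by
        refine lintegral_lintegral_swap (Measurable.aemeasurable ?_)
        refine (hL.measurable_admInd hI hU hV measurable_snd measurable_const measurable_fst).mul
          (((hL.measurable_admInd hI hU hV measurable_const measurable_const measurable_fst).mul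
          (hL.measurable_lifespan hI hU hV measurable_const measurable_fst).inv).mul
          (h.measurable_exp _ measurable_snd (hL.measurable_lipFlow
                measurable_snd measurable_const measurable_fst)))
    _ ≤ _ := by
        refine lintegral_mono fun r => ?_
        refine (hL.lintegral_admInd_mul_le s r _).trans (lintegral_mono fun y => ?_)
        by_cases hy : Admissible c I U V s r y
        · have e : admInd c I U V t s (lipFlow c s r y) = admInd c I U V t r y := by
            by_cases h' : Admissible c I U V t r y
            · rw [admInd_of_admissible h', admInd_of_admissible ((hy.iff_comp hL).1 h')]
            · rw [admInd_of_not_admissible h',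
                admInd_of_not_admissible fun h'' => h' ((hy.iff_comp hL).2 h'')]
          rw [admInd_of_admissible hy, e, ← hy.lifespan_eq hL, hL.lipFlow_cancel]
          apply le_of_eq
          ring
        · simp [admInd_of_not_admissible hy]

theorem lintegral_prod_three {f : ℝ × ℝ × (𝔼 n) → ℝ≥0∞} (hf : Measurable f) :
    ∫⁻ s, ∫⁻ r, ∫⁻ y, f (s, r, y) = ∫⁻ z, f z := by
  rw [Measure.volume_eq_prod, lintegral_prod _ hf.aemeasurable]
  refine lintegral_congr fun s => ?_
  rw [Measure.volume_eq_prod]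
  exact (lintegral_prod (fun q : ℝ × 𝔼 n => f (s, q))
    (hf.comp measurable_prodMk_left).aemeasurable).symm

theorem lintegral_prod_three_symm {f : ℝ × ℝ × (𝔼 n) → ℝ≥0∞} (hf : Measurable f) :
    ∫⁻ z, f z = ∫⁻ r, ∫⁻ y, ∫⁻ s, f (s, r, y) := by
  rw [Measure.volume_eq_prod, lintegral_prod_symm' _ hf, Measure.volume_eq_prod]
  exact lintegral_prod (fun q : ℝ × 𝔼 n => ∫⁻ s, f (s, q)) hf.lintegral_prod_left'.aemeasurable

theorem lintegral_lintegral_mul_le {P Q : ℝ} (hPQ : P.HolderConjugate Q)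
    {f g : ℝ × (𝔼 n) → ℝ≥0∞} (hf : Measurable f) (hg : Measurable g) :
    ∫⁻ r, ∫⁻ y, f (r, y) * g (r, y) ≤ (∫⁻ r, ∫⁻ y, f (r, y) ^ P) ^ (1 / P) *
      (∫⁻ r, ∫⁻ y, g (r, y) ^ Q) ^ (1 / Q) := by
  have := ENNReal.lintegral_mul_le_Lp_mul_Lq (volume.prod volume) hPQ hf.aemeasurable
    hg.aemeasurable
  rwa [lintegral_prod _ (hf.mul hg).aemeasurable,
    lintegral_prod _ (hf.pow_const P).aemeasurable,
    lintegral_prod _ (hg.pow_const Q).aemeasurable] at this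

/-- An absorption argument: `B ≤ ℓ Λ ^ (1 / P) B ^ (1 / Q)` with `B` finite bounds `B`. -/
theorem rpow_absorb {P Q : ℝ} (hPQ : P.HolderConjugate Q) {B l Λ : ℝ≥0∞} (hB : B ≠ ⊤)
    (h : B ≤ l * (Λ ^ (1 / P) * B ^ (1 / Q))) : B ≤ l ^ P * Λ := by
  rcases eq_or_ne B 0 with h0 | h0
  · rw [h0]; exact zero_le
  have h1 : B ^ (1 / P) * B ^ (1 / Q) = B := by
    rw [← ENNReal.rpow_add _ _ h0 hB, one_div, one_div, hPQ.inv_add_inv_eq_one, ENNReal.rpow_one]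
  have h2 : B ^ (1 / P) ≤ l * Λ ^ (1 / P) := by
    have h3 : B ^ (1 / Q) ≠ 0 := (ENNReal.rpow_pos h0.bot_lt hB).ne'
    have h4 : B ^ (1 / Q) ≠ ⊤ := ENNReal.rpow_ne_top_of_nonneg (one_div_nonneg.2 hPQ.symm.nonneg) hB
    refine (ENNReal.mul_le_mul_iff_left h3 h4).1 ?_
    rw [h1, mul_assoc]
    exact h
  have h3 := ENNReal.rpow_le_rpow h2 hPQ.nonneg
  rwa [ENNReal.mul_rpow_of_nonneg _ _ hPQ.nonneg, ← ENNReal.rpow_mul, ← ENNReal.rpow_mul,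
    one_div_mul_cancel hPQ.ne_zero, ENNReal.rpow_one, ENNReal.rpow_one] at h3

theorem holderConjugate_div {n p : ℝ} (hn : 0 < n) (hp : n < p) :
    (p / (p - n)).HolderConjugate (p / n) := by
  refine Real.holderConjugate_iff.2 ⟨?_, ?_⟩
  · rw [one_lt_div (by linarith)]; linarith
  · have : p - n ≠ 0 := by linarith
    have : p ≠ 0 := by linarith
    field_simp
    ring

theorem enorm_fderiv_lipFlow_le (h : IsLipField c M L) {t s : ℝ} (hts : |t - s| ≤ ℓ)
    (x : 𝔼 n) : ‖fderiv ℝ (lipFlow c t s) x‖ₑ ≤ ENNReal.ofReal (Real.exp (|L| * ℓ)) := by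
  rw [← ofReal_norm]
  refine ENNReal.ofReal_le_ofReal ((norm_fderiv_le_of_lipschitz ℝ
    (h.lipschitzWith_lipFlow t s)).trans ?_)
  rw [Real.coe_toNNReal _ (Real.exp_pos _).le]
  exact Real.exp_le_exp.2 (mul_le_mul_of_nonneg_left hts (abs_nonneg _))

/-- The `p`-energy of the flow of a Lipschitz field is finite, by the Lipschitz bound. -/
theorem IsLipField.lintegral_flowEnergy_ne_top (h : IsLipField c M L) (hIb : Bornology.IsBounded I)
    (hIm : MeasurableSet I) (hUm : MeasurableSet U)
    (hU : Bornology.IsBounded U) (hp : 0 ≤ p) : ∫⁻ t, flowEnergy c I U V p t ≠ ⊤ := by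
  set ℓ := Metric.diam I
  have hb : ∀ t s x, admInd c I U V t s x * ‖fderiv ℝ (lipFlow c t s) x‖ₑ ^ p ≤
      I.indicator (fun _ => I.indicator (fun _ => U.indicator
        (fun _ => ENNReal.ofReal (Real.exp (|L| * ℓ)) ^ p) x) s) t := by
    intro t s x
    by_cases hx : Admissible c I U V t s x
    · rw [admInd_of_admissible hx, one_mul, indicator_of_mem hx.2.1, indicator_of_mem hx.1,
        indicator_of_mem (hx.mem h)]
      exact ENNReal.rpow_le_rpow (enorm_fderiv_lipFlow_le h
        (Metric.dist_le_diam_of_mem hIb hx.2.1 hx.1) x) hp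
    · rw [admInd_of_not_admissible hx, zero_mul]
      exact zero_le
  refine (lt_of_le_of_lt (lintegral_mono fun t => lintegral_mono fun s => lintegral_mono fun x =>
    hb t s x) ?_).ne
  set C := ENNReal.ofReal (Real.exp (|L| * ℓ)) ^ p
  have hC : C < ⊤ := ENNReal.rpow_lt_top_of_nonneg hp ENNReal.ofReal_ne_top
  have e1 : ∀ t s : ℝ, ∫⁻ x, I.indicator (fun _ => I.indicator (fun _ => U.indicator
        (fun _ => C) x) s) t = I.indicator (fun _ => I.indicator (fun _ => C * volume U) s) t := by
    intro t s
    by_cases h1 : t ∈ I <;> by_cases h2 : s ∈ I <;> simp [h1, h2, hUm]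
  have e2 : ∀ t : ℝ, ∫⁻ s, I.indicator (fun _ => I.indicator (fun _ => C * volume U) s) t =
      I.indicator (fun _ => C * volume U * volume I) t := by
    intro t
    by_cases h1 : t ∈ I <;> simp [h1, hIm]
  simp only [e1, e2]
  rw [lintegral_indicator_const hIm]
  exact ENNReal.mul_lt_top (ENNReal.mul_lt_top (ENNReal.mul_lt_top hC hU.measure_lt_top)
    hIb.measure_lt_top) hIb.measure_lt_top

theorem rpow_div_eq {n p : ℝ} (hp : n < p) (a : ℝ≥0∞) (ha : a ≠ 0) (ha' : a ≠ ⊤) :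
    (a⁻¹) ^ (p / (p - n)) * a = a ^ (n / (n - p)) := by
  have : p - n ≠ 0 := by linarith
  have : n - p ≠ 0 := by linarith
  nth_rewrite 2 [← ENNReal.rpow_one a]
  rw [ENNReal.inv_rpow, ← ENNReal.rpow_neg, ← ENNReal.rpow_add _ _ ha ha']
  congr 1
  field_simp
  ring

theorem ofReal_exp_rpow {n p : ℝ} (ℓ d : ℝ) :
    ENNReal.ofReal (Real.exp (p * ℓ * d)) ^ (p / (p - n)) =
      ENNReal.ofReal (Real.exp (ℓ * p ^ 2 / (p - n) * d)) := by
  rw [ENNReal.ofReal_rpow_of_pos (Real.exp_pos _), ← Real.exp_mul]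
  congr 2
  ring

/-- Hölder's inequality bounds the energy at time `t` by a power less than one of the energy
integrated over all times. -/
theorem IsTaylorField.flowEnergy_le_mul (h : IsTaylorField c Dc M L K) (hn : 0 < n)
    (hp : (n : ℝ) < p) (hI : IsOpen I)
    (hIc : I.OrdConnected) (hU : IsOpen U) (hV : IsOpen V) (hℓ : volume I = ENNReal.ofReal ℓ)
    (hℓ0 : 0 ≤ ℓ) (t : ℝ) :
    flowEnergy c I U V p t ≤ fieldEnergy c Dc I U V ℓ p ^ (1 / (p / (p - n))) *
      (∫⁻ s, flowEnergy c I U V p s) ^ (1 / (p / n)) := by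
  have hL := h.toIsLipField
  have hn' : (0 : ℝ) < n := by exact_mod_cast hn
  have hPQ := holderConjugate_div hn' hp
  set f : ℝ × ℝ × (𝔼 n) → ℝ≥0∞ := fun z => admInd c I U V t z.2.1 z.2.2 *
    admInd c I U V z.1 z.2.1 z.2.2 * (lifespan c I U V z.2.1 z.2.2)⁻¹ *
        ENNReal.ofReal (Real.exp (p * ℓ * ‖Dc z.2.1 z.2.2‖))
  set g : ℝ × ℝ × (𝔼 n) → ℝ≥0∞ := fun z => admInd c I U V z.1 z.2.1 z.2.2 *
    ‖fderiv ℝ (lipFlow c z.1 z.2.1) z.2.2‖ₑ ^ n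
  have m1 : Measurable fun z : ℝ × ℝ × 𝔼 n => z.2.1 := by fun_prop
  have m2 : Measurable fun z : ℝ × ℝ × 𝔼 n => z.2.2 := by fun_prop
  have ma1 := hL.measurable_admInd hI hU hV (measurable_const (a := t)) m1 m2
  have ma2 := hL.measurable_admInd hI hU hV measurable_fst m1 m2
  have ml := hL.measurable_lifespan hI hU hV m1 m2
  have me := h.measurable_exp (p * ℓ) m1 m2
  have hf : Measurable f := ((ma1.mul ma2).mul ml.inv).mul me
  have hg : Measurable g := ma2.mul ((hL.measurable_enorm_fderiv measurable_fst m1 m2).pow_const n)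
  have key := h.flowEnergy_le hI hIc hU hV hℓ hℓ0 (hn'.trans hp).le t
  refine key.trans ?_
  rw [lintegral_prod_three (f := fun z => f z * g z) (hf.mul hg)]
  refine (ENNReal.lintegral_mul_le_Lp_mul_Lq volume hPQ hf.aemeasurable hg.aemeasurable).trans ?_
  refine mul_le_mul' (ENNReal.rpow_le_rpow ?_ (one_div_nonneg.2 hPQ.nonneg))
    (ENNReal.rpow_le_rpow ?_ (one_div_nonneg.2 hPQ.symm.nonneg))
  -- the integral over `s` yields the lifespan to the power `1 - p / (p - n) = n / (n - p)`
  · have e : ∀ z, f z ^ (p / (p - n)) = admInd c I U V t z.2.1 z.2.2 *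
        admInd c I U V z.1 z.2.1 z.2.2 * ((lifespan c I U V z.2.1 z.2.2)⁻¹ ^ (p / (p - n))) *
        ENNReal.ofReal (Real.exp (ℓ * p ^ 2 / (p - n) * ‖Dc z.2.1 z.2.2‖)) := by
      intro z
      simp only [f]
      rw [ENNReal.mul_rpow_of_nonneg _ _ hPQ.nonneg, ENNReal.mul_rpow_of_nonneg _ _ hPQ.nonneg,
        ENNReal.mul_rpow_of_nonneg _ _ hPQ.nonneg, admInd_rpow hPQ.pos, admInd_rpow hPQ.pos,
        ofReal_exp_rpow]
    rw [lintegral_prod_three_symm (hf.pow_const _)]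
    simp only [e]
    refine lintegral_mono fun r => lintegral_mono fun y => ?_
    have hm : Measurable fun s => admInd c I U V s r y :=
      hL.measurable_admInd hI hU hV measurable_id measurable_const measurable_const
    by_cases hy : Admissible c I U V t r y
    · simp only [admInd_of_admissible hy, one_mul, admInd_of_admissible (hy.self hL)]
      rw [lintegral_mul_const _ (hm.mul_const _), lintegral_mul_const _ hm,
        lintegral_admInd hL hI hU hV, mul_comm (lifespan c I U V r y), rpow_div_eq hp _
          (hy.lifespan_pos hL hI hU hV).ne' ((lifespan_le c I U V r y).trans_lt
          (hℓ ▸ ENNReal.ofReal_lt_top)).ne]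
    · simp [admInd_of_not_admissible hy]
  -- the power `n · p / n = p` of the differential gives back the energy
  · rw [← lintegral_prod_three (hg.pow_const _)]
    refine lintegral_mono fun s => lintegral_mono fun r => lintegral_mono fun y => le_of_eq ?_
    simp only [g]
    rw [ENNReal.mul_rpow_of_nonneg _ _ hPQ.symm.nonneg, admInd_rpow hPQ.symm.pos,
      ← ENNReal.rpow_natCast, ← ENNReal.rpow_mul]
    congr 2
    field_simp

theorem flowEnergy_eq_zero {t : ℝ} (htI : t ∉ I) : flowEnergy c I U V p t = 0 := by
  have : ∀ s x, admInd c I U V t s x = 0 := fun s x =>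
    admInd_of_not_admissible fun h => htI h.2.1
  simp [flowEnergy, this]

/-- Integrating the previous bound over time, the total energy appears on both sides and can be
absorbed, since it is finite for a Lipschitz field; inserting the result back bounds the energy at
every time `t`. -/
theorem IsTaylorField.flowEnergy_le_fieldEnergy (h : IsTaylorField c Dc M L K) (hn : 0 < n)
    (hp : (n : ℝ) < p) (hI : IsOpen I) (hIb : Bornology.IsBounded I) (hUb : Bornology.IsBounded U)
    (hIc : I.OrdConnected) (hU : IsOpen U) (hV : IsOpen V) (hℓ : volume I = ENNReal.ofReal ℓ)
    (hℓ0 : 0 ≤ ℓ) (t : ℝ) :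
    flowEnergy c I U V p t ≤
      ENNReal.ofReal ℓ ^ ((n : ℝ) / (p - n)) * fieldEnergy c Dc I U V ℓ p := by
  have hn' : (0 : ℝ) < n := by exact_mod_cast hn
  have hPQ := holderConjugate_div hn' hp
  have hmul := h.flowEnergy_le_mul hn hp hI hIc hU hV hℓ hℓ0
  set Λ := fieldEnergy c Dc I U V ℓ p
  have hB := h.toIsLipField.lintegral_flowEnergy_ne_top (V := V) hIb hI.measurableSet
    hU.measurableSet hUb (hn'.trans hp).le
  set B := ∫⁻ s, flowEnergy c I U V p s
  have h1 : B ≤ ENNReal.ofReal ℓ * (Λ ^ (1 / (p / (p - n))) * B ^ (1 / (p / n))) := by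
    calc B ≤ ∫⁻ t, I.indicator (fun _ => Λ ^ (1 / (p / (p - n))) * B ^ (1 / (p / n))) t := by
          refine lintegral_mono fun t => ?_
          by_cases ht : t ∈ I
          · rw [indicator_of_mem ht]; exact hmul t
          · rw [flowEnergy_eq_zero ht]; exact zero_le
      _ = _ := by rw [lintegral_indicator_const hI.measurableSet, hℓ, mul_comm]
  have h2 := rpow_absorb hPQ hB h1
  refine (hmul t).trans ?_
  refine (mul_le_mul' le_rfl (ENNReal.rpow_le_rpow h2 (one_div_nonneg.2 hPQ.symm.nonneg))).trans ?_
  rw [ENNReal.mul_rpow_of_nonneg _ _ (one_div_nonneg.2 hPQ.symm.nonneg), mul_left_comm,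
    ← ENNReal.rpow_add_of_nonneg _ _ (one_div_nonneg.2 hPQ.nonneg)
      (one_div_nonneg.2 hPQ.symm.nonneg), one_div, one_div, hPQ.inv_add_inv_eq_one,
    ENNReal.rpow_one, ← ENNReal.rpow_mul]
  have : p - n ≠ 0 := by linarith
  have : p ≠ 0 := by linarith
  refine le_of_eq ?_
  congr 2
  field_simp

/-- The energy of the flow issued from the fixed time `t`. Here the integral over the final time
cancels the inverse of the lifespan, so no weight remains. -/
theorem IsTaylorField.lintegral_flow_from_le (h : IsTaylorField c Dc M L K) (hn : 0 < n)
    (hp : (n : ℝ) < p) (hI : IsOpen I)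
    (hIc : I.OrdConnected) (hU : IsOpen U) (hV : IsOpen V) (hℓ : volume I = ENNReal.ofReal ℓ)
    (hℓ0 : 0 ≤ ℓ) (t : ℝ) :
    ∫⁻ s, ∫⁻ x, admInd c I U V s t x * ‖fderiv ℝ (lipFlow c s t) x‖ₑ ^ p ≤
      (∫⁻ r, ∫⁻ y, admInd c I U V r r y *
        ENNReal.ofReal (Real.exp (ℓ * p ^ 2 / (p - n) * ‖Dc r y‖))) ^ (1 / (p / (p - n))) *
      flowEnergy c I U V p t ^ (1 / (p / n)) := by
  have hL := h.toIsLipField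
  have hn' : (0 : ℝ) < n := by exact_mod_cast hn
  have hPQ := holderConjugate_div hn' hp
  have hma : ∀ {α : Type} [MeasurableSpace α] {f g : α → ℝ} {k : α → 𝔼 n},
    Measurable f → Measurable g → Measurable k →
    Measurable fun a => admInd c I U V (f a) (g a) (k a) := fun hf hg hk =>
      hL.measurable_admInd hI hU hV hf hg hk
  set E : ℝ → ℝ → (𝔼 n) → ℝ≥0∞ := fun r s x =>
    ENNReal.ofReal (Real.exp (p * ℓ * ‖Dc r (lipFlow c r s x)‖))
  have hE : ∀ {α : Type} [MeasurableSpace α] {g : α → ℝ} {k : α → 𝔼 n}, Measurable g →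
    Measurable k → Measurable fun a => E (g a) t (k a) := fun hg hk =>
      h.measurable_exp _ hg (hL.measurable_lipFlow hg measurable_const hk)
  calc ∫⁻ s, ∫⁻ x, admInd c I U V s t x * ‖fderiv ℝ (lipFlow c s t) x‖ₑ ^ p
      ≤ ∫⁻ s, ∫⁻ x, admInd c I U V s t x * ((lifespan c I U V t x)⁻¹ *
          ∫⁻ r, admInd c I U V r t x * E r t x) := by
        refine lintegral_mono fun s => lintegral_mono fun x => ?_
        by_cases hx : Admissible c I U V s t x
        · simp only [admInd_of_admissible hx, one_mul]
          exact h.enorm_fderiv_rpow_le hI hIc hU hV hℓ hℓ0 (hn'.trans hp).le hx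
        · simp [admInd_of_not_admissible hx]
    _ = ∫⁻ x, ∫⁻ s, admInd c I U V s t x * ((lifespan c I U V t x)⁻¹ *
          ∫⁻ r, admInd c I U V r t x * E r t x) := by
        refine lintegral_lintegral_swap (Measurable.aemeasurable ?_)
        refine (hma measurable_fst measurable_const measurable_snd).mul
          ((hL.measurable_lifespan hI hU hV measurable_const measurable_snd).inv.mul ?_)
        exact Measurable.lintegral_prod_left' (f := fun z : ℝ × ℝ × 𝔼 n =>
          admInd c I U V z.1 t z.2.2 * E z.1 t z.2.2)
          ((hma measurable_fst measurable_const measurable_snd.snd).mul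
          (hE measurable_fst measurable_snd.snd))
    _ ≤ ∫⁻ x, ∫⁻ r, admInd c I U V r t x * E r t x := by
        refine lintegral_mono fun x => ?_
        have hm : Measurable fun s => admInd c I U V s t x :=
          hma measurable_id measurable_const measurable_const
        rw [lintegral_mul_const _ hm, lintegral_admInd hL hI hU hV, ← mul_assoc]
        exact mul_le_of_le_one_left zero_le (ENNReal.mul_inv_le_one _)
    _ = ∫⁻ r, ∫⁻ x, admInd c I U V r t x * E r t x := by
        refine lintegral_lintegral_swap (Measurable.aemeasurable ?_)
        exact (hma measurable_snd measurable_const measurable_fst).mul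
          (hE measurable_snd measurable_fst)
    _ ≤ ∫⁻ r, ∫⁻ y, (admInd c I U V r r y * ENNReal.ofReal (Real.exp (p * ℓ * ‖Dc r y‖))) *
          (admInd c I U V t r y * ‖fderiv ℝ (lipFlow c t r) y‖ₑ ^ n) := by
        refine lintegral_mono fun r => (hL.lintegral_admInd_mul_le t r _).trans
          (lintegral_mono fun y => ?_)
        by_cases hy : Admissible c I U V t r y
        · simp only [E]
          rw [admInd_of_admissible hy, admInd_of_admissible (hy.self hL), hL.lipFlow_cancel]
          apply le_of_eq; ring
        · simp [admInd_of_not_admissible hy]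
    _ ≤ (∫⁻ r, ∫⁻ y, (admInd c I U V r r y *
            ENNReal.ofReal (Real.exp (p * ℓ * ‖Dc r y‖))) ^ (p / (p - n))) ^ (1 / (p / (p - n))) *
          (∫⁻ r, ∫⁻ y, (admInd c I U V t r y *
            ‖fderiv ℝ (lipFlow c t r) y‖ₑ ^ n) ^ (p / n)) ^ (1 / (p / n)) :=
        lintegral_lintegral_mul_le (f := fun z => admInd c I U V z.1 z.1 z.2 *
            ENNReal.ofReal (Real.exp (p * ℓ * ‖Dc z.1 z.2‖)))
          (g := fun z => admInd c I U V t z.1 z.2 * ‖fderiv ℝ (lipFlow c t z.1) z.2‖ₑ ^ n) hPQ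
          ((hma measurable_fst measurable_fst measurable_snd).mul
          (h.measurable_exp _ measurable_fst measurable_snd))
          ((hma measurable_const measurable_fst measurable_snd).mul
          ((hL.measurable_enorm_fderiv measurable_const measurable_fst
            measurable_snd).pow_const n))
    _ = _ := by
        congr 2
        · refine lintegral_congr fun r => lintegral_congr fun y => ?_
          rw [ENNReal.mul_rpow_of_nonneg _ _ hPQ.nonneg, admInd_rpow hPQ.pos, ofReal_exp_rpow]
        · refine lintegral_congr fun r => lintegral_congr fun y => ?_
          rw [ENNReal.mul_rpow_of_nonneg _ _ hPQ.symm.nonneg, admInd_rpow hPQ.symm.pos,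
            ← ENNReal.rpow_natCast, ← ENNReal.rpow_mul]
          congr 2
          field_simp

end FlowEnergy

/-! ### The geometric condition bounds the energy of the mollified field -/

section GeometricBound

local notation "𝔼" n => EuclideanSpace ℝ (Fin n)

variable {n : ℕ}

/-- The points of `Ω` at distance more than `δ` from the boundary. -/
def core (Ω : Set (𝔼 n)) (δ : ℝ) : Set (𝔼 n) := {x ∈ Ω | δ < Metric.infDist x (frontier Ω)}

theorem isOpen_core {Ω : Set (𝔼 n)} (hΩ : IsOpen Ω) (δ : ℝ) : IsOpen (core Ω δ) :=
  hΩ.inter (isOpen_lt continuous_const (Metric.continuous_infDist_pt _))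

/-- A ball around a point of `Ω` is connected, so it cannot leave `Ω` without meeting the boundary. -/
theorem closedBall_subset_of_lt_infDist {Ω : Set (𝔼 n)} (hΩ : IsOpen Ω) {x : 𝔼 n} (hx : x ∈ Ω)
    {ρ : ℝ} (hρ : ρ < Metric.infDist x (frontier Ω)) : Metric.closedBall x ρ ⊆ Ω := by
  intro y hy
  have hρ0 : 0 ≤ ρ := dist_nonneg.trans hy
  refine (convex_closedBall x ρ).isPreconnected.subset_of_closure_inter_subset hΩ
    ⟨x, Metric.mem_closedBall_self hρ0, hx⟩ ?_ hy
  rintro z ⟨hz, hz'⟩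
  by_contra hzΩ
  have h1 := Metric.infDist_le_dist_of_mem (x := x)
    (show z ∈ frontier Ω from ⟨hz, fun h => hzΩ (interior_subset h)⟩)
  rw [Metric.mem_closedBall, dist_comm] at hz'
  linarith

theorem core_closedBall_subset {Ω : Set (𝔼 n)} (hΩ : IsOpen Ω) {δ : ℝ} {x : 𝔼 n} (hx : x ∈ core Ω δ) :
    Metric.closedBall x δ ⊆ Ω := closedBall_subset_of_lt_infDist hΩ hx.1 hx.2

theorem mem_core_of_dist_lt {Ω : Set (𝔼 n)} (hΩ : IsOpen Ω) {δ : ℝ} {x y : 𝔼 n} (hx : x ∈ Ω)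
    (hδ : 0 ≤ δ) (h : dist y x < Metric.infDist x (frontier Ω) - δ) : y ∈ core Ω δ := by
  have h1 := Metric.infDist_le_infDist_add_dist (s := frontier Ω) (x := x) (y := y)
  rw [dist_comm] at h1
  refine ⟨closedBall_subset_of_lt_infDist hΩ hx (ρ := dist y x) (by linarith)
    (Metric.mem_closedBall.2 le_rfl), by linarith⟩

theorem ofReal_min_le_volume_inter {t₀ t₁ q ρ : ℝ} (hq : q ∈ Ioo t₀ t₁) (hρ : 0 < ρ) :
    ENNReal.ofReal (min (t₁ - t₀) ρ) ≤ volume (Ioo t₀ t₁ ∩ Ioo (q - ρ) (q + ρ)) := by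
  rw [Ioo_inter_Ioo, Real.volume_Ioo]
  refine ENNReal.ofReal_le_ofReal ?_
  obtain ⟨h1, h2⟩ := hq
  rcases min_cases t₁ (q + ρ) with h | h <;> rcases max_cases t₀ (q - ρ) with h' | h' <;>
    rcases min_cases (t₁ - t₀) ρ with h'' | h'' <;> linarith

variable {c : ℝ → (𝔼 n) → 𝔼 n} {M L δ : ℝ} {t₀ t₁ : ℝ} {Ω V : Set (𝔼 n)}

/-- At speed at most `M`, a trajectory cannot leave the core before the distance is covered. -/
theorem lifespan_of_mem_ge (h : IsLipField c M L) (hΩ : IsOpen Ω) (hδ : 0 ≤ δ)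
    {r : ℝ} {y : 𝔼 n} (hr : Admissible c (Ioo t₀ t₁) (core Ω δ) V r r y) {ρ : ℝ} (hρ : 0 < ρ)
    (hM : M * ρ ≤ Metric.infDist y (frontier Ω) - δ) :
    ENNReal.ofReal (min (t₁ - t₀) ρ) ≤ lifespan c (Ioo t₀ t₁) (core Ω δ) V r y := by
  refine (ofReal_min_le_volume_inter hr.1 hρ).trans (measure_mono fun t ht => ?_)
  refine ⟨hr.1, ht.1, fun q hq => ?_, hr.2.2.2⟩
  have hy := hr.mem h
  have hqρ : |q - r| < ρ := (abs_sub_left_of_mem_uIcc hq).trans_lt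
    (abs_sub_lt_iff.2 ⟨by linarith [ht.2.2], by linarith [ht.2.1]⟩)
  have h1 := h.norm_lipFlow_time_sub_le q r r y
  rw [h.lipFlow_self] at h1
  by_cases hM0 : M = 0
  · rw [hM0, zero_mul] at h1
    rw [sub_eq_zero.1 (norm_le_zero_iff.1 h1)]
    exact hy
  · have hMp : 0 < M := lt_of_le_of_ne ((norm_nonneg _).trans (h.bound 0 0)) (Ne.symm hM0)
    refine mem_core_of_dist_lt hΩ hy.1 hδ ?_
    rw [dist_eq_norm]
    exact (h1.trans_lt (mul_lt_mul_of_pos_left hqρ hMp)).trans_le hM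

/-- Consider a trajectory that visits points at distance more than `σ` from the boundary and is
followed while the distance is more than `σ²`. Up to a factor that tends to `1` with `σ → 0`, it
lives for every time `m` at most `t₁ - t₀` in which the speed `M` does not cover the distance of a
nearby point `y'` to the boundary. If `y` itself is too close to the boundary, the bound comes from
the visit. -/
theorem ofReal_mul_le_lifespan (h : IsLipField c M L) (hΩ : IsOpen Ω) {σ : ℝ} (hσ : 0 < σ) (hσ1 : σ < 1)
    {r : ℝ} {y y' : 𝔼 n}
    (hr : Admissible c (Ioo t₀ t₁) (core Ω (σ ^ 2)) (core Ω σ) r r y)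
    (hy' : dist y' y ≤ σ ^ 4) {m : ℝ} (hm : m ≤ t₁ - t₀)
    (hM : M * m ≤ Metric.infDist y' (frontier Ω)) (hm0 : 0 < m) :
    ENNReal.ofReal ((1 - σ) / (1 + σ ^ 2) * m) ≤
      lifespan c (Ioo t₀ t₁) (core Ω (σ ^ 2)) (core Ω σ) r y := by
  have hM0 : 0 ≤ M := (norm_nonneg _).trans (h.bound 0 0)
  have hy := hr.mem h
  set d := Metric.infDist y (frontier Ω)
  have hd : σ ^ 2 < d := hy.2
  have hdy' : M * m ≤ (1 + σ ^ 2) * d := by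
    have h1 := Metric.infDist_le_infDist_add_dist (s := frontier Ω) (x := y') (y := y)
    have h2 : σ ^ 4 ≤ σ ^ 2 * d := by nlinarith [sq_nonneg σ]
    linarith
  set ρ := (1 - σ) / (1 + σ ^ 2) * m
  have hρ : 0 < ρ := by have : 0 < 1 - σ := by linarith
                        positivity
  have hMρ : M * ρ ≤ (1 - σ) * d := by
    have h1 : M * ρ = (1 - σ) / (1 + σ ^ 2) * (M * m) := by simp only [ρ]; ring
    rw [h1, div_mul_eq_mul_div, div_le_iff₀ (by positivity)]
    have := mul_le_mul_of_nonneg_left hdy' (show 0 ≤ 1 - σ by linarith)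
    linarith
  have hρm : ρ ≤ t₁ - t₀ := by
    refine le_trans ?_ hm
    refine mul_le_of_le_one_left hm0.le ((div_le_one (by positivity)).2 (by nlinarith [sq_nonneg σ]))
  rw [← min_eq_right hρm]
  -- if `y` is far from the boundary, the trajectory takes the time to lose `d - σ² ≥ (1 - σ) d`;
  -- otherwise it does so starting from a point at distance more than `σ ≥ d`, which it visits
  rcases le_total σ d with hσd | hσd
  · exact lifespan_of_mem_ge h hΩ (sq_nonneg σ) hr hρ (hMρ.trans (by nlinarith))
  · obtain ⟨q, hq, hq1, hq2⟩ := hr.2.2.2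
    have hqa : Admissible c (Ioo t₀ t₁) (core Ω (σ ^ 2)) (core Ω σ) q r y :=
      ⟨hr.1, hq, hq1, hr.2.2.2⟩
    rw [hqa.lifespan_eq h]
    refine lifespan_of_mem_ge h hΩ (sq_nonneg σ) (hqa.symm h |>.self h) hρ ?_
    have h3 : σ < Metric.infDist (lipFlow c q r y) (frontier Ω) := hq2.2
    nlinarith [mul_le_mul_of_nonneg_left hσd (show 0 ≤ 1 - σ by linarith)]

theorem ENNReal.rpow_anti_of_nonpos {a b : ℝ≥0∞} {z : ℝ} (hz : z ≤ 0) (h : a ≤ b) :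
    b ^ z ≤ a ^ z := by
  rw [← neg_neg z, ENNReal.rpow_neg b, ENNReal.rpow_neg a]
  exact ENNReal.inv_le_inv.2 (ENNReal.rpow_le_rpow h (neg_nonneg.2 hz))

/-- The geometric weight, as a function of the point; `α` stands for `n / (n - p)`. The quotient
is that of extended nonnegative reals, with `M ^ α = ∞` if `M = 0`, since `α < 0`. -/
noncomputable def geometricWeight (Ω : Set (𝔼 n)) (ℓ : ℝ) (M : ℝ≥0∞) (α : ℝ) (x : 𝔼 n) : ℝ≥0∞ :=
  max (ENNReal.ofReal ℓ ^ α) (Metric.infEDist x (frontier Ω) ^ α / M ^ α)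

theorem measurable_geometricWeight (Ω : Set (𝔼 n)) (ℓ : ℝ) (M : ℝ≥0∞) (α : ℝ) :
    Measurable (geometricWeight Ω ℓ M α) :=
  measurable_const.max ((measurable_infEDist.pow_const α).div_const _)

/-- The exponent `α` is negative: a lower bound of the lifespan is an upper bound of the weight. -/
theorem lifespan_rpow_le (h : IsLipField c M L) (hΩ : IsOpen Ω) {σ : ℝ} (hσ : 0 < σ) (hσ1 : σ < 1)
    (ht : t₀ < t₁) {α : ℝ} (hα : α < 0) {r : ℝ} {y y' : 𝔼 n}
    (hr : Admissible c (Ioo t₀ t₁) (core Ω (σ ^ 2)) (core Ω σ) r r y)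
    (hy' : dist y' y ≤ σ ^ 4) :
    lifespan c (Ioo t₀ t₁) (core Ω (σ ^ 2)) (core Ω σ) r y ^ α ≤
      ENNReal.ofReal ((1 - σ) / (1 + σ ^ 2)) ^ α *
        geometricWeight Ω (t₁ - t₀) (ENNReal.ofReal M) α y' := by
  have hM0 : 0 ≤ M := (norm_nonneg _).trans (h.bound 0 0)
  have hy := hr.mem h
  set d' := Metric.infDist y' (frontier Ω)
  have hθ : 0 < (1 - σ) / (1 + σ ^ 2) := by
    have : 0 < 1 - σ := by linarith
    positivity
  have hd' : 0 < d' := by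
    have h1 := Metric.infDist_le_infDist_add_dist (s := frontier Ω) (x := y) (y := y')
    rw [dist_comm] at h1
    have h2 : σ ^ 4 < σ ^ 2 := pow_lt_pow_right_of_lt_one₀ hσ hσ1 (by norm_num)
    have h3 : σ ^ 2 < Metric.infDist y (frontier Ω) := hy.2
    linarith
  have key : ∀ m : ℝ, m ≤ t₁ - t₀ → M * m ≤ d' → 0 < m →
      lifespan c (Ioo t₀ t₁) (core Ω (σ ^ 2)) (core Ω σ) r y ^ α ≤
      ENNReal.ofReal ((1 - σ) / (1 + σ ^ 2)) ^ α * ENNReal.ofReal m ^ α := by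
    intro m h1 h2 h3
    have := ENNReal.rpow_anti_of_nonpos hα.le
      (ofReal_mul_le_lifespan h hΩ hσ hσ1 hr hy' h1 h2 h3)
    rwa [ENNReal.ofReal_mul hθ.le, ENNReal.mul_rpow_of_ne_top ENNReal.ofReal_ne_top
      ENNReal.ofReal_ne_top] at this
  -- the two cases correspond to the two terms of the maximum; if `M = 0` the first one applies
  rcases le_or_gt (M * (t₁ - t₀)) d' with hc | hc
  · exact (key _ le_rfl hc (sub_pos.2 ht)).trans (mul_le_mul_right (le_max_left _ _) _)
  · have hMp : 0 < M := by
      rcases hM0.eq_or_lt with h0 | h0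
      · rw [← h0, zero_mul] at hc; linarith
      · exact h0
    refine (key (d' / M) ?_ ?_ (div_pos hd' hMp)).trans
      (mul_le_mul_right (le_trans (le_of_eq ?_) (le_max_right _ _)) _)
    · rw [div_le_iff₀ hMp]; linarith
    · rw [mul_div_cancel₀ _ hMp.ne']
    · have hne : Metric.infEDist y' (frontier Ω) ≠ ⊤ := by
        intro h'
        simp [d', Metric.infDist, h'] at hd'
      have e : ENNReal.ofReal d' = Metric.infEDist y' (frontier Ω) := ENNReal.ofReal_toReal hne
      rw [ENNReal.ofReal_div_of_pos hMp, e, div_eq_mul_inv, ENNReal.mul_rpow_of_ne_top hne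
        (by simpa using hMp), ENNReal.inv_rpow, ← div_eq_mul_inv]

variable {β : ℝ → (𝔼 n) → 𝔼 n} {B : ℝ → (𝔼 n) → (𝔼 n) →L[ℝ] 𝔼 n} {R a : ℝ} {F : ℝ → ℝ}

/-- Averaging over small translations does not increase the integral. -/
theorem lintegral_moll_translate_le (Ω : Set (𝔼 n)) (hΩ : MeasurableSet Ω) {G : (𝔼 n) → ℝ≥0∞}
    (hG : Measurable G) (ε : ℝ) {S : Set (𝔼 n)}
    (hS : ∀ y ∈ S, ∀ z, ‖z‖ ≤ 1 → y + ε • z ∈ Ω) :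
    ∫⁻ y, S.indicator (fun y => ∫⁻ z, G (y + ε • z) ∂(mollMeasure n)) y ≤ ∫⁻ y in Ω, G y := by
  have hGi : Measurable (Ω.indicator G) := hG.indicator hΩ
  calc ∫⁻ y, S.indicator (fun y => ∫⁻ z, G (y + ε • z) ∂(mollMeasure n)) y
      ≤ ∫⁻ y, (∫⁻ z, Ω.indicator G (y + ε • z) ∂(mollMeasure n)) := by
        refine lintegral_mono fun y => ?_
        by_cases hy : y ∈ S
        · rw [indicator_of_mem hy]
          refine lintegral_mono_ae ?_
          filter_upwards [ae_mollMeasure_norm_le] with z hz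
          rw [indicator_of_mem (hS y hy z hz)]
        · rw [indicator_of_notMem hy]; exact zero_le
    _ = ∫⁻ z, (∫⁻ y, Ω.indicator G (y + ε • z)) ∂(mollMeasure n) := by
        refine lintegral_lintegral_swap (Measurable.aemeasurable ?_)
        exact hGi.comp (f := fun w : (𝔼 n) × 𝔼 n => w.1 + ε • w.2) (by fun_prop)
    _ = ∫⁻ _z, (∫⁻ y, Ω.indicator G y) ∂(mollMeasure n) := by
        refine lintegral_congr fun z => lintegral_add_right_eq_self (μ := volume) _ _
    _ = ∫⁻ y in Ω, G y := by
        rw [lintegral_const, measure_univ, mul_one, lintegral_indicator hΩ]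

namespace ExpSobolevField

theorem exists_isTaylorField (h : ExpSobolevField t₀ t₁ Ω β B M R a F) {η : ℝ} (hη : 0 < η) :
    ∃ L K, IsTaylorField (mollField β η) (fun t => mollDeriv η (β t)) M L K := by
  obtain ⟨L, K, h1, h2, h3⟩ := h.exists_isLipField hη
  exact ⟨L, K, h1, measurable_mollDeriv h.meas η, h2, h3⟩

/-- Weighted exponential integrals of the differential of the mollified field are controlled by
those of the field, by Jensen's inequality. -/
theorem lintegral_admInd_mul_exp_le (h : ExpSobolevField t₀ t₁ Ω β B M R a F) {σ : ℝ}
    (hσ : 0 < σ) (hσ1 : σ < 1) {I : Set ℝ} (hI : I = Ioo t₀ t₁) {u : ℝ → (𝔼 n) → ℝ≥0∞}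
    {w : (𝔼 n) → ℝ≥0∞} (hw : Measurable w)
    (hu : ∀ r y, Admissible (mollField β (σ ^ 4)) I (core Ω (σ ^ 2)) V r r y → ∀ y',
      dist y' y ≤ σ ^ 4 → u r y ≤ w y') :
    ∫⁻ r, ∫⁻ y, admInd (mollField β (σ ^ 4)) I (core Ω (σ ^ 2)) V r r y *
      u r y * ENNReal.ofReal (Real.exp (a * ‖mollDeriv (σ ^ 4) (β r) y‖)) ≤
    ∫⁻ r in I, ∫⁻ y in Ω, w y * ENNReal.ofReal (Real.exp (a * ‖B r y‖)) := by
  have hσ4 : 0 < σ ^ 4 := by positivity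
  obtain ⟨L, K, hT⟩ := h.exists_isTaylorField hσ4
  have hL := hT.toIsLipField
  have hIm : MeasurableSet I := hI ▸ measurableSet_Ioo
  rw [← lintegral_indicator hIm]
  refine lintegral_mono_ae ?_
  filter_upwards [h.ae] with r hr
  by_cases hrI : r ∈ I
  swap
  · have : ∀ y, ¬ Admissible (mollField β (σ ^ 4)) I (core Ω (σ ^ 2)) V r r y :=
      fun y hy => hrI hy.1
    simp [admInd_of_not_admissible (this _)]
  rw [indicator_of_mem hrI]
  have hE := hr (Ioo_subset_Icc_self (hI ▸ hrI))
  have hball : ∀ y ∈ core Ω (σ ^ 2), Metric.closedBall y (σ ^ 4) ⊆ Ω := fun y hy =>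
    (Metric.closedBall_subset_closedBall
      (pow_le_pow_of_le_one hσ.le hσ1.le (by norm_num))).trans (core_closedBall_subset h.isOpen hy)
  have hzb : ∀ (y z : 𝔼 n), ‖z‖ ≤ 1 → dist (y + σ ^ 4 • z) y ≤ σ ^ 4 := by
    intro y z hz
    rw [dist_eq_norm, add_sub_cancel_left, norm_smul, Real.norm_of_nonneg hσ4.le]
    exact mul_le_of_le_one_right hσ4.le hz
  refine le_trans (lintegral_mono fun y => ?_)
    (lintegral_moll_translate_le Ω h.isOpen.measurableSet (hw.mul (hE.measurable_exp a)) (σ ^ 4)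
      (S := {y | Admissible (mollField β (σ ^ 4)) I (core Ω (σ ^ 2)) V r r y})
      fun y hy z hz => hball y (hy.mem hL) (hzb y z hz))
  by_cases hy : Admissible (mollField β (σ ^ 4)) I (core Ω (σ ^ 2)) V r r y
  · rw [admInd_of_admissible hy, one_mul, indicator_of_mem
      (show y ∈ {y | Admissible (mollField β (σ ^ 4)) I (core Ω (σ ^ 2)) V r r y} from hy)]
    refine (mul_le_mul_right (hE.exp_norm_mollDeriv_le h.pos.le hσ4 (hball y (hy.mem hL))) _).trans
      ?_
    have hm : Measurable fun z : 𝔼 n =>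
        ENNReal.ofReal (Real.exp (a * ‖B r (y + σ ^ 4 • z)‖)) :=
      (hE.measurable_exp a).comp (f := fun z : 𝔼 n => y + σ ^ 4 • z) (by fun_prop)
    rw [← lintegral_const_mul _ hm]
    refine lintegral_mono_ae ?_
    filter_upwards [ae_mollMeasure_norm_le] with z hz
    exact mul_le_mul_left (hu r y hy _ (hzb y z hz)) _
  · rw [admInd_of_not_admissible hy, zero_mul, zero_mul]
    exact zero_le

end ExpSobolevField

end GeometricBound

/-! ### Strong limits of convex combinations -/

section ConvexCombinations

/-- The weights of the convex combinations of the terms of index at least `m`. -/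
def tailWeights (m : ℕ) : Set (ℕ →₀ ℝ) :=
  {c | (∀ k, 0 ≤ c k) ∧ Finsupp.linearCombination ℝ (fun _ : ℕ => (1 : ℝ)) c = 1 ∧
    ∀ k < m, c k = 0}

theorem convex_tailWeights (m : ℕ) : Convex ℝ (tailWeights m) := by
  rintro c ⟨h1, h2, h3⟩ c' ⟨h1', h2', h3'⟩ a b ha hb hab
  refine ⟨fun k => ?_, ?_, fun k hk => ?_⟩
  · exact add_nonneg (mul_nonneg ha (h1 k)) (mul_nonneg hb (h1' k))
  · rw [map_add, map_smul, map_smul, h2, h2', smul_eq_mul, smul_eq_mul, mul_one, mul_one, hab]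
  · simp [h3 k hk, h3' k hk]

theorem single_mem_tailWeights (m : ℕ) : Finsupp.single m (1 : ℝ) ∈ tailWeights m := by
  refine ⟨fun k => ?_, by simp, fun k hk => ?_⟩
  · rw [Finsupp.single_apply]; split_ifs <;> norm_num
  · exact Finsupp.single_eq_of_ne hk.ne

theorem tailWeights_anti {m l : ℕ} (h : m ≤ l) : tailWeights l ⊆ tailWeights m :=
  fun _ hc => ⟨hc.1, hc.2.1, fun k hk => hc.2.2 k (hk.trans_le h)⟩

theorem linearCombination_mem_of_convex {E : Type*} [AddCommGroup E] [Module ℝ E] {S : Set E}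
    (hS : Convex ℝ S) {u : ℕ → E} {m : ℕ} (hu : ∀ k, m ≤ k → u k ∈ S) {c : ℕ →₀ ℝ}
    (hc : c ∈ tailWeights m) : Finsupp.linearCombination ℝ u c ∈ S := by
  rw [Finsupp.linearCombination_apply, Finsupp.sum]
  refine hS.sum_mem (fun k _ => hc.1 k) ?_ fun k hk => hu k ?_
  · have := hc.2.1
    rw [Finsupp.linearCombination_apply, Finsupp.sum] at this
    simpa using this
  · by_contra hkm
    exact (Finsupp.mem_support_iff.1 hk) (hc.2.2 k (not_le.1 hkm))

/-- In a Hilbert space, suitable convex combinations of the tails of a bounded sequence converge: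
elements of almost minimal norm in the convex hulls of the tails form a Cauchy sequence, by the
parallelogram law. -/
theorem exists_tendsto_linearCombination {H : Type*} [NormedAddCommGroup H] [InnerProductSpace ℝ H]
    [CompleteSpace H] {u : ℕ → H} {R : ℝ} (hu : ∀ k, ‖u k‖ ≤ R) :
    ∃ c : ℕ → ℕ →₀ ℝ, (∀ m, c m ∈ tailWeights m) ∧
      ∃ v, Tendsto (fun m => Finsupp.linearCombination ℝ u (c m)) atTop (𝓝 v) := by
  have hR : 0 ≤ R := (norm_nonneg _).trans (hu 0)
  set N : (ℕ →₀ ℝ) → ℝ := fun c => ‖Finsupp.linearCombination ℝ u c‖ ^ 2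
  set e : ℕ → ℝ := fun m => sInf (N '' tailWeights m)
  have hbdd : ∀ m, BddBelow (N '' tailWeights m) := fun m =>
    ⟨0, by rintro _ ⟨c, -, rfl⟩; exact sq_nonneg _⟩
  have hne : ∀ m, (N '' tailWeights m).Nonempty := fun m =>
    ⟨_, mem_image_of_mem N (single_mem_tailWeights m)⟩
  have he : Monotone e := fun m l hml =>
    csInf_le_csInf (hbdd m) (hne l) (image_mono (tailWeights_anti hml))
  have heR : ∀ m, e m ≤ R ^ 2 := fun m => by
    refine (csInf_le (hbdd m) (mem_image_of_mem N (single_mem_tailWeights m))).trans ?_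
    simp only [N, Finsupp.linearCombination_single, one_smul]
    exact pow_le_pow_left₀ (norm_nonneg _) (hu m) 2
  have hbe : BddAbove (range e) := ⟨R ^ 2, by rintro _ ⟨m, rfl⟩; exact heR m⟩
  have hlim := tendsto_atTop_ciSup he hbe
  set S := ⨆ m, e m
  have hch : ∀ m : ℕ, ∃ c ∈ tailWeights m, N c < e m + 1 / (m + 1 : ℝ) := by
    intro m
    obtain ⟨_, ⟨c, hc, rfl⟩, h⟩ := exists_lt_of_csInf_lt (hne m)
      (show e m < e m + 1 / (m + 1 : ℝ) by have : (0:ℝ) < 1 / (m + 1 : ℝ) := by positivity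
                                           linarith)
    exact ⟨c, hc, h⟩
  choose c hc hcN using hch
  refine ⟨c, hc, ?_⟩
  set w : ℕ → H := fun m => Finsupp.linearCombination ℝ u (c m)
  set b : ℕ → ℝ := fun m => Real.sqrt (2 * (S - e m) + 4 * (1 / (m + 1 : ℝ)))
  have hdist : ∀ m l, m ≤ l → dist (w m) (w l) ≤ b m := by
    intro m l hml
    have h1 : e m ≤ ‖(2⁻¹ : ℝ) • w m + (2⁻¹ : ℝ) • w l‖ ^ 2 := by
      refine csInf_le (hbdd m) ⟨(2⁻¹ : ℝ) • c m + (2⁻¹ : ℝ) • c l, convex_tailWeights m (hc m)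
        (tailWeights_anti hml (hc l)) (by norm_num) (by norm_num) (by norm_num), ?_⟩
      simp only [N, w, map_add, map_smul]
    rw [← smul_add, norm_smul, mul_pow, Real.norm_of_nonneg (by norm_num : (0:ℝ) ≤ 2⁻¹)] at h1
    have h2 := parallelogram_law_with_norm ℝ (w m) (w l)
    have h3 : ‖w m‖ ^ 2 < e m + 1 / (m + 1 : ℝ) := hcN m
    have h4 : ‖w l‖ ^ 2 < e l + 1 / (l + 1 : ℝ) := hcN l
    have h5 : e l ≤ S := le_ciSup hbe l
    have h6 : 1 / (l + 1 : ℝ) ≤ 1 / (m + 1 : ℝ) := by gcongr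
    rw [dist_eq_norm]
    refine Real.le_sqrt_of_sq_le ?_
    nlinarith
  refine cauchySeq_tendsto_of_complete (cauchySeq_of_le_tendsto_0' b hdist ?_)
  have h1 : Tendsto (fun m => 2 * (S - e m) + 4 * (1 / (m + 1 : ℝ))) atTop (𝓝 0) := by
    have := ((tendsto_const_nhds (x := S)).sub hlim).const_mul 2 |>.add
      ((tendsto_one_div_add_atTop_nhds_zero_nat (𝕜 := ℝ)).const_mul 4)
    simpa using this
  have h2 := (Real.continuous_sqrt.tendsto 0).comp h1
  rwa [Real.sqrt_zero] at h2

theorem tendsto_linearCombination {E : Type*} [NormedAddCommGroup E] [NormedSpace ℝ E]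
    {u : ℕ → E} {a : E} (hu : Tendsto u atTop (𝓝 a)) {c : ℕ → ℕ →₀ ℝ}
    (hc : ∀ m, c m ∈ tailWeights m) :
    Tendsto (fun m => Finsupp.linearCombination ℝ u (c m)) atTop (𝓝 a) := by
  rw [Metric.tendsto_atTop] at hu ⊢
  intro ε hε
  obtain ⟨N, hN⟩ := hu (ε / 2) (by positivity)
  refine ⟨N, fun m hm => ?_⟩
  have := linearCombination_mem_of_convex (convex_closedBall a (ε / 2))
    (fun k hk => (hN k (hm.trans hk)).le) (hc m)
  exact (Metric.mem_closedBall.1 this).trans_lt (by linarith)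

theorem coeFn_linearCombination_toLp {α E : Type*} [MeasurableSpace α] {μ : Measure α}
    [NormedAddCommGroup E] [NormedSpace ℝ E] {p : ℝ≥0∞} {G : ℕ → α → E}
    (hG : ∀ k, MemLp (G k) p μ) (c : ℕ →₀ ℝ) :
    Finsupp.linearCombination ℝ (fun k => (hG k).toLp (G k)) c =ᵐ[μ]
      Finsupp.linearCombination ℝ G c := by
  induction c using Finsupp.induction_linear with
  | zero => simpa using Lp.coeFn_zero E p μ
  | add c c' h h' =>
    rw [map_add, map_add]
    exact (Lp.coeFn_add _ _).trans (h.add h')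
  | single k a =>
    rw [Finsupp.linearCombination_single, Finsupp.linearCombination_single]
    exact (Lp.coeFn_smul _ _).trans ((hG k).coeFn_toLp.const_smul a)

theorem linearCombination_apply_fun {α E : Type*} [AddCommGroup E] [Module ℝ E]
    (G : ℕ → α → E) (c : ℕ →₀ ℝ) (z : α) :
    Finsupp.linearCombination ℝ G c z = Finsupp.linearCombination ℝ (fun k => G k z) c := by
  simp [Finsupp.linearCombination_apply, Finsupp.sum]

theorem aestronglyMeasurable_linearCombination {α E : Type*} [MeasurableSpace α] {μ : Measure α}
    [NormedAddCommGroup E] [NormedSpace ℝ E] {G : ℕ → α → E}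
    (hG : ∀ k, AEStronglyMeasurable (G k) μ) (c : ℕ →₀ ℝ) :
    AEStronglyMeasurable (Finsupp.linearCombination ℝ G c) μ := by
  induction c using Finsupp.induction_linear with
  | zero => rw [map_zero]; exact aestronglyMeasurable_zero
  | add c c' h h' => rw [map_add]; exact h.add h'
  | single k a => rw [Finsupp.linearCombination_single]; exact (hG k).const_smul a

end ConvexCombinations

/-! ### Weak limits in almost every slice -/

section WeakLimit

set_option linter.unusedSectionVars false

variable {α X : Type*} [MeasurableSpace α] [MeasurableSpace X] {μ : Measure α} {ν : Measure X}
  [IsFiniteMeasure μ] [IsFiniteMeasure ν]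
  {F : Type*} [NormedAddCommGroup F] [NormedSpace ℝ F] [FiniteDimensional ℝ F]

/-- A sequence which is bounded in `L²` has convex combinations that converge in `L¹`. -/
theorem exists_linearCombination_tendsto_eLpNorm_one {κ : Measure α} [IsFiniteMeasure κ]
    {D : ℕ → α → F} (hD : ∀ k, MemLp (D k) 2 κ) {R : ℝ≥0∞} (hR : R ≠ ⊤)
    (hDR : ∀ k, eLpNorm (D k) 2 κ ≤ R) :
    ∃ c : ℕ → ℕ →₀ ℝ, (∀ m, c m ∈ tailWeights m) ∧ ∃ D' : α → F, StronglyMeasurable D' ∧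
      Tendsto (fun m => eLpNorm (Finsupp.linearCombination ℝ D (c m) - D') 1 κ) atTop (𝓝 0) := by
  set e : F ≃L[ℝ] EuclideanSpace ℝ (Fin (Module.finrank ℝ F)) := toEuclidean
  have hG : ∀ k, MemLp (fun a => e (D k a)) 2 κ := fun k =>
    ContinuousLinearMap.comp_memLp'
      (e : F →L[ℝ] EuclideanSpace ℝ (Fin (Module.finrank ℝ F))) (hD k)
  have hbd : ∀ k, ‖(hG k).toLp _‖ ≤ ‖(e : F →L[ℝ] EuclideanSpace ℝ (Fin (Module.finrank ℝ F)))‖ *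
      R.toReal := by
    intro k
    rw [Lp.norm_toLp]
    have h1 : eLpNorm (fun a => e (D k a)) 2 κ ≤ ENNReal.ofReal
        ‖(e : F →L[ℝ] EuclideanSpace ℝ (Fin (Module.finrank ℝ F)))‖ * eLpNorm (D k) 2 κ :=
      eLpNorm_le_mul_eLpNorm_of_ae_le_mul (Eventually.of_forall fun a =>
        (e : F →L[ℝ] EuclideanSpace ℝ (Fin (Module.finrank ℝ F))).le_opNorm _) 2
    have h2 := ENNReal.toReal_mono (ENNReal.mul_ne_top ENNReal.ofReal_ne_top hR)
      (h1.trans (mul_le_mul_right (hDR k) _))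
    rwa [ENNReal.toReal_mul, ENNReal.toReal_ofReal (norm_nonneg _)] at h2
  obtain ⟨c, hc, v, hv⟩ := exists_tendsto_linearCombination hbd
  set D' : α → F := fun a => e.symm (v a)
  have hD'm : StronglyMeasurable D' := e.symm.continuous.comp_stronglyMeasurable (Lp.stronglyMeasurable v)
  refine ⟨c, hc, D', hD'm, ?_⟩
  have h0 := (Lp.tendsto_Lp_iff_tendsto_eLpNorm' _ _).1 hv
  have h1 : ∀ m, eLpNorm (Finsupp.linearCombination ℝ D (c m) - D') 1 κ ≤
      ENNReal.ofReal ‖(e.symm : EuclideanSpace ℝ (Fin (Module.finrank ℝ F)) →L[ℝ] F)‖ *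
      eLpNorm (⇑(Finsupp.linearCombination ℝ (fun k => (hG k).toLp _) (c m)) - ⇑v) 2 κ *
        κ univ ^ (1 / (1 : ℝ≥0∞).toReal - 1 / (2 : ℝ≥0∞).toReal) := by
    intro m
    have hm : AEStronglyMeasurable (Finsupp.linearCombination ℝ D (c m) - D') κ := by
      refine AEStronglyMeasurable.sub ?_ hD'm.aestronglyMeasurable
      exact aestronglyMeasurable_linearCombination (fun k => (hD k).1) (c m)
    refine (eLpNorm_le_eLpNorm_mul_rpow_measure_univ one_le_two hm).trans
      (mul_le_mul_left ?_ _)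
    refine eLpNorm_le_mul_eLpNorm_of_ae_le_mul ?_ 2
    filter_upwards [coeFn_linearCombination_toLp hG (c m)] with a ha
    have : (Finsupp.linearCombination ℝ D (c m) - D') a =
        (e.symm : EuclideanSpace ℝ (Fin (Module.finrank ℝ F)) →L[ℝ] F)
          ((⇑(Finsupp.linearCombination ℝ (fun k => (hG k).toLp _) (c m)) - ⇑v) a) := by
      rw [Pi.sub_apply, Pi.sub_apply, ha, map_sub, linearCombination_apply_fun,
        linearCombination_apply_fun]
      congr 1
      simp [Finsupp.linearCombination_apply, Finsupp.sum, map_sum]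
    rw [this]
    exact ContinuousLinearMap.le_opNorm _ _
  refine tendsto_of_tendsto_of_tendsto_of_le_of_le tendsto_const_nhds ?_ (fun _ => zero_le) h1
  have h2 := ENNReal.Tendsto.mul_const (ENNReal.Tendsto.const_mul (a := ENNReal.ofReal
    ‖(e.symm : EuclideanSpace ℝ (Fin (Module.finrank ℝ F)) →L[ℝ] F)‖) h0
    (Or.inr ENNReal.ofReal_ne_top)) (b := κ univ ^ (1 / (1 : ℝ≥0∞).toReal - 1 / (2 : ℝ≥0∞).toReal))
    (Or.inr (ENNReal.rpow_ne_top_of_nonneg (by norm_num) (measure_ne_top κ univ)))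
  simpa using h2

/-- From convergence in `L¹` of a product to convergence in `L¹` of almost every slice, and almost
everywhere, along a subsequence. -/
theorem exists_seq_tendsto_slices {f : ℕ → α × X → F} {g : α × X → F}
    (hf : ∀ m, StronglyMeasurable (f m)) (hg : StronglyMeasurable g)
    (h : Tendsto (fun m => eLpNorm (f m - g) 1 (μ.prod ν)) atTop (𝓝 0)) :
    ∃ φ : ℕ → ℕ, StrictMono φ ∧
      (∀ᵐ z ∂(μ.prod ν), Tendsto (fun j => f (φ j) z) atTop (𝓝 (g z))) ∧
      ∀ᵐ s ∂μ, Tendsto (fun j => ∫⁻ x, ‖f (φ j) (s, x) - g (s, x)‖ₑ ∂ν) atTop (𝓝 0) := by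
  have hε : ∀ j : ℕ, ∀ᶠ m in atTop, eLpNorm (f m - g) 1 (μ.prod ν) < (2⁻¹ : ℝ≥0∞) ^ j := fun j =>
    h.eventually_lt_const (ENNReal.pow_pos (by simp) j)
  obtain ⟨φ, hφ, hφlt⟩ := extraction_forall_of_eventually hε
  have hm : ∀ j, Measurable fun z => ‖f (φ j) z - g z‖ₑ := fun j =>
    ((hf (φ j)).sub hg).enorm
  have hsum : ∑' j, ∫⁻ z, ‖f (φ j) z - g z‖ₑ ∂(μ.prod ν) ≠ ⊤ := by
    refine ne_top_of_le_ne_top (b := ∑' j : ℕ, (2⁻¹ : ℝ≥0∞) ^ j) ?_ (ENNReal.tsum_le_tsum fun j => ?_)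
    · rw [ENNReal.tsum_geometric, ENNReal.one_sub_inv_two, inv_inv]
      exact ENNReal.ofNat_ne_top
    · have := (hφlt j).le
      rwa [eLpNorm_one_eq_lintegral_enorm] at this
  refine ⟨φ, hφ, ?_, ?_⟩
  · rw [← lintegral_tsum fun j => (hm j).aemeasurable] at hsum
    filter_upwards [ae_lt_top (Measurable.tsum hm) hsum] with z hz
    have := ENNReal.tendsto_atTop_zero_of_tsum_ne_top hz.ne
    rw [tendsto_iff_edist_tendsto_0]
    simpa only [edist_eq_enorm_sub] using this
  · have e : ∀ j, ∫⁻ z, ‖f (φ j) z - g z‖ₑ ∂(μ.prod ν) =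
        ∫⁻ s, ∫⁻ x, ‖f (φ j) (s, x) - g (s, x)‖ₑ ∂ν ∂μ := fun j =>
      lintegral_prod _ (hm j).aemeasurable
    simp only [e] at hsum
    rw [← lintegral_tsum fun j => (hm j).lintegral_prod_right'.aemeasurable] at hsum
    filter_upwards [ae_lt_top (Measurable.tsum fun j => (hm j).lintegral_prod_right') hsum]
      with s hs
    exact ENNReal.tendsto_atTop_zero_of_tsum_ne_top hs.ne

theorem integral_smul_linearCombination {E : Type*} [NormedAddCommGroup E] [NormedSpace ℝ E]
    (A : F →L[ℝ] E) (φ : X → ℝ) {G : ℕ → X → F} (c : ℕ →₀ ℝ)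
    (hG : ∀ k, Integrable (fun x => φ x • A (G k x)) ν) :
    ∫ x, φ x • A (Finsupp.linearCombination ℝ (fun k => G k x) c) ∂ν =
      Finsupp.linearCombination ℝ (fun k => ∫ x, φ x • A (G k x) ∂ν) c := by
  simp only [Finsupp.linearCombination_apply, Finsupp.sum, map_sum, map_smul, Finset.smul_sum]
  rw [integral_finsetSum]
  · refine Finset.sum_congr rfl fun k _ => ?_
    rw [← integral_smul]
    refine integral_congr_ae (Eventually.of_forall fun x => ?_)
    exact smul_comm _ _ _
  · intro k _
    refine ((hG k).smul (c k)).congr (Eventually.of_forall fun x => ?_)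
    exact (smul_comm _ _ _)

theorem Integrable.bdd_smul_clm {E : Type*} [NormedAddCommGroup E] [NormedSpace ℝ E]
    (A : F →L[ℝ] E) {φ : X → ℝ} (hφ : Measurable φ) {K : ℝ} (hK : ∀ x, |φ x| ≤ K) {g : X → F}
    (hg : Integrable g ν) : Integrable (fun x => φ x • A (g x)) ν :=
  (A.integrable_comp hg).bdd_smul K hφ.aestronglyMeasurable (Eventually.of_forall hK)

/-- Weak limits of a sequence with bounded `p`-energy, in the slices of a product. Whenever the
pairing of the slices of the terms with a test function converges, the limit is the pairing with
the slice of the weak limit. -/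
theorem exists_slicewise_weakLimit {p : ℝ} (hp : 2 ≤ p) {D : ℕ → α × X → F}
    (hDm : ∀ k, StronglyMeasurable (D k)) (hDb : ∀ k, ∃ K, ∀ z, ‖D k z‖ ≤ K) {C : ℝ≥0∞}
    (hC : C ≠ ⊤) (hDC : ∀ C' > C, ∀ᶠ k in atTop, ∫⁻ z, ‖D k z‖ₑ ^ p ∂(μ.prod ν) ≤ C') :
    ∃ D' : α × X → F, StronglyMeasurable D' ∧ ∫⁻ z, ‖D' z‖ₑ ^ p ∂(μ.prod ν) ≤ C ∧
      ∀ᵐ s ∂μ, Integrable (fun x => D' (s, x)) ν ∧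
        ∀ {E : Type} [NormedAddCommGroup E] [NormedSpace ℝ E] (A : F →L[ℝ] E) (φ : X → ℝ),
          Measurable φ → (∃ K, ∀ x, |φ x| ≤ K) → ∀ T,
          Tendsto (fun k => ∫ x, φ x • A (D k (s, x)) ∂ν) atTop (𝓝 T) →
          ∫ x, φ x • A (D' (s, x)) ∂ν = T := by
  have hp0 : 0 < p := by linarith
  have hpe : ENNReal.ofReal p ≠ 0 := by simpa using hp0
  have hnorm : ∀ f : α × X → F, eLpNorm f (ENNReal.ofReal p) (μ.prod ν) =
      (∫⁻ z, ‖f z‖ₑ ^ p ∂(μ.prod ν)) ^ (1 / p) := fun f => by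
    rw [eLpNorm_eq_lintegral_rpow_enorm_toReal hpe ENNReal.ofReal_ne_top,
      ENNReal.toReal_ofReal hp0.le]
  -- dropping the first `k₀` terms makes the energies uniformly bounded
  obtain ⟨k₀, hk₀⟩ := eventually_atTop.1 (hDC (C + 1) (ENNReal.lt_add_right hC one_ne_zero))
  set G : ℕ → α × X → F := fun k => D (k + k₀)
  have hGm : ∀ k, StronglyMeasurable (G k) := fun k => hDm _
  have hG2 : ∀ k, MemLp (G k) 2 (μ.prod ν) := fun k => by
    obtain ⟨K, hK⟩ := hDb (k + k₀)
    exact MemLp.of_bound (hGm k).aestronglyMeasurable K (Eventually.of_forall hK)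
  obtain ⟨c, hc, D', hD', hlim⟩ := exists_linearCombination_tendsto_eLpNorm_one hG2
    (R := (C + 1) ^ (1 / p) * (μ.prod ν) univ ^
      (1 / (2 : ℝ≥0∞).toReal - 1 / (ENNReal.ofReal p).toReal)) (by
      refine ENNReal.mul_ne_top (ENNReal.rpow_ne_top_of_nonneg (by positivity) (by simp [hC]))
        (ENNReal.rpow_ne_top_of_nonneg ?_ (measure_ne_top _ _))
      rw [ENNReal.toReal_ofReal hp0.le, ENNReal.toReal_ofNat]
      exact sub_nonneg.2 (one_div_le_one_div_of_le two_pos hp)) (fun k => by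
      refine (eLpNorm_le_eLpNorm_mul_rpow_measure_univ (q := ENNReal.ofReal p) ?_
        (hGm k).aestronglyMeasurable).trans (mul_le_mul_left ?_ _)
      · rw [← ENNReal.ofReal_ofNat]; exact ENNReal.ofReal_le_ofReal hp
      · rw [hnorm]
        exact ENNReal.rpow_le_rpow (hk₀ _ (by omega)) (by positivity))
  have hWm : ∀ m, StronglyMeasurable (Finsupp.linearCombination ℝ G (c m)) := fun m =>
    linearCombination_mem_of_convex (S := {f | StronglyMeasurable f}) (m := m)
      (fun f hf g hg a b _ _ _ => show StronglyMeasurable (a • f + b • g) from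
        (hf.const_smul a).add (hg.const_smul b))
      (fun k _ => hGm k) (hc m)
  obtain ⟨φ, hφ, hae, hslice⟩ := exists_seq_tendsto_slices hWm hD' hlim
  refine ⟨D', hD', ?_, ?_⟩
  · refine le_of_forall_gt_imp_ge_of_dense fun C' hC' => ?_
    obtain ⟨k₁, hk₁⟩ := eventually_atTop.1 (hDC C' hC')
    have h1 : eLpNorm D' (ENNReal.ofReal p) (μ.prod ν) ≤ C' ^ (1 / p) := by
      refine (Lp.eLpNorm_lim_le_liminf_eLpNorm (fun j => (hWm (φ j)).aestronglyMeasurable) D'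
        hae).trans (liminf_le_of_le (by isBoundedDefault) fun b hb => ?_)
      obtain ⟨j, hjb, hj⟩ := (hb.and (eventually_ge_atTop k₁)).exists
      refine hjb.trans ?_
      have hconv : Convex ℝ {f : α × X → F | StronglyMeasurable f ∧
          eLpNorm f (ENNReal.ofReal p) (μ.prod ν) ≤ C' ^ (1 / p)} := by
        rintro f ⟨hf, hf'⟩ g ⟨hg, hg'⟩ a b ha hb hab
        refine ⟨(hf.const_smul a).add (hg.const_smul b), ?_⟩
        refine (eLpNorm_add_le (hf.const_smul a).aestronglyMeasurable
          (hg.const_smul b).aestronglyMeasurable ?_).trans ?_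
        · rw [← ENNReal.ofReal_one]; exact ENNReal.ofReal_le_ofReal (by linarith)
        rw [eLpNorm_const_smul, eLpNorm_const_smul, ← ofReal_norm, ← ofReal_norm,
          Real.norm_of_nonneg ha, Real.norm_of_nonneg hb]
        refine (add_le_add (mul_le_mul_right hf' _) (mul_le_mul_right hg' _)).trans (le_of_eq ?_)
        rw [← add_mul, ← ENNReal.ofReal_add ha hb, hab, ENNReal.ofReal_one, one_mul]
      refine (linearCombination_mem_of_convex hconv (m := φ j) (fun k hk => ⟨hGm k, ?_⟩)
        (hc (φ j))).2
      rw [hnorm]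
      refine ENNReal.rpow_le_rpow (hk₁ _ ?_) (by positivity)
      have := hφ.id_le j
      simp only [id] at this
      omega
    rw [hnorm] at h1
    have h2 := ENNReal.rpow_le_rpow h1 hp0.le
    rwa [← ENNReal.rpow_mul, ← ENNReal.rpow_mul, one_div_mul_cancel hp0.ne', ENNReal.rpow_one,
      ENNReal.rpow_one] at h2
  · filter_upwards [hslice] with s hs
    have hGi : ∀ k, Integrable (fun x => G k (s, x)) ν := fun k => by
      obtain ⟨K, hK⟩ := hDb (k + k₀)
      exact Integrable.of_bound ((hGm k).comp_measurable measurable_prodMk_left).aestronglyMeasurable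
        K (Eventually.of_forall fun x => hK _)
    have hWi : ∀ m, Integrable (fun x => Finsupp.linearCombination ℝ G (c m) (s, x)) ν := by
      intro m
      refine linearCombination_mem_of_convex
        (S := {f : α × X → F | Integrable (fun x => f (s, x)) ν}) (m := m)
        (fun f hf g hg a b _ _ _ => ?_) (fun k _ => hGi k) (hc m)
      exact (Integrable.smul a hf).add (Integrable.smul b hg)
    have hD'i : Integrable (fun x => D' (s, x)) ν := by
      obtain ⟨j, hj⟩ := (hs.eventually_lt_const (zero_lt_one)).exists
      have h1 : Integrable (fun x => Finsupp.linearCombination ℝ G (c (φ j)) (s, x) - D' (s, x)) ν :=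
        ⟨(((hWm (φ j)).sub hD').comp_measurable measurable_prodMk_left).aestronglyMeasurable,
          hj.trans ENNReal.one_lt_top⟩
      refine ((hWi (φ j)).sub h1).congr (Eventually.of_forall fun x => ?_)
      simp
    refine ⟨hD'i, ?_⟩
    rintro E _ _ A ψ hψ ⟨K, hK⟩ T hT
    have h1 : Tendsto (fun j => ∫ x, ψ x • A (Finsupp.linearCombination ℝ G (c (φ j)) (s, x)) ∂ν)
        atTop (𝓝 T) := by
      have := (tendsto_linearCombination (hT.comp (tendsto_add_atTop_nat k₀)) hc).comp
        hφ.tendsto_atTop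
      refine this.congr fun j => ?_
      simp only [comp_apply, linearCombination_apply_fun]
      exact (integral_smul_linearCombination A ψ (c (φ j))
        fun k => Integrable.bdd_smul_clm A hψ hK (hGi k)).symm
    refine tendsto_nhds_unique ?_ h1
    refine tendsto_integral_of_L1 _ (Integrable.bdd_smul_clm A hψ hK hD'i).aestronglyMeasurable
      (Eventually.of_forall fun j => Integrable.bdd_smul_clm A hψ hK (hWi (φ j))) ?_
    have h2 := ENNReal.Tendsto.const_mul (a := ENNReal.ofReal (K * ‖A‖)) hs
      (Or.inr ENNReal.ofReal_ne_top)
    rw [mul_zero] at h2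
    refine tendsto_of_tendsto_of_tendsto_of_le_of_le tendsto_const_nhds h2 (fun _ => zero_le)
      fun j => ?_
    dsimp only
    rw [← lintegral_const_mul' _ _ ENNReal.ofReal_ne_top]
    refine lintegral_mono fun x => ?_
    rw [← smul_sub, ← map_sub, ← ofReal_norm, ← ofReal_norm,
      ← ENNReal.ofReal_mul' (norm_nonneg _)]
    refine ENNReal.ofReal_le_ofReal ?_
    rw [norm_smul, mul_assoc]
    exact mul_le_mul (hK x) (A.le_opNorm _) (norm_nonneg _) ((abs_nonneg _).trans (hK x))

end WeakLimit

/-! ### Weak derivatives of the flow -/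

section WeakDerivative

local notation "𝔼" n => EuclideanSpace ℝ (Fin n)

variable {n : ℕ}

/-- Integration by parts for Lipschitz maps. -/
theorem LipschitzWith.integral_smul_fderiv_eq {f : (𝔼 n) → 𝔼 n} {K : NNReal}
    (hf : LipschitzWith K f) {φ : (𝔼 n) → ℝ} (hφ : ContDiff ℝ (⊤ : ℕ∞) φ)
    (hφc : HasCompactSupport φ) (v : 𝔼 n) :
    ∫ x, φ x • fderiv ℝ f x v = -∫ x, (fderiv ℝ φ x v) • f x := by
  obtain ⟨C, hC⟩ := ContDiff.lipschitzWith_of_hasCompactSupport hφc hφ (by simp)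
  have hφd : Differentiable ℝ φ := hφ.differentiable (by simp)
  have hdc : Continuous fun x => fderiv ℝ φ x v := (hφ.continuous_fderiv (by simp)).clm_apply
    continuous_const
  have hdcs : HasCompactSupport fun x => fderiv ℝ φ x v := hφc.fderiv_apply (𝕜 := ℝ) v
  have hi1 : Integrable fun x => φ x • fderiv ℝ f x v := by
    have h1 : Integrable φ := hφ.continuous.integrable_of_hasCompactSupport hφc
    refine h1.smul_bdd (K * ‖v‖) ?_ ?_
    · exact ((measurable_fderiv ℝ f).apply_continuousLinearMap v).aestronglyMeasurable
    · refine Eventually.of_forall fun x => ((fderiv ℝ f x).le_opNorm v).trans ?_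
      exact mul_le_mul_of_nonneg_right (norm_fderiv_le_of_lipschitz ℝ hf) (norm_nonneg v)
  have hi2 : Integrable fun x => (fderiv ℝ φ x v) • f x :=
    (hdc.smul hf.continuous).integrable_of_hasCompactSupport hdcs.smul_right
  ext i
  set π : (𝔼 n) →L[ℝ] ℝ := EuclideanSpace.proj i
  have hπ : ∀ w : 𝔼 n, w i = π w := fun w => rfl
  rw [hπ, hπ, map_neg, ← π.integral_comp_comm hi1, ← π.integral_comp_comm hi2]
  have hfi : LipschitzWith (‖π‖₊ * K) fun x => π (f x) := π.lipschitz.comp hf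
  have key := hfi.integral_lineDeriv_mul_eq (μ := volume) hC hφc v
  have e1 : ∫ x, π (φ x • fderiv ℝ f x v) = ∫ x, lineDeriv ℝ (fun x => π (f x)) x v * φ x := by
    refine integral_congr_ae ?_
    filter_upwards [hf.ae_differentiableAt] with x hx
    have h1 : HasFDerivAt (fun x => π (f x)) (π.comp (fderiv ℝ f x)) x :=
      π.hasFDerivAt.comp x hx.hasFDerivAt
    rw [h1.differentiableAt.lineDeriv_eq_fderiv, h1.fderiv, map_smul, smul_eq_mul, mul_comm]
    rfl
  rw [e1, key, ← integral_neg]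
  refine integral_congr_ae (Eventually.of_forall fun x => ?_)
  dsimp only
  rw [(hφd x).lineDeriv_eq_fderiv, map_neg, map_smul, smul_eq_mul, neg_mul]

theorem frontier_nonempty_of_isBounded (hn : 0 < n) {Ω : Set (𝔼 n)} (hΩ : Bornology.IsBounded Ω)
    (hne : Ω.Nonempty) : (frontier Ω).Nonempty := by
  have : Nonempty (Fin n) := ⟨⟨0, hn⟩⟩
  refine nonempty_frontier_iff.2 ⟨hne, ?_⟩
  rintro rfl
  exact NormedSpace.unbounded_univ ℝ (𝔼 n) hΩ

theorem le_infDist_frontier (hn : 0 < n) {Ω : Set (𝔼 n)} (hΩo : IsOpen Ω)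
    (hΩ : Bornology.IsBounded Ω) {y : 𝔼 n}
    {r : ℝ} (hr : 0 ≤ r) (h : Metric.closedBall y r ⊆ Ω) :
    r ≤ Metric.infDist y (frontier Ω) := by
  refine (Metric.le_infDist (frontier_nonempty_of_isBounded hn hΩ
    ⟨y, h (Metric.mem_closedBall_self hr)⟩)).2 fun z hz => ?_
  by_contra hlt
  rw [hΩo.frontier_eq] at hz
  exact hz.2 (h (by rw [Metric.mem_closedBall, dist_comm]; exact (not_le.1 hlt).le))

/-- Trajectories in a tube of width `r₀` inside `Ω` are admissible for all small `σ`. -/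
theorem admissible_of_closedBall_subset (hn : 0 < n) {Ω : Set (𝔼 n)} (hΩo : IsOpen Ω)
    (hΩ : Bornology.IsBounded Ω) {c : ℝ → (𝔼 n) → 𝔼 n} {I : Set ℝ} {t s r₀ σ : ℝ} (hs : s ∈ I)
    (ht : t ∈ I) (hσ : 0 < σ) (hσ1 : σ < 1) (hσr : σ < r₀) {x : 𝔼 n}
    (h : ∀ r ∈ uIcc s t, Metric.closedBall (lipFlow c r s x) r₀ ⊆ Ω) :
    Admissible c I (core Ω (σ ^ 2)) (core Ω σ) t s x := by
  have hr₀ : 0 ≤ r₀ := hσ.le.trans hσr.le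
  have key : ∀ r ∈ uIcc s t, ∀ δ < r₀, lipFlow c r s x ∈ core Ω δ := fun r hr δ hδ =>
    ⟨h r hr (Metric.mem_closedBall_self hr₀), hδ.trans_le (le_infDist_frontier hn hΩo hΩ hr₀ (h r hr))⟩
  have hσ2 : σ ^ 2 < r₀ := by nlinarith
  refine ⟨hs, ht, fun r hr => key r hr _ hσ2, s, hs, fun r hr => ?_, key s left_mem_uIcc _ hσr⟩
  rw [uIcc_self, mem_singleton_iff] at hr
  rw [hr]
  exact key s left_mem_uIcc _ hσ2

theorem flowDomain_subset {b : ℝ → (𝔼 n) → 𝔼 n} {I : Set ℝ} {Ω : Set (𝔼 n)} {t s : ℝ} :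
    flowDomain b I Ω t s ⊆ Ω := by
  rintro x ⟨y, J, -, -, -, hs, -, γ, hγ, rfl, -⟩
  exact hγ.mapsTo hs

theorem flow_mem {b : ℝ → (𝔼 n) → 𝔼 n} {I : Set ℝ} {Ω : Set (𝔼 n)} {t s : ℝ} {x : 𝔼 n}
    (hx : x ∈ flowDomain b I Ω t s) : flow b I Ω t s x ∈ Ω := by
  have hx' : ∃ y, Reaches b I Ω t s x y := hx
  rw [flow, dif_pos hx']
  obtain ⟨J, -, -, -, -, ht, γ, hγ, -, h⟩ := hx'.choose_spec
  rw [← h]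
  exact hγ.mapsTo ht

variable {t₀ t₁ : ℝ} {Ω : Set (𝔼 n)} {β b : ℝ → (𝔼 n) → 𝔼 n}
  {B : ℝ → (𝔼 n) → (𝔼 n) →L[ℝ] 𝔼 n} {M R a : ℝ} {F : ℝ → ℝ}

/-- The differential of the flow at admissible points, extended by zero. -/
noncomputable def admFDeriv (c : ℝ → (𝔼 n) → 𝔼 n) (I : Set ℝ) (U V : Set (𝔼 n)) (t s : ℝ)
    (x : 𝔼 n) : (𝔼 n) →L[ℝ] 𝔼 n :=
  {z : ℝ × ℝ × 𝔼 n | Admissible c I U V z.1 z.2.1 z.2.2}.indicator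
    (fun z => fderiv ℝ (lipFlow c z.1 z.2.1) z.2.2) (t, s, x)

theorem enorm_admFDeriv_rpow {c : ℝ → (𝔼 n) → 𝔼 n} {I : Set ℝ} {U V : Set (𝔼 n)} {t s : ℝ}
    {x : 𝔼 n} {p : ℝ} (hp : 0 < p) : ‖admFDeriv c I U V t s x‖ₑ ^ p =
      admInd c I U V t s x * ‖fderiv ℝ (lipFlow c t s) x‖ₑ ^ p := by
  by_cases hx : Admissible c I U V t s x
  · rw [admInd_of_admissible hx, one_mul, admFDeriv, indicator_of_mem]
    exact hx
  · rw [admInd_of_not_admissible hx, zero_mul, admFDeriv, indicator_of_notMem]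
    · rw [← ofReal_norm, norm_zero, ENNReal.ofReal_zero, ENNReal.zero_rpow_of_pos hp]
    · exact hx

theorem IsLipField.measurable_admFDeriv {c : ℝ → (𝔼 n) → 𝔼 n} {M L : ℝ} (h : IsLipField c M L)
    {I : Set ℝ} {U V : Set (𝔼 n)} (hI : IsOpen I) (hU : IsOpen U)
    (hV : IsOpen V) {α : Type*} [MeasurableSpace α] {f g : α → ℝ} {k : α → 𝔼 n}
    (hf : Measurable f) (hg : Measurable g) (hk : Measurable k) :
    Measurable fun a => admFDeriv c I U V (f a) (g a) (k a) := by
  have h1 : Continuous (uncurry fun z : ℝ × ℝ => lipFlow c z.1 z.2) :=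
    h.continuous_lipFlow.comp (f := fun w : (ℝ × ℝ) × 𝔼 n => (w.1.1, w.1.2, w.2)) (by fun_prop)
  have h2 : Measurable fun z : ℝ × ℝ × 𝔼 n => fderiv ℝ (lipFlow c z.1 z.2.1) z.2.2 :=
    (measurable_fderiv_with_param ℝ h1).comp
      (f := fun z : ℝ × ℝ × 𝔼 n => ((z.1, z.2.1), z.2.2)) (by fun_prop)
  exact (h2.indicator (isOpen_admissible h hI hU hV).measurableSet).comp (hf.prodMk (hg.prodMk hk))

theorem IsLipField.norm_admFDeriv_le {c : ℝ → (𝔼 n) → 𝔼 n} {M L : ℝ} (h : IsLipField c M L)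
    {I : Set ℝ} {U V : Set (𝔼 n)} (hI : Bornology.IsBounded I) (t s : ℝ) (x : 𝔼 n) :
    ‖admFDeriv c I U V t s x‖ ≤ Real.exp (|L| * Metric.diam I) := by
  by_cases hx : Admissible c I U V t s x
  · rw [admFDeriv, indicator_of_mem (show (t, s, x) ∈ {z : ℝ × ℝ × 𝔼 n |
      Admissible c I U V z.1 z.2.1 z.2.2} from hx)]
    refine (norm_fderiv_le_of_lipschitz ℝ (h.lipschitzWith_lipFlow t s)).trans ?_
    rw [Real.coe_toNNReal _ (Real.exp_pos _).le]
    exact Real.exp_le_exp.2 (mul_le_mul_of_nonneg_left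
      (Metric.dist_le_diam_of_mem hI hx.2.1 hx.1) (abs_nonneg _))
  · rw [admFDeriv, indicator_of_notMem (show (t, s, x) ∉ {z : ℝ × ℝ × 𝔼 n |
      Admissible c I U V z.1 z.2.1 z.2.2} from hx), norm_zero]
    exact (Real.exp_pos _).le

namespace ExpSobolevField

/-- Convergence of the flows of the mollified fields, uniformly on compact subsets of the flow
domain. -/
theorem exists_uniform_flow (h : ExpSobolevField t₀ t₁ Ω β B M R a F)
    (hb : IsRep t₀ t₁ Ω β b) {t s : ℝ} {S : Set (𝔼 n)} (hS : IsCompact S)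
    (hSd : S ⊆ flowDomain b (Ioo t₀ t₁) Ω t s) :
    ∃ κ₀ > 0, ∃ r₀ > 0, ∀ κ, 0 < κ → κ ≤ κ₀ → ∀ x ∈ S,
      ‖lipFlow (mollField β κ) t s x - flow b (Ioo t₀ t₁) Ω t s x‖ ≤
        rate n t₀ t₁ a F * κ ^ (1 / 4 : ℝ) ∧
      ∀ r ∈ uIcc s t, Metric.closedBall (lipFlow (mollField β κ) r s x) r₀ ⊆ Ω := by
  refine hS.induction_on (p := fun S => ∃ κ₀ > 0, ∃ r₀ > 0, ∀ κ, 0 < κ → κ ≤ κ₀ → ∀ x ∈ S,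
      ‖lipFlow (mollField β κ) t s x - flow b (Ioo t₀ t₁) Ω t s x‖ ≤
        rate n t₀ t₁ a F * κ ^ (1 / 4 : ℝ) ∧
      ∀ r ∈ uIcc s t, Metric.closedBall (lipFlow (mollField β κ) r s x) r₀ ⊆ Ω) ?_ ?_ ?_ ?_
  · exact ⟨1, one_pos, 1, one_pos, by simp⟩
  · rintro S T hST ⟨κ₀, hκ₀, r₀, hr₀, H⟩
    exact ⟨κ₀, hκ₀, r₀, hr₀, fun κ h1 h2 x hx => H κ h1 h2 x (hST hx)⟩
  · rintro S T ⟨κ₀, hκ₀, r₀, hr₀, H⟩ ⟨κ₁, hκ₁, r₁, hr₁, H'⟩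
    refine ⟨min κ₀ κ₁, lt_min hκ₀ hκ₁, min r₀ r₁, lt_min hr₀ hr₁, fun κ h1 h2 x hx => ?_⟩
    rcases hx with hx | hx
    · obtain ⟨h3, h4⟩ := H κ h1 (h2.trans (min_le_left _ _)) x hx
      exact ⟨h3, fun r hr => (Metric.closedBall_subset_closedBall (min_le_left _ _)).trans (h4 r hr)⟩
    · obtain ⟨h3, h4⟩ := H' κ h1 (h2.trans (min_le_right _ _)) x hx
      exact ⟨h3, fun r hr => (Metric.closedBall_subset_closedBall (min_le_right _ _)).trans
        (h4 r hr)⟩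
  · intro x hx
    obtain ⟨ρ, hρ, κ₀, hκ₀, r₀, hr₀, H⟩ := h.exists_ball_flow hb (hSd hx)
    refine ⟨Metric.ball x ρ, mem_nhdsWithin_of_mem_nhds (Metric.ball_mem_nhds x hρ), κ₀, hκ₀, r₀,
      hr₀, fun κ h1 h2 y hy => (H y hy).2 κ h1 h2⟩

theorem continuousOn_flow (h : ExpSobolevField t₀ t₁ Ω β B M R a F)
    (hb : IsRep t₀ t₁ Ω β b) (t s : ℝ) :
    ContinuousOn (flow b (Ioo t₀ t₁) Ω t s) (flowDomain b (Ioo t₀ t₁) Ω t s) := by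
  intro x hx
  refine ContinuousAt.continuousWithinAt ?_
  obtain ⟨ρ, hρ, κ₀, hκ₀, r₀, hr₀, H⟩ := h.exists_ball_flow hb hx
  refine continuousAt_of_locally_uniform_approx_of_continuousAt fun u hu => ?_
  obtain ⟨ε, hε, hεu⟩ := Metric.mem_uniformity_dist.1 hu
  have h1 : ∀ᶠ κ in 𝓝[>] (0 : ℝ), rate n t₀ t₁ a F * κ ^ (1 / 4 : ℝ) < ε :=
    (tendsto_rpow_quarter _).eventually_lt_const hε
  have h2 : ∀ᶠ κ in 𝓝[>] (0 : ℝ), κ ∈ Ioc 0 κ₀ := Ioc_mem_nhdsGT hκ₀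
  obtain ⟨κ, h3, h4⟩ := (h1.and h2).exists
  obtain ⟨L, K, hL, -⟩ := h.exists_isLipField h4.1
  refine ⟨Metric.ball x ρ, Metric.ball_mem_nhds x hρ, lipFlow (mollField β κ) t s,
    (hL.lipschitzWith_lipFlow t s).continuous.continuousAt, fun y hy => hεu ?_⟩
  rw [dist_comm, dist_eq_norm]
  exact ((H y hy).2 κ h4.1 h4.2).1.trans_lt h3

theorem memLp_flow (h : ExpSobolevField t₀ t₁ Ω β B M R a F)
    (hb : IsRep t₀ t₁ Ω β b) (hΩ : Bornology.IsBounded Ω) (t s : ℝ) (q : ℝ≥0∞) :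
    MemLp (flow b (Ioo t₀ t₁) Ω t s) q (volume.restrict (flowDomain b (Ioo t₀ t₁) Ω t s)) := by
  have hm := (h.isOpen_flowDomain hb t s).measurableSet
  have hfin : IsFiniteMeasure (volume.restrict (flowDomain b (Ioo t₀ t₁) Ω t s)) :=
    ⟨by simpa using (hΩ.subset flowDomain_subset).measure_lt_top⟩
  obtain ⟨C, hC⟩ := hΩ.exists_norm_le
  exact MemLp.of_bound ((h.continuousOn_flow hb t s).aestronglyMeasurable hm) C
    ((ae_restrict_iff' hm).2 (Eventually.of_forall fun x hx => hC _ (flow_mem hx)))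

/-- The pairings of the differentials of the approximate flows with a test function converge, and
the limit is the weak differential of the flow tested against that function. -/
theorem tendsto_integral_smul_fderiv (h : ExpSobolevField t₀ t₁ Ω β B M R a F)
    (hb : IsRep t₀ t₁ Ω β b) (hn : 0 < n) (hΩ : Bornology.IsBounded Ω) {σ : ℕ → ℝ}
    (hσ : ∀ k, 0 < σ k) (hσ1 : ∀ k, σ k < 1) (hσ0 : Tendsto σ atTop (𝓝 0)) {t s : ℝ}
    (ht : t ∈ Ioo t₀ t₁) (hs : s ∈ Ioo t₀ t₁) {φ : (𝔼 n) → ℝ} (hφ : ContDiff ℝ (⊤ : ℕ∞) φ)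
    (hφc : HasCompactSupport φ) (hφs : tsupport φ ⊆ flowDomain b (Ioo t₀ t₁) Ω t s) (v : 𝔼 n) :
    Tendsto (fun k => ∫ x in Ω, φ x • (admFDeriv (mollField β (σ k ^ 4))
        (Ioo t₀ t₁) (core Ω (σ k ^ 2)) (core Ω (σ k)) t s x) v) atTop
      (𝓝 (-∫ x, (fderiv ℝ φ x v) • flow b (Ioo t₀ t₁) Ω t s x)) := by
  obtain ⟨κ₀, hκ₀, r₀, hr₀, H⟩ := h.exists_uniform_flow hb hφc hφs
  have hσ4 : Tendsto (fun k => σ k ^ 4) atTop (𝓝[>] 0) := by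
    refine tendsto_nhdsWithin_iff.2 ⟨?_, Eventually.of_forall fun k => pow_pos (hσ k) 4⟩
    simpa using hσ0.pow 4
  have hev : ∀ᶠ k in atTop, σ k ^ 4 ≤ κ₀ ∧ σ k < r₀ :=
    ((tendsto_nhdsWithin_iff.1 hσ4).1.eventually_le_const hκ₀).and (hσ0.eventually_lt_const hr₀)
  have hdsupp : ∀ x, x ∉ tsupport φ → fderiv ℝ φ x v = 0 := fun x hx => by
    have : fderiv ℝ φ x = 0 := by
      by_contra hne
      exact hx (support_fderiv_subset ℝ hne)
    rw [this]; rfl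
  have hdc : Continuous fun x => fderiv ℝ φ x v := (hφ.continuous_fderiv (by simp)).clm_apply
    continuous_const
  have hdi : Integrable fun x => fderiv ℝ φ x v :=
    hdc.integrable_of_hasCompactSupport (hφc.fderiv_apply (𝕜 := ℝ) v)
  obtain ⟨C, hC⟩ := hΩ.exists_norm_le
  have hlim : Tendsto (fun k => ∫ x, (fderiv ℝ φ x v) • lipFlow (mollField β (σ k ^ 4)) t s x) atTop
      (𝓝 (∫ x, (fderiv ℝ φ x v) • flow b (Ioo t₀ t₁) Ω t s x)) := by
    refine tendsto_integral_filter_of_dominated_convergence (fun x => ‖fderiv ℝ φ x v‖ * C) ?_ ?_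
      (hdi.norm.mul_const C) ?_
    · refine Eventually.of_forall fun k => ?_
      obtain ⟨L, K, hL, -⟩ := h.exists_isLipField (pow_pos (hσ k) 4)
      exact (hdc.smul (hL.lipschitzWith_lipFlow t s).continuous).aestronglyMeasurable
    · filter_upwards [hev] with k hk
      refine Eventually.of_forall fun x => ?_
      by_cases hx : x ∈ tsupport φ
      · rw [norm_smul]
        refine mul_le_mul_of_nonneg_left (hC _ ?_) (norm_nonneg _)
        exact (H _ (pow_pos (hσ k) 4) hk.1 x hx).2 t right_mem_uIcc
          (Metric.mem_closedBall_self hr₀.le)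
      · rw [hdsupp x hx]; simp
    · refine Eventually.of_forall fun x => ?_
      by_cases hx : x ∈ tsupport φ
      · refine Tendsto.const_smul ?_ _
        rw [tendsto_iff_norm_sub_tendsto_zero]
        refine squeeze_zero' (Eventually.of_forall fun k => norm_nonneg _) ?_
          ((tendsto_rpow_quarter (rate n t₀ t₁ a F)).comp hσ4)
        filter_upwards [hev] with k hk
        exact (H _ (pow_pos (hσ k) 4) hk.1 x hx).1
      · rw [hdsupp x hx]; simp
  refine hlim.neg.congr' ?_
  filter_upwards [hev] with k hk
  obtain ⟨L, K, hL, -⟩ := h.exists_isLipField (pow_pos (hσ k) 4)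
  rw [← (hL.lipschitzWith_lipFlow t s).integral_smul_fderiv_eq hφ hφc v]
  have hzero : ∀ x, x ∉ tsupport φ → φ x = 0 := fun x hx => image_eq_zero_of_notMem_tsupport hx
  rw [← setIntegral_eq_integral_of_forall_compl_eq_zero (s := Ω)]
  · refine integral_congr_ae (Eventually.of_forall fun x => ?_)
    dsimp only
    by_cases hx : x ∈ tsupport φ
    · rw [admFDeriv, indicator_of_mem]
      exact admissible_of_closedBall_subset hn h.isOpen hΩ hs ht (hσ k) (hσ1 k) hk.2
        (H _ (pow_pos (hσ k) 4) hk.1 x hx).2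
    · rw [hzero x hx, zero_smul, zero_smul]
  · intro x hx
    rw [hzero x fun h' => hx (flowDomain_subset (hφs h')), zero_smul]

end ExpSobolevField

end WeakDerivative

/-! ### Sobolev regularity of the flow -/

section SobolevFlow

local notation "𝔼" n => EuclideanSpace ℝ (Fin n)

variable {n : ℕ} {t₀ t₁ : ℝ} {Ω : Set (𝔼 n)} {β b : ℝ → (𝔼 n) → 𝔼 n}
  {B : ℝ → (𝔼 n) → (𝔼 n) →L[ℝ] 𝔼 n} {M R a : ℝ} {F : ℝ → ℝ}

namespace ExpSobolevField

/-- If the `p`-energies of the flows of the mollified fields, between the times `S s` and `T s`,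
are asymptotically bounded by `C`, then the limit flow has weak derivatives with `p`-energy at
most `C`. -/
theorem exists_weakFDeriv (h : ExpSobolevField t₀ t₁ Ω β B M R a F)
    (hb : IsRep t₀ t₁ Ω β b) (hn : 0 < n) (hΩ : Bornology.IsBounded Ω) {p : ℝ} (hp : 2 ≤ p)
    {σ : ℕ → ℝ} (hσ : ∀ k, 0 < σ k) (hσ1 : ∀ k, σ k < 1) (hσ0 : Tendsto σ atTop (𝓝 0))
    {T S : ℝ → ℝ} (hT : Measurable T) (hS : Measurable S)
    (hTI : ∀ s ∈ Ioo t₀ t₁, T s ∈ Ioo t₀ t₁) (hSI : ∀ s ∈ Ioo t₀ t₁, S s ∈ Ioo t₀ t₁)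
    {C : ℝ≥0∞} (hC : C ≠ ⊤)
    (hE : ∀ C' > C, ∀ᶠ k in atTop, ∫⁻ s in Ioo t₀ t₁, ∫⁻ x,
      admInd (mollField β (σ k ^ 4)) (Ioo t₀ t₁) (core Ω (σ k ^ 2)) (core Ω (σ k)) (T s) (S s) x *
        ‖fderiv ℝ (lipFlow (mollField β (σ k ^ 4)) (T s) (S s)) x‖ₑ ^ p ≤ C') :
    ∃ DX : ℝ → (𝔼 n) → (𝔼 n) →L[ℝ] 𝔼 n, StronglyMeasurable (uncurry DX) ∧
      ∫⁻ s in Ioo t₀ t₁, ∫⁻ x in Ω, ‖DX s x‖ₑ ^ p ≤ C ∧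
      ∀ᵐ s ∂(volume.restrict (Ioo t₀ t₁)),
        HasWeakFDerivOn (flowDomain b (Ioo t₀ t₁) Ω (T s) (S s))
          (flow b (Ioo t₀ t₁) Ω (T s) (S s)) (DX s) ∧
        MemLp (DX s) (ENNReal.ofReal p)
          (volume.restrict (flowDomain b (Ioo t₀ t₁) Ω (T s) (S s))) := by
  have hp0 : 0 < p := by linarith
  set I := Ioo t₀ t₁
  have hIb : Bornology.IsBounded I := Metric.isBounded_Ioo t₀ t₁
  have hIo : IsOpen I := isOpen_Ioo
  have : IsFiniteMeasure (volume.restrict I) := ⟨by simpa using hIb.measure_lt_top⟩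
  have : IsFiniteMeasure (volume.restrict Ω) := ⟨by simpa using hΩ.measure_lt_top⟩
  set D : ℕ → ℝ × (𝔼 n) → (𝔼 n) →L[ℝ] 𝔼 n := fun k z => admFDeriv (mollField β (σ k ^ 4)) I
    (core Ω (σ k ^ 2)) (core Ω (σ k)) (T z.1) (S z.1) z.2
  have hD : ∀ k, StronglyMeasurable (D k) := fun k => by
    obtain ⟨L, K, hL, -⟩ := h.exists_isLipField (pow_pos (hσ k) 4)
    exact (hL.measurable_admFDeriv hIo (isOpen_core h.isOpen _) (isOpen_core h.isOpen _)
      (hT.comp measurable_fst) (hS.comp measurable_fst) measurable_snd).stronglyMeasurable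
  have hDb : ∀ k, ∃ K, ∀ z, ‖D k z‖ ≤ K := fun k => by
    obtain ⟨L, K, hL, -⟩ := h.exists_isLipField (pow_pos (hσ k) 4)
    exact ⟨_, fun z => hL.norm_admFDeriv_le hIb _ _ _⟩
  have hDE : ∀ C' > C, ∀ᶠ k in atTop,
      ∫⁻ z, ‖D k z‖ₑ ^ p ∂((volume.restrict I).prod (volume.restrict Ω)) ≤ C' := by
    intro C' hC'
    filter_upwards [hE C' hC'] with k hk
    refine le_trans ?_ hk
    rw [lintegral_prod _ ((hD k).enorm.pow_const p).aemeasurable]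
    refine lintegral_mono fun s => (setLIntegral_le_lintegral _ _).trans (le_of_eq ?_)
    exact lintegral_congr fun x => enorm_admFDeriv_rpow hp0
  obtain ⟨D', hD', hD'C, hae⟩ := exists_slicewise_weakLimit hp hD hDb hC hDE
  have hm : Measurable fun z => ‖D' z‖ₑ ^ p := hD'.enorm.pow_const p
  rw [lintegral_prod _ hm.aemeasurable] at hD'C
  refine ⟨fun s x => D' (s, x), hD', hD'C, ?_⟩
  filter_upwards [hae, ae_lt_top hm.lintegral_prod_right' (hD'C.trans_lt hC.lt_top).ne,
    ae_restrict_mem measurableSet_Ioo] with s hs hsp hsI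
  have hsub : flowDomain b I Ω (T s) (S s) ⊆ Ω := flowDomain_subset
  have hI1 : IntegrableOn (fun x => D' (s, x)) (flowDomain b I Ω (T s) (S s)) :=
    IntegrableOn.mono_set hs.1 hsub
  have hfin : IsFiniteMeasure (volume.restrict (flowDomain b I Ω (T s) (S s))) :=
    ⟨by simpa using (hΩ.subset hsub).measure_lt_top⟩
  refine ⟨⟨?_, hI1.locallyIntegrableOn, ?_⟩, ?_⟩
  · have h1 := h.memLp_flow hb hΩ (T s) (S s) 1
    exact IntegrableOn.locallyIntegrableOn (memLp_one_iff_integrable.1 h1)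
  · intro φ hφ hφc hφs v
    obtain ⟨K, hK⟩ := hφ.continuous.bounded_above_of_compact_support hφc
    have h1 := hs.2 (ContinuousLinearMap.apply ℝ (𝔼 n) v) φ hφ.continuous.measurable
      ⟨K, hK⟩ _ (h.tendsto_integral_smul_fderiv hb hn hΩ hσ hσ1 hσ0 (hTI s hsI) (hSI s hsI) hφ
        hφc hφs v)
    rw [setIntegral_eq_integral_of_forall_compl_eq_zero] at h1
    · rw [← neg_eq_iff_eq_neg]
      exact h1.symm
    · intro x hx
      rw [image_eq_zero_of_notMem_tsupport fun h' => hx (hsub (hφs h')), zero_smul]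
  · refine ⟨hI1.aestronglyMeasurable, ?_⟩
    rw [eLpNorm_lt_top_iff_lintegral_rpow_enorm_lt_top (by simpa using hp0) ENNReal.ofReal_ne_top,
      ENNReal.toReal_ofReal hp0.le]
    exact (lintegral_mono_set hsub).trans_lt hsp

/-- The energy of the mollified field is bounded by the exponential integral of the differential of
the field, with the geometric weight, up to a factor that tends to `1` with `σ → 0`. -/
theorem fieldEnergy_mollField_le (h : ExpSobolevField t₀ t₁ Ω β B M R a F) (hn : 0 < n) {p : ℝ}
    (hp : (n : ℝ) < p) (ha : a = (t₁ - t₀) * p ^ 2 / (p - n)) {σ : ℝ} (hσ : 0 < σ) (hσ1 : σ < 1) :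
    fieldEnergy (mollField β (σ ^ 4)) (fun t => mollDeriv (σ ^ 4) (β t)) (Ioo t₀ t₁)
      (core Ω (σ ^ 2)) (core Ω σ) (t₁ - t₀) p ≤
    ENNReal.ofReal ((1 - σ) / (1 + σ ^ 2)) ^ ((n : ℝ) / (n - p)) *
      ∫⁻ r in Ioo t₀ t₁, ∫⁻ y in Ω,
        geometricWeight Ω (t₁ - t₀) (ENNReal.ofReal M) ((n : ℝ) / (n - p)) y *
          ENNReal.ofReal (Real.exp (a * ‖B r y‖)) := by
  have hn' : (0 : ℝ) < n := by exact_mod_cast hn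
  have hα : (n : ℝ) / (n - p) < 0 := div_neg_of_pos_of_neg hn' (by linarith)
  obtain ⟨L, K, hL, -⟩ := h.exists_isLipField (pow_pos hσ 4)
  have hθ : ENNReal.ofReal ((1 - σ) / (1 + σ ^ 2)) ≠ 0 := by
    have : 0 < 1 - σ := by linarith
    have : 0 < (1 - σ) / (1 + σ ^ 2) := by positivity
    simpa using this
  have hθ' : ENNReal.ofReal ((1 - σ) / (1 + σ ^ 2)) ^ ((n : ℝ) / (n - p)) ≠ ⊤ :=
    ENNReal.rpow_ne_top_of_ne_zero hθ ENNReal.ofReal_ne_top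
  have key := h.lintegral_admInd_mul_exp_le (V := core Ω σ) hσ hσ1 rfl
    (u := fun r y => lifespan (mollField β (σ ^ 4)) (Ioo t₀ t₁) (core Ω (σ ^ 2)) (core Ω σ) r y ^
      ((n : ℝ) / (n - p)))
    ((measurable_geometricWeight Ω (t₁ - t₀) (ENNReal.ofReal M) ((n : ℝ) / (n - p))).const_mul
      (ENNReal.ofReal ((1 - σ) / (1 + σ ^ 2)) ^ ((n : ℝ) / (n - p))))
    (fun r y hy y' hy' => lifespan_rpow_le hL h.isOpen hσ hσ1 h.lt hα hy hy')
  rw [fieldEnergy, ← ha]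
  refine key.trans (le_of_eq ?_)
  simp only [mul_assoc]
  rw [← lintegral_const_mul' _ _ hθ']
  refine lintegral_congr fun r => ?_
  rw [lintegral_const_mul' _ _ hθ']

theorem tendsto_rpow_core_factor {σ : ℕ → ℝ} (hσ0 : Tendsto σ atTop (𝓝 0)) (α : ℝ) :
    Tendsto (fun k => ENNReal.ofReal ((1 - σ k) / (1 + σ k ^ 2)) ^ α) atTop (𝓝 1) := by
  have h1 : Tendsto (fun k => (1 - σ k) / (1 + σ k ^ 2)) atTop (𝓝 ((1 - 0) / (1 + 0 ^ 2))) :=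
    (tendsto_const_nhds.sub hσ0).div (tendsto_const_nhds.add (hσ0.pow 2)) (by norm_num)
  have h2 := (ENNReal.continuous_rpow_const (y := α)).tendsto _ |>.comp
    (ENNReal.tendsto_ofReal h1)
  simpa [comp_def] using h2

theorem eventually_flowEnergy_le (h : ExpSobolevField t₀ t₁ Ω β B M R a F) (hn : 0 < n)
    (hΩ : Bornology.IsBounded Ω) {p : ℝ}
    (hp : (n : ℝ) < p) (ha : a = (t₁ - t₀) * p ^ 2 / (p - n)) {σ : ℕ → ℝ} (hσ : ∀ k, 0 < σ k)
    (hσ1 : ∀ k, σ k < 1) (hσ0 : Tendsto σ atTop (𝓝 0)) {Λ : ℝ≥0∞} (hΛ : Λ ≠ ⊤)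
    (hΛe : ∫⁻ r in Ioo t₀ t₁, ∫⁻ y in Ω,
        geometricWeight Ω (t₁ - t₀) (ENNReal.ofReal M) ((n : ℝ) / (n - p)) y *
          ENNReal.ofReal (Real.exp (a * ‖B r y‖)) = Λ) (t : ℝ) {C' : ℝ≥0∞}
    (hC' : ENNReal.ofReal (t₁ - t₀) ^ ((n : ℝ) / (p - n)) * Λ < C') :
    ∀ᶠ k in atTop, flowEnergy (mollField β (σ k ^ 4)) (Ioo t₀ t₁) (core Ω (σ k ^ 2))
      (core Ω (σ k)) p t ≤ C' := by
  have h1 := ENNReal.Tendsto.const_mul (a := ENNReal.ofReal (t₁ - t₀) ^ ((n : ℝ) / (p - n)))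
    (ENNReal.Tendsto.mul_const (b := Λ) (tendsto_rpow_core_factor hσ0 ((n : ℝ) / (n - p)))
      (Or.inr hΛ)) (Or.inr (ENNReal.rpow_ne_top_of_nonneg
        (div_nonneg (Nat.cast_nonneg n) (by linarith)) ENNReal.ofReal_ne_top))
  rw [one_mul] at h1
  filter_upwards [h1.eventually_le_const hC'] with k hk
  obtain ⟨L, K, hT⟩ := h.exists_isTaylorField (pow_pos (hσ k) 4)
  refine (hT.flowEnergy_le_fieldEnergy hn hp isOpen_Ioo (Metric.isBounded_Ioo t₀ t₁)
    (hΩ.subset fun x hx => hx.1) ordConnected_Ioo (isOpen_core h.isOpen _)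
    (isOpen_core h.isOpen _) Real.volume_Ioo (sub_nonneg.2 h.lt.le) t).trans (le_trans ?_ hk)
  refine mul_le_mul_right ?_ _
  rw [← hΛe]
  exact h.fieldEnergy_mollField_le hn hp ha (hσ k) (hσ1 k)

/-- Sobolev regularity of the flow, and the estimate of its energy. For the flow ending at the fixed
time `t` the weighted energy is used, which gives the constant of the estimate; for the flow
starting at `t` some finite bound is enough. -/
theorem exists_weakFDeriv_flow (h : ExpSobolevField t₀ t₁ Ω β B M R a F)
    (hb : IsRep t₀ t₁ Ω β b) (hn : 0 < n) (hΩ : Bornology.IsBounded Ω) {p : ℝ}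
    (hp : (n : ℝ) < p) (hp2 : 2 ≤ p) (ha : a = (t₁ - t₀) * p ^ 2 / (p - n))
    {Λ : ℝ≥0∞} (hΛ : Λ ≠ ⊤)
    (hΛe : ∫⁻ r in Ioo t₀ t₁, ∫⁻ y in Ω,
        geometricWeight Ω (t₁ - t₀) (ENNReal.ofReal M) ((n : ℝ) / (n - p)) y *
          ENNReal.ofReal (Real.exp (a * ‖B r y‖)) = Λ)
    (hexp : ∫⁻ r in Ioo t₀ t₁, ∫⁻ y in Ω, ENNReal.ofReal (Real.exp (a * ‖B r y‖)) ≠ ⊤)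
    {t : ℝ} (ht : t ∈ Ioo t₀ t₁) :
    (∀ᵐ s ∂(volume.restrict (Ioo t₀ t₁)),
      MemW1p (flowDomain b (Ioo t₀ t₁) Ω t s) p (flow b (Ioo t₀ t₁) Ω t s) ∧
      MemW1p (flowDomain b (Ioo t₀ t₁) Ω s t) p (flow b (Ioo t₀ t₁) Ω s t)) ∧
    ∃ DX : ℝ → (𝔼 n) → (𝔼 n) →L[ℝ] 𝔼 n, StronglyMeasurable (uncurry DX) ∧
      (∀ᵐ s ∂(volume.restrict (Ioo t₀ t₁)),
        HasWeakFDerivOn (flowDomain b (Ioo t₀ t₁) Ω t s) (flow b (Ioo t₀ t₁) Ω t s) (DX s)) ∧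
      ∫⁻ s in Ioo t₀ t₁, ∫⁻ x in flowDomain b (Ioo t₀ t₁) Ω t s, ‖DX s x‖ₑ ^ p ≤
        ENNReal.ofReal (t₁ - t₀) ^ ((n : ℝ) / (p - n)) * Λ := by
  have hn' : (0 : ℝ) < n := by exact_mod_cast hn
  have hPQ := holderConjugate_div hn' hp
  set σ : ℕ → ℝ := fun k => 1 / ((k + 1 : ℕ) + 1 : ℝ)
  have hσ : ∀ k, 0 < σ k := fun k => by positivity
  have hσ1 : ∀ k, σ k < 1 := fun k => by
    simp only [σ]
    rw [div_lt_one (by positivity)]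
    push_cast
    have : (0:ℝ) ≤ k := Nat.cast_nonneg k
    linarith
  have hσ0 : Tendsto σ atTop (𝓝 0) :=
    (tendsto_one_div_add_atTop_nhds_zero_nat (𝕜 := ℝ)).comp (tendsto_add_atTop_nat 1)
  set C₀ := ENNReal.ofReal (t₁ - t₀) ^ ((n : ℝ) / (p - n)) * Λ
  have hC₀ : C₀ ≠ ⊤ := ENNReal.mul_ne_top (ENNReal.rpow_ne_top_of_nonneg
    (div_nonneg (Nat.cast_nonneg n) (by linarith)) ENNReal.ofReal_ne_top) hΛ
  have hE := fun {C' : ℝ≥0∞} (hC' : C₀ < C') =>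
    h.eventually_flowEnergy_le hn hΩ hp ha hσ hσ1 hσ0 hΛ hΛe t hC'
  obtain ⟨DX, hDX, hDXC, hDXae⟩ := h.exists_weakFDeriv hb hn hΩ hp2 hσ hσ1 hσ0
    (T := fun _ => t) (S := fun s => s) measurable_const measurable_id (fun _ _ => ht)
    (fun _ hs => hs) hC₀ (fun C' hC' => (hE hC').mono fun k hk =>
      (setLIntegral_le_lintegral _ _).trans hk)
  set Λ₁ := ∫⁻ r in Ioo t₀ t₁, ∫⁻ y in Ω, ENNReal.ofReal (Real.exp (a * ‖B r y‖))
  set C₁ := Λ₁ ^ (1 / (p / (p - n))) * (C₀ + 1) ^ (1 / (p / n))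
  have hC₁ : C₁ ≠ ⊤ := ENNReal.mul_ne_top
    (ENNReal.rpow_ne_top_of_nonneg (one_div_nonneg.2 hPQ.nonneg) hexp)
    (ENNReal.rpow_ne_top_of_nonneg (one_div_nonneg.2 hPQ.symm.nonneg) (by simp [hC₀]))
  obtain ⟨DY, hDY, -, hDYae⟩ := h.exists_weakFDeriv hb hn hΩ hp2 hσ hσ1 hσ0
    (T := fun s => s) (S := fun _ => t) measurable_id measurable_const (fun _ hs => hs)
    (fun _ _ => ht) hC₁ (fun C' hC' => by
      filter_upwards [hE (ENNReal.lt_add_right hC₀ one_ne_zero)] with k hk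
      obtain ⟨L, K, hT⟩ := h.exists_isTaylorField (pow_pos (hσ k) 4)
      refine (setLIntegral_le_lintegral _ _).trans (le_trans ?_ hC'.le)
      refine (hT.lintegral_flow_from_le hn hp isOpen_Ioo ordConnected_Ioo (isOpen_core h.isOpen _)
        (isOpen_core h.isOpen _) Real.volume_Ioo (sub_nonneg.2 h.lt.le) t).trans ?_
      refine mul_le_mul' (ENNReal.rpow_le_rpow ?_ (one_div_nonneg.2 hPQ.nonneg))
        (ENNReal.rpow_le_rpow hk (one_div_nonneg.2 hPQ.symm.nonneg))
      have key := h.lintegral_admInd_mul_exp_le (V := core Ω (σ k)) (hσ k) (hσ1 k) rfl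
        (u := fun _ _ => 1) (w := fun _ => 1) measurable_const fun _ _ _ _ _ => le_rfl
      rw [← ha]
      simpa only [mul_one, one_mul] using key)
  refine ⟨?_, DX, hDX, hDXae.mono fun s hs => hs.1, le_trans ?_ hDXC⟩
  · filter_upwards [hDXae, hDYae] with s h1 h2
    exact ⟨⟨h.memLp_flow hb hΩ t s _, _, h1.1, h1.2⟩, ⟨h.memLp_flow hb hΩ s t _, _, h2.1, h2.2⟩⟩
  · exact lintegral_mono fun s => lintegral_mono_set flowDomain_subset

end ExpSobolevField

end SobolevFlow

/-! ### Bounded Sobolev fields satisfying the geometric condition -/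

section Assembly

local notation "𝔼" n => EuclideanSpace ℝ (Fin n)

variable {n : ℕ}

theorem LocallyIntegrableOn.congr_ae {E : Type*} [NormedAddCommGroup E] {U : Set (𝔼 n)}
    {u u' : (𝔼 n) → E} (h : LocallyIntegrableOn u U volume)
    (hu : u =ᵐ[volume.restrict U] u') : LocallyIntegrableOn u' U volume := by
  intro x hx
  obtain ⟨V, hV, hi⟩ := h x hx
  refine ⟨V ∩ U, inter_mem hV self_mem_nhdsWithin, ?_⟩
  exact (hi.mono_set inter_subset_left).congr
    (ae_restrict_of_ae_restrict_of_subset inter_subset_right hu)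

theorem HasWeakFDerivOn.congr_ae {U : Set (𝔼 n)} {u u' : (𝔼 n) → 𝔼 n}
    {Du Du' : (𝔼 n) → (𝔼 n) →L[ℝ] 𝔼 n} (hU : MeasurableSet U) (h : HasWeakFDerivOn U u Du)
    (hu : u =ᵐ[volume.restrict U] u') (hDu : Du =ᵐ[volume.restrict U] Du') :
    HasWeakFDerivOn U u' Du' := by
  refine ⟨LocallyIntegrableOn.congr_ae h.locInt hu,
    LocallyIntegrableOn.congr_ae h.locInt_deriv hDu, fun φ hφ hφc hφs v => ?_⟩
  have h1 := h.integral_eq φ hφ hφc hφs v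
  have e1 : ∫ x, (fderiv ℝ φ x v) • u x = ∫ x, (fderiv ℝ φ x v) • u' x := by
    refine integral_congr_ae ?_
    filter_upwards [(ae_restrict_iff' hU).1 hu] with x hx
    by_cases hxs : x ∈ tsupport φ
    · rw [hx (hφs hxs)]
    · have : fderiv ℝ φ x = 0 := by
        by_contra hne
        exact hxs (support_fderiv_subset ℝ hne)
      simp [this]
  have e2 : ∫ x, φ x • Du x v = ∫ x, φ x • Du' x v := by
    refine integral_congr_ae ?_
    filter_upwards [(ae_restrict_iff' hU).1 hDu] with x hx
    by_cases hxs : x ∈ tsupport φ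
    · rw [hx (hφs hxs)]
    · simp [image_eq_zero_of_notMem_tsupport hxs]
  rw [← e1, ← e2, h1]

variable {t₀ t₁ : ℝ} {Ω : Set (𝔼 n)} {b : ℝ → (𝔼 n) → 𝔼 n} {Db : ℝ → (𝔼 n) → (𝔼 n) →L[ℝ] 𝔼 n}
  {p : ℝ}

theorem restrict_prod_eq (I : Set ℝ) (Ω : Set (𝔼 n)) :
    (volume : Measure (ℝ × 𝔼 n)).restrict (I ×ˢ Ω) =
      (volume.restrict I).prod (volume.restrict Ω) := by
  rw [Measure.prod_restrict, Measure.volume_eq_prod]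

/-- An essentially bounded field has a Borel representative, extended by zero, that is bounded
everywhere by the essential supremum. -/
theorem exists_bounded_representative (hΩ : IsOpen Ω)
    (hb : LocallyIntegrableOn (uncurry b) (Ioo t₀ t₁ ×ˢ Ω) volume) {M : ℝ≥0∞} (hM : M ≠ ⊤)
    (hbM : eLpNorm (uncurry b) ⊤ (volume.restrict (Ioo t₀ t₁ ×ˢ Ω)) ≤ M) :
    ∃ β : ℝ → (𝔼 n) → 𝔼 n, Measurable (uncurry β) ∧ (∀ t y, ‖β t y‖ ≤ M.toReal) ∧
      (∀ t y, y ∉ Ω → β t y = 0) ∧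
      ∀ᵐ t ∂(volume.restrict (Ioo t₀ t₁)), b t =ᵐ[volume.restrict Ω] β t := by
  have hm := hb.aestronglyMeasurable
  set g := hm.mk (uncurry b)
  have hg : Measurable g := hm.stronglyMeasurable_mk.measurable
  set S : Set (ℝ × 𝔼 n) := {z | z.2 ∈ Ω ∧ ‖g z‖ ≤ M.toReal}
  have hS : MeasurableSet S := (hΩ.measurableSet.preimage measurable_snd).inter
    (measurableSet_le hg.norm measurable_const)
  refine ⟨fun t y => S.indicator g (t, y), hg.indicator hS, fun t y => ?_, fun t y hy => ?_, ?_⟩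
  · dsimp only
    by_cases h : (t, y) ∈ S
    · rw [indicator_of_mem h]; exact h.2
    · rw [indicator_of_notMem h, norm_zero]; exact ENNReal.toReal_nonneg
  · exact indicator_of_notMem (fun h => hy h.1) _
  · have h1 : ∀ᵐ z ∂(volume.restrict (Ioo t₀ t₁ ×ˢ Ω)), uncurry b z = S.indicator g z := by
      rw [eLpNorm_exponent_top] at hbM
      filter_upwards [hm.ae_eq_mk, ae_le_eLpNormEssSup (f := uncurry b),
        ae_restrict_mem (measurableSet_Ioo.prod hΩ.measurableSet)] with z hz hz' hzI
      rw [indicator_of_mem (show z ∈ S from ⟨hzI.2, ?_⟩), hz]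
      rw [← show uncurry b z = g z from hz, ← toReal_enorm]
      exact ENNReal.toReal_mono hM (hz'.trans hbM)
    rw [restrict_prod_eq] at h1
    exact Measure.ae_ae_of_ae_prod h1

/-- The exponential integral is finite if the one with the geometric weight is. -/
theorem lintegral_le_of_geometricWeight {ℓ α : ℝ} (hℓ : 0 < ℓ) {M : ℝ≥0∞} {I : Set ℝ}
    {E : ℝ → (𝔼 n) → ℝ≥0∞}
    (h : ∫⁻ r in I, ∫⁻ y in Ω, geometricWeight Ω ℓ M α y * E r y ≠ ⊤) :
    ∫⁻ r in I, ∫⁻ y in Ω, E r y ≠ ⊤ := by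
  have h0 : ENNReal.ofReal ℓ ≠ 0 := by simpa using hℓ
  have h1 : ENNReal.ofReal ℓ ^ α ≠ 0 := (ENNReal.rpow_pos h0.bot_lt ENNReal.ofReal_ne_top).ne'
  have h2 : ENNReal.ofReal ℓ ^ α ≠ ⊤ := ENNReal.rpow_ne_top_of_ne_zero h0 ENNReal.ofReal_ne_top
  have h3 : ENNReal.ofReal ℓ ^ α * ∫⁻ r in I, ∫⁻ y in Ω, E r y ≤
      ∫⁻ r in I, ∫⁻ y in Ω, geometricWeight Ω ℓ M α y * E r y := by
    rw [← lintegral_const_mul' _ _ h2]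
    refine lintegral_mono fun r => ?_
    rw [← lintegral_const_mul' _ _ h2]
    exact lintegral_mono fun y => mul_le_mul_left (le_max_left _ _) _
  intro htop
  rw [htop, ENNReal.mul_top h1] at h3
  exact h (top_unique h3)

/-- A bounded Sobolev field satisfying the geometric condition is represented by an exponentially
Sobolev field. -/
theorem exists_expSobolevField (hI : t₀ < t₁) (hΩ : IsOpen Ω) (hΩb : Bornology.IsBounded Ω)
    (hb : MemL1locW11loc (Ioo t₀ t₁) Ω b Db)
    (hbdd : eLpNorm (uncurry b) ⊤ (volume.restrict (Ioo t₀ t₁ ×ˢ Ω)) < ⊤)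
    (hp0 : 0 < p) (hp : (n : ℝ) < p)
    (hΛ : geometricConst (Ioo t₀ t₁) (t₁ - t₀) Ω p b Db < ⊤) :
    ∃ β B M R F, ExpSobolevField t₀ t₁ Ω β B M R ((t₁ - t₀) * p ^ 2 / (p - n)) F ∧
      (∀ᵐ t ∂(volume.restrict (Ioo t₀ t₁)), b t =ᵐ[volume.restrict Ω] β t) ∧
      ∫⁻ r in Ioo t₀ t₁, ∫⁻ y in Ω,
        geometricWeight Ω (t₁ - t₀) (ENNReal.ofReal M) ((n : ℝ) / (n - p)) y *
          ENNReal.ofReal (Real.exp ((t₁ - t₀) * p ^ 2 / (p - n) * ‖B r y‖)) =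
        geometricConst (Ioo t₀ t₁) (t₁ - t₀) Ω p b Db := by
  have hℓ : 0 < t₁ - t₀ := sub_pos.2 hI
  set Mₑ := eLpNorm (uncurry b) ⊤ (volume.restrict (Ioo t₀ t₁ ×ˢ Ω))
  set a := (t₁ - t₀) * p ^ 2 / (p - n)
  have ha : 0 < a := by
    have : 0 < p - n := by linarith
    positivity
  obtain ⟨β, hβm, hβM, hβ0, hβ⟩ := exists_bounded_representative hΩ hb.locInt hbdd.ne le_rfl
  have hDm := hb.locInt_deriv.aestronglyMeasurable
  set g := hDm.mk (uncurry Db)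
  have hg : Measurable g := hDm.stronglyMeasurable_mk.measurable
  have hgae : ∀ᵐ z ∂((volume.restrict (Ioo t₀ t₁)).prod (volume.restrict Ω)),
      uncurry Db z = g z := by
    rw [← restrict_prod_eq]; exact hDm.ae_eq_mk
  set B : ℝ → (𝔼 n) → (𝔼 n) →L[ℝ] 𝔼 n := fun t y => g (t, y)
  have hBm : Measurable (uncurry B) := hg
  have hE : Measurable fun z : ℝ × 𝔼 n => ENNReal.ofReal (Real.exp (a * ‖B z.1 z.2‖)) :=
    (Real.measurable_exp.comp (hg.norm.const_mul a)).ennreal_ofReal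
  have hB : ∀ᵐ t ∂(volume.restrict (Ioo t₀ t₁)), Db t =ᵐ[volume.restrict Ω] B t :=
    Measure.ae_ae_of_ae_prod hgae
  have hw := measurable_geometricWeight Ω (t₁ - t₀) Mₑ ((n : ℝ) / (n - p))
  have hΛe : ∫⁻ r in Ioo t₀ t₁, ∫⁻ y in Ω,
        geometricWeight Ω (t₁ - t₀) Mₑ ((n : ℝ) / (n - p)) y *
          ENNReal.ofReal (Real.exp (a * ‖B r y‖)) =
        geometricConst (Ioo t₀ t₁) (t₁ - t₀) Ω p b Db := by
    rw [lintegral_lintegral_swap]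
    swap
    · exact ((hw.comp measurable_snd).mul hE).aemeasurable
    have h1 : ∀ᵐ z ∂((volume.restrict Ω).prod (volume.restrict (Ioo t₀ t₁))),
        uncurry Db z.swap = g z.swap :=
      Measure.measurePreserving_swap.quasiMeasurePreserving.ae hgae
    refine lintegral_congr_ae ?_
    filter_upwards [Measure.ae_ae_of_ae_prod h1] with x hx
    refine lintegral_congr_ae ?_
    filter_upwards [hx] with s hs
    have : Db s x = B s x := hs
    rw [this]
    rfl
  have hfin : ∫⁻ r in Ioo t₀ t₁, ∫⁻ y in Ω, ENNReal.ofReal (Real.exp (a * ‖B r y‖)) ≠ ⊤ :=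
    lintegral_le_of_geometricWeight hℓ (hΛe.trans_ne hΛ.ne)
  have hEm : Measurable fun r => ∫⁻ y in Ω, ENNReal.ofReal (Real.exp (a * ‖B r y‖)) :=
    Measurable.lintegral_prod_right' hE
  have hvol : volume Ω ≠ ⊤ := hΩb.measure_lt_top.ne
  have hM0 : 0 ≤ Mₑ.toReal := ENNReal.toReal_nonneg
  have hβi : ∀ t, Integrable (β t) := fun t => by
    have h1 : IntegrableOn (β t) Ω := by
      refine Measure.integrableOn_of_bounded hvol
        hβm.of_uncurry_left.aestronglyMeasurable (M := Mₑ.toReal) (Eventually.of_forall (hβM t))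
    exact (integrableOn_iff_integrable_of_support_subset
      (fun y hy => by_contra fun hyΩ => hy (hβ0 t y hyΩ))).1 h1
  refine ⟨β, B, Mₑ.toReal, Mₑ.toReal * volume.real Ω,
    fun r => (∫⁻ y in Ω, ENNReal.ofReal (Real.exp (a * ‖B r y‖))).toReal,
    ⟨hI, hΩ, hβm, hβM, hβi, fun t => ?_, ?_, fun t => ENNReal.toReal_nonneg, ?_, ha, ?_⟩,
    hβ, ?_⟩
  · have h1 : ∫ y, ‖β t y‖ = ∫ y in Ω, ‖β t y‖ :=
      (setIntegral_eq_integral_of_forall_compl_eq_zero fun y hy => by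
        rw [hβ0 t y hy, norm_zero]).symm
    rw [h1]
    refine (le_abs_self _).trans ?_
    rw [← Real.norm_eq_abs]
    exact norm_setIntegral_le_of_norm_le_const hvol.lt_top fun y _ => by
      rw [norm_norm]; exact hβM t y
  · rw [integrableOn_Icc_iff_integrableOn_Ioo]
    exact integrable_toReal_of_lintegral_ne_top hEm.aemeasurable hfin
  · rw [← ae_restrict_iff' measurableSet_Icc, ← restrict_Ioo_eq_restrict_Icc]
    filter_upwards [hb.weakDeriv, hβ, hB, ae_lt_top hEm hfin] with t h1 h2 h3 h4
    exact ⟨hΩ, hβm.of_uncurry_left, hβi t, hβM t, hBm.of_uncurry_left,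
      h1.congr_ae hΩ.measurableSet h2 h3, ha, ENNReal.toReal_nonneg,
      (ENNReal.ofReal_toReal h4.ne).ge⟩
  -- `4 n ℓ ≤ ℓ p² / (p - n)` amounts to `(p - 2 n)² ≥ 0`
  · rw [le_div_iff₀ (by linarith)]
    nlinarith [mul_nonneg hℓ.le (sq_nonneg (p - 2 * n))]
  · rw [ENNReal.ofReal_toReal hbdd.ne]
    exact hΛe

theorem IsSpaceContinuousRep.isRep {β b' : ℝ → (𝔼 n) → 𝔼 n}
    (hβ : ∀ᵐ t ∂(volume.restrict (Ioo t₀ t₁)), b t =ᵐ[volume.restrict Ω] β t)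
    (h : IsSpaceContinuousRep (Ioo t₀ t₁) Ω b b') : ExpSobolevField.IsRep t₀ t₁ Ω β b' := by
  rw [ExpSobolevField.IsRep, ← ae_restrict_iff' measurableSet_Icc, ← restrict_Ioo_eq_restrict_Icc]
  filter_upwards [h, hβ] with t h1 h2
  exact ⟨h1.1, h1.2.trans h2⟩

theorem ExpSobolevField.exists_isSpaceContinuousRep {β : ℝ → (𝔼 n) → 𝔼 n}
    {B : ℝ → (𝔼 n) → (𝔼 n) →L[ℝ] 𝔼 n} {M R a : ℝ} {F : ℝ → ℝ}
    (h : ExpSobolevField t₀ t₁ Ω β B M R a F)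
    (hβ : ∀ᵐ t ∂(volume.restrict (Ioo t₀ t₁)), b t =ᵐ[volume.restrict Ω] β t) :
    ∃ b', IsSpaceContinuousRep (Ioo t₀ t₁) Ω b b' := by
  have h1 : ∀ᵐ t ∂(volume.restrict (Ioo t₀ t₁)), ∃ g : (𝔼 n) → 𝔼 n,
      ContinuousOn g Ω ∧ g =ᵐ[volume.restrict Ω] b t := by
    have h2 : ∀ᵐ t ∂(volume.restrict (Ioo t₀ t₁)), ExpSobolev Ω (β t) (B t) M a (F t) := by
      rw [restrict_Ioo_eq_restrict_Icc, ae_restrict_iff' measurableSet_Icc]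
      exact h.ae
    filter_upwards [h2, hβ] with t h3 h4
    obtain ⟨g, hg, hg'⟩ := h3.exists_continuousOn
    exact ⟨g, hg, EventuallyEq.trans hg' h4.symm⟩
  choose! b' hb' using fun (t : ℝ) (ht : ∃ g : (𝔼 n) → 𝔼 n,
    ContinuousOn g Ω ∧ g =ᵐ[volume.restrict Ω] b t) => ht
  exact ⟨b', h1.mono hb'⟩

end Assembly

theorem mainTheorem4 (n : ℕ) (hn : 1 ≤ n) (t₀ t₁ : ℝ) (hI : t₀ < t₁)
    (Ω : Set (EuclideanSpace ℝ (Fin n))) (hΩ : IsOpen Ω) (hΩb : Bornology.IsBounded Ω)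
    (b : ℝ → EuclideanSpace ℝ (Fin n) → EuclideanSpace ℝ (Fin n))
    (Db : ℝ → EuclideanSpace ℝ (Fin n) →
      EuclideanSpace ℝ (Fin n) →L[ℝ] EuclideanSpace ℝ (Fin n))
    (hb : MemL1locW11loc (Ioo t₀ t₁) Ω b Db)
    (hbdd : eLpNorm (Function.uncurry b) ⊤ (volume.restrict (Ioo t₀ t₁ ×ˢ Ω)) < ⊤)
    (p : ℝ) (hp : 2 * (n : ℝ) < p)
    (hΛ : geometricConst (Ioo t₀ t₁) (t₁ - t₀) Ω p b Db < ⊤) :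
    -- a space-continuous representative exists
    (∃ b', IsSpaceContinuousRep (Ioo t₀ t₁) Ω b b') ∧
    ∀ b', IsSpaceContinuousRep (Ioo t₀ t₁) Ω b b' →
      -- it is well-posed in the closed time interval
      WellPosed b' (Icc t₀ t₁) Ω ∧
      -- the domains of the flow maps are open
      (∀ t ∈ Ioo t₀ t₁, ∀ s ∈ Ioo t₀ t₁, IsOpen (flowDomain b' (Ioo t₀ t₁) Ω t s)) ∧
      ∀ t ∈ Ioo t₀ t₁,
        -- Sobolev regularity of the flow
        (∀ᵐ s ∂(volume.restrict (Ioo t₀ t₁)),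
          MemW1p (flowDomain b' (Ioo t₀ t₁) Ω t s) p (flow b' (Ioo t₀ t₁) Ω t s) ∧
          MemW1p (flowDomain b' (Ioo t₀ t₁) Ω s t) p (flow b' (Ioo t₀ t₁) Ω s t)) ∧
        -- the estimate; `DX s x` is the weak derivative `D_x X(t, s, x)`
        ∃ DX : ℝ → EuclideanSpace ℝ (Fin n) →
            EuclideanSpace ℝ (Fin n) →L[ℝ] EuclideanSpace ℝ (Fin n),
          AEStronglyMeasurable (Function.uncurry DX) (volume.restrict
            {z : ℝ × EuclideanSpace ℝ (Fin n) |
              z.1 ∈ Ioo t₀ t₁ ∧ z.2 ∈ flowDomain b' (Ioo t₀ t₁) Ω t z.1}) ∧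
          (∀ᵐ s ∂(volume.restrict (Ioo t₀ t₁)),
            HasWeakFDerivOn (flowDomain b' (Ioo t₀ t₁) Ω t s)
              (flow b' (Ioo t₀ t₁) Ω t s) (DX s)) ∧
          ∫⁻ s in Ioo t₀ t₁, ∫⁻ x in flowDomain b' (Ioo t₀ t₁) Ω t s, ‖DX s x‖ₑ ^ p ≤
            ENNReal.ofReal (t₁ - t₀) ^ ((n : ℝ) / (p - n)) *
              geometricConst (Ioo t₀ t₁) (t₁ - t₀) Ω p b Db := by
  have hn1 : (1 : ℝ) ≤ n := by exact_mod_cast hn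
  have hpn : (n : ℝ) < p := by linarith
  obtain ⟨β, B, M, R, F, h, hβ, hΛe⟩ :=
    exists_expSobolevField hI hΩ hΩb hb hbdd (by linarith) hpn hΛ
  refine ⟨h.exists_isSpaceContinuousRep hβ, fun b' hb' => ?_⟩
  have hrep := hb'.isRep hβ
  refine ⟨h.wellPosed hrep, fun t _ s _ => h.isOpen_flowDomain hrep t s, fun t ht => ?_⟩
  obtain ⟨h1, DX, hDX, h2, h3⟩ := h.exists_weakFDeriv_flow hrep hn hΩb hpn (by linarith) rfl hΛ.ne
    hΛe (lintegral_le_of_geometricWeight (sub_pos.2 hI) (hΛe.trans_ne hΛ.ne)) ht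
  exact ⟨h1, DX, hDX.aestronglyMeasurable, h2, h3⟩
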